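/- Fix $\epsilon>0$ and an integer $q\ge 2$. For integers $d,n\ge 1$ let $\Lambda_n=\{0,\dots,n-1\}^d$ and let $(\sigma_v)_{v\in\Lambda_n}$ be i.i.d. labels, uniform on $\{1,\dots,q\}$. For an integer $1\le r\le n$, the empirical profile of $\sigma$ is the multiset of the labelings of $\Lambda_r$ obtained by restricting $\sigma$ to each of the $r$-boxes $c+\{0,\dots,r-1\}^d\subset\Lambda_n$ and translating it back to $\Lambda_r$. The labeling $\sigma$ is identifiable if no other labeling of $\Lambda_n$ has the same empirical profile, and non-identifiable otherwise. Below, $r=r(n)$ is an arbitrary sequence of integers with $1\le r\le n$ (for all large $n$), and limits are taken for $d$, $q$, $\epsilon$ fixed and $n\to\infty$. (1) Let $d=1$. With probability tending to $1$, the labeling is identifiable if $r\ge \frac{2(1+\epsilon)\log n}{\log q}$ for all large $n$, and non-identifiable if $r\le \frac{2(1-\epsilon)\log n}{\log q}$ for all large $n$. (2) Let $d\ge 2$. With probability tending to $1$, the labeling is identifiable if $r^d\ge \frac{d(1+\epsilon)\log n}{\log q}$ for all large $n$, and non-identifiable if $r^d\le \frac{d(1-\epsilon)\log n}{\log q}$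 for all large $n$. (3) For every $d\ge 1$ there are an algorithm (a program for a unit-cost random access machine with addition and subtraction) and a polynomial $p$ such that, given $n$, $1\le r\le n$ and the empirical profile of any labeling of $\Lambda_n$, listed in an arbitrary order, the algorithm halts within $p(n)$ steps, and such that for every sequence $r=r(n)$ in the identifiable regime of (1) (if $d=1$) or of (2) (if $d\ge 2$), with probability tending to $1$ its output is $\sigma$, whatever the order in which the profile is listed. -/

import Mathlib

open MeasureTheory ProbabilityTheory Filter Topology

namespace Shotgun

/-! ### Labelings of boxes and their empirical profiles -/

/-- Labelings of the box `Λ_n = {0, …, n-1}^d` by `q` labels (represented as `0, …, q-1`). -/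
abbrev Labeling (d n q : ℕ) : Type := (Fin d → Fin n) → Fin q

/-- The `r`-boxes contained in `Λ_n`, each given by its smallest corner `c`; the box itself is
`c + {0, …, r-1}^d`. -/
abbrev Box (d n r : ℕ) : Type := {c : Fin d → Fin n // ∀ i, (c i : ℕ) + r ≤ n}

/-- The labels that `σ` puts on the box `B`, translated back to `Λ_r`. -/
def restrict {d n q r : ℕ} (σ : Labeling d n q) (B : Box d n r) : Labeling d r q :=
  fun x => σ fun i => ⟨(B.1 i : ℕ) + (x i : ℕ), by have := B.2 i; omega⟩

/-- The empirical profile of `σ`: the multiset of the patterns on all `r`-boxes. -/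
def profile {d n q : ℕ} (r : ℕ) (σ : Labeling d n q) : Multiset (Labeling d r q) :=
  (Finset.univ : Finset (Box d n r)).val.map (restrict σ)

/-- `σ` is identifiable: no other labeling of `Λ_n` has the same empirical profile. -/
def Identifiable {d n q : ℕ} (r : ℕ) (σ : Labeling d n q) : Prop :=
  ∀ σ' : Labeling d n q, profile r σ' = profile r σ → σ' = σ

/-- The law of i.i.d. labels, uniform on the `q` labels. -/
noncomputable def labelLaw (d n q : ℕ) : Measure (Labeling d n q) :=
  Measure.pi fun _ => uniformOn (Set.univ : Set (Fin q))

/-- The sequence `r` of box sizes satisfies `(r n)^d ≥ c (1 + ε) log n / log q`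
(for all large `n`); the `r`-boxes have to fit into `Λ_n`. -/
def AboveThreshold (d q : ℕ) (c ε : ℝ) (r : ℕ → ℕ) : Prop :=
  ∀ᶠ n : ℕ in atTop, 1 ≤ r n ∧ r n ≤ n ∧
    c * (1 + ε) * Real.log n / Real.log q ≤ (r n : ℝ) ^ d

/-- The sequence `r` of box sizes satisfies `(r n)^d ≤ c (1 - ε) log n / log q`
(for all large `n`). -/
def BelowThreshold (d q : ℕ) (c ε : ℝ) (r : ℕ → ℕ) : Prop :=
  ∀ᶠ n : ℕ in atTop, 1 ≤ r n ∧
    (r n : ℝ) ^ d ≤ c * (1 - ε) * Real.log n / Real.log q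

/-- The property `E` (for box size `r n`) of a random labeling of `Λ_n` has probability tending
to `1` as `n → ∞`. -/
def WithHighProbability (d q : ℕ) (E : ∀ n : ℕ, Labeling d n q → Prop) : Prop :=
  Tendsto (fun n => labelLaw d n q {σ | E n σ}) atTop (𝓝 1)

/-! ### A random access machine with a step count

The machine has registers and memory arrays (a program refers to finitely many of each), all of
which hold natural numbers. The instructions are those of the usual unit-cost random access machine
with addition and truncated subtraction (no multiplication). -/

/-- A state of the machine: `reg i` is the content of register `i`, and `arr a k` is the content
of cell `k` of array `a`. -/
structure State where
  reg : ℕ → ℕ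
  arr : ℕ → ℕ → ℕ

/-- Writes `v` into register `i`. -/
def State.setReg (s : State) (i v : ℕ) : State :=
  { s with reg := Function.update s.reg i v }

/-- Writes `v` into cell `k` of array `a`. -/
def State.setArr (s : State) (a k v : ℕ) : State :=
  { s with arr := Function.update s.arr a (Function.update (s.arr a) k v) }

/-- Programs. -/
inductive Program : Type
  /-- do nothing -/
  | skip : Program
  /-- `reg i := k` -/
  | const (i k : ℕ) : Program
  /-- `reg i := reg j` -/
  | copy (i j : ℕ) : Program
  /-- `reg i := reg j + reg k` -/
  | add (i j k : ℕ) : Program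
  /-- `reg i := reg j - reg k`, truncated at `0` -/
  | sub (i j k : ℕ) : Program
  /-- `reg i := arr a (reg j)` -/
  | load (i a j : ℕ) : Program
  /-- `arr a (reg i) := reg j` -/
  | store (a i j : ℕ) : Program
  /-- first `P`, then `Q` -/
  | seq (P Q : Program) : Program
  /-- if `reg i ≠ 0` then `P`, else `Q` -/
  | ite (i : ℕ) (P Q : Program) : Program
  /-- while `reg i ≠ 0` repeat `P` -/
  | loop (i : ℕ) (P : Program) : Program

/-- `Run P s t s'`: started in state `s`, the program `P` halts in state `s'` after exactly `t`
steps. Every elementary instruction and every test of a register is one step. -/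
inductive Run : Program → State → ℕ → State → Prop
  | skip (s : State) : Run .skip s 1 s
  | const (i k : ℕ) (s : State) : Run (.const i k) s 1 (s.setReg i k)
  | copy (i j : ℕ) (s : State) : Run (.copy i j) s 1 (s.setReg i (s.reg j))
  | add (i j k : ℕ) (s : State) : Run (.add i j k) s 1 (s.setReg i (s.reg j + s.reg k))
  | sub (i j k : ℕ) (s : State) : Run (.sub i j k) s 1 (s.setReg i (s.reg j - s.reg k))
  | load (i a j : ℕ) (s : State) : Run (.load i a j) s 1 (s.setReg i (s.arr a (s.reg j)))
  | store (a i j : ℕ) (s : State) : Run (.store a i j) s 1 (s.setArr a (s.reg i) (s.reg j))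
  | seq {P Q : Program} {s s' s'' : State} {t t' : ℕ} :
      Run P s t s' → Run Q s' t' s'' → Run (.seq P Q) s (t + t') s''
  | iteTrue {i : ℕ} {P Q : Program} {s s' : State} {t : ℕ} :
      s.reg i ≠ 0 → Run P s t s' → Run (.ite i P Q) s (t + 1) s'
  | iteFalse {i : ℕ} {P Q : Program} {s s' : State} {t : ℕ} :
      s.reg i = 0 → Run Q s t s' → Run (.ite i P Q) s (t + 1) s'
  | loopDone {i : ℕ} {P : Program} {s : State} :
      s.reg i = 0 → Run (.loop i P) s 1 s
  | loopStep {i : ℕ} {P : Program} {s s' s'' : State} {t t' : ℕ} :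
      s.reg i ≠ 0 → Run P s t s' → Run (.loop i P) s' t' s'' →
      Run (.loop i P) s (t + t' + 1) s''

/-! ### Recovery of a labeling from its profile -/

/-- The labels of `w`, listed so that the vertex `x` has position `∑ i, x i * n ^ i`. -/
def labelList {d n q : ℕ} (w : Labeling d n q) : List ℕ :=
  List.ofFn fun k : Fin (n ^ d) => (w (finFunctionFinEquiv.symm k) : ℕ)

/-- The initial state for the input `n`, `r` and a list `L` of patterns: the registers `0` and `1`
hold `n` and `r`, array `0` holds the patterns one after the other, all else is `0`. -/
def inputState {d q r : ℕ} (n : ℕ) (L : List (Labeling d r q)) : State where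
  reg i := if i = 0 then n else if i = 1 then r else 0
  arr a k := if a = 0 then (L.flatMap labelList).getD k 0 else 0

/-- In the state `s`, array `1` holds the labeling `σ`. -/
def State.Outputs {d n q : ℕ} (s : State) (σ : Labeling d n q) : Prop :=
  ∀ v : Fin d → Fin n, s.arr 1 (finFunctionFinEquiv v : ℕ) = (σ v : ℕ)

/-- The labeling can be recovered from its profile by a polynomial-time algorithm in the regime
`R`: there are a program and a polynomial `p` such that, for every `n`, every `1 ≤ r ≤ n` and every
labeling of `Λ_n`, the program, given `n`, `r` and the patterns on the `r`-boxes in an arbitrary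
order, halts within `p n` steps; and for every sequence `r` of box sizes in the regime `R`, with
probability tending to `1` the output is the labeling (whatever the order of the patterns). -/
def RecoverableInPolyTime (d q : ℕ) (R : (ℕ → ℕ) → Prop) : Prop :=
  ∃ (P : Program) (p : Polynomial ℕ),
    (∀ (n r : ℕ), 1 ≤ r → r ≤ n → ∀ (σ : Labeling d n q) (L : List (Labeling d r q)),
      (L : Multiset (Labeling d r q)) = profile r σ →
        ∃ t ≤ p.eval n, ∃ s, Run P (inputState n L) t s) ∧
    ∀ r : ℕ → ℕ, R r → WithHighProbability d q fun n σ =>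
      ∀ L : List (Labeling d (r n) q), (L : Multiset (Labeling d (r n) q)) = profile (r n) σ →
        ∃ t ≤ p.eval n, ∃ s, Run P (inputState n L) t s ∧ s.Outputs σ

end Shotgun

/-!
The threshold is governed by repetitions. The core of an `r`-box is the box without its outermost
layer; call a box bad (`badSites`) if the labels on its core reappear on some other translate of
the core. A labeling is `Fillable` if the corner box is good and if every set of vertices that
contains the corner box, and contains each good box whose core it contains, is everything. The
proof has three parts.

**Fillable labelings are recovered.** `reconstruct` finds the pattern of the corner box, which is
the only box that has no neighbour one step down in any direction; the patterns show this, as the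
corner box is good (`Describes.numShiftedFits_eq_zero_iff`). It then sweeps over all positions and
writes down a pattern wherever at most one pattern agrees with the labels known so far. The right
pattern always agrees, so nothing wrong is written; a good box with known core is completed, so
the known region is closed after `n ^ d` sweeps, hence everything (`Describes.finalLabels_eq`). As
the program sees only the profile, distinct fillable labelings have distinct profiles
(`Fillable.eq_of_profile_eq`); by counting, this gives identifiability with high probability
(`identifiable_of_injOn`).

**Above the threshold, labelings are fillable.** For `d = 1` a union bound shows that there is no
bad box at all (`fillable_whp_one`). For `d ≥ 2` bad boxes exist, but they are rare: near the corners of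
`Λ_n` there is none, a window whose side is a large multiple of `r` meets only a bounded number of
disjoint ones, and no `r` successive translates of a box along an axis are all bad. A vertex never
reached would lie in a room walled by slices without bad boxes, and the boxes that meet the missing
region only in an extremal vertex would all be bad (`ClosedUnder.eq_of_mostlyClean`). The union bounds
are collected in `prob_not_fillable_le`, and `fillable_whp_of_two_le` lets `n` tend to infinity.

**Below the threshold, labelings are not identifiable.** For `d ≥ 2` there are far fewer profiles than
labelings (`prob_identifiable_le`, `not_identifiable_whp`). For `d = 1`, counting loses a factor `2`;
there, two words of length `r - 1` occur interleaved, `x … y … x … y`, by a second moment argument,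
and exchanging the two segments from an `x` to the next `y` changes the labeling but not the profile
(`not_identifiable_of_interleaved`, `not_identifiable_whp_one`).
-/

namespace Shotgun

/-! ### Counting labelings -/

/-- The proportion of the labelings of `Λ_n` that satisfy `E`, that is, the probability of `E`. -/
noncomputable def prob {d n q : ℕ} (E : Labeling d n q → Prop) : ℝ :=
  ({σ | E σ}.ncard : ℝ) / (q : ℝ) ^ n ^ d

section prob
variable {d n q : ℕ}

theorem card_labeling : Fintype.card (Labeling d n q) = q ^ n ^ d := by
  simp [Fintype.card_fin]

theorem prob_eq_card (E : Labeling d n q → Prop) [DecidablePred E] :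
    prob E = ((Finset.univ.filter E).card : ℝ) / (q : ℝ) ^ n ^ d := by
  unfold prob
  rw [← Set.ncard_coe_finset]
  simp

theorem prob_nonneg (E : Labeling d n q → Prop) : 0 ≤ prob E := by
  unfold prob; positivity

theorem prob_mono {E F : Labeling d n q → Prop} (h : ∀ σ, E σ → F σ) : prob E ≤ prob F := by
  unfold prob
  gcongr
  · exact Set.toFinite _
  · exact h _

theorem prob_le_one (E : Labeling d n q → Prop) : prob E ≤ 1 := by
  classical
  simp only [prob_eq_card]
  apply div_le_one_of_le₀ _ (by positivity)
  have := Finset.card_filter_le (Finset.univ : Finset (Labeling d n q)) E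
  rw [Finset.card_univ, card_labeling] at this
  exact_mod_cast this

theorem prob_or (E F : Labeling d n q → Prop) :
    prob (fun σ => E σ ∨ F σ) ≤ prob E + prob F := by
  classical
  simp only [prob_eq_card]
  rw [← add_div]
  gcongr
  rw [Finset.filter_or]
  exact_mod_cast Finset.card_union_le _ _

theorem prob_exists_le_sum {ι : Type*} (I : Finset ι) (E : ι → Labeling d n q → Prop) :
    prob (fun σ => ∃ i ∈ I, E i σ) ≤ ∑ i ∈ I, prob (E i) := by
  classical
  simp only [prob_eq_card]
  rw [← Finset.sum_div]
  gcongr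
  have : Finset.univ.filter (fun σ => ∃ i ∈ I, E i σ)
      = I.biUnion fun i => Finset.univ.filter (E i) := by
    ext σ; simp
  rw [this]
  exact_mod_cast Finset.card_biUnion_le

theorem prob_exists_le {ι : Type*} (I : Finset ι) (E : ι → Labeling d n q → Prop) {B : ℝ}
    (h : ∀ i ∈ I, prob (E i) ≤ B) : prob (fun σ => ∃ i ∈ I, E i σ) ≤ I.card * B := by
  refine (prob_exists_le_sum I E).trans ?_
  rw [← nsmul_eq_mul]
  exact Finset.sum_le_card_nsmul _ _ _ h

theorem prob_not (hq : 0 < q) (E : Labeling d n q → Prop) :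
    prob E = 1 - prob (fun σ => ¬ E σ) := by
  classical
  simp only [prob_eq_card]
  have h := Finset.card_filter_add_card_filter_not (s := (Finset.univ : Finset (Labeling d n q))) E
  rw [Finset.card_univ, card_labeling] at h
  have h' : ((Finset.univ.filter E).card : ℝ) + ((Finset.univ.filter fun σ => ¬ E σ).card : ℝ)
      = (q : ℝ) ^ n ^ d := by exact_mod_cast h
  have : (q : ℝ) ^ n ^ d ≠ 0 := by positivity
  field_simp
  linarith

theorem labelLaw_eq_prob (hq : 0 < q) (E : Labeling d n q → Prop) :
    labelLaw d n q {σ | E σ} = ENNReal.ofReal (prob E) := by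
  classical
  have : NeZero q := ⟨hq.ne'⟩
  have : IsProbabilityMeasure (uniformOn (Set.univ : Set (Fin q))) :=
    isProbabilityMeasure_uniformOn Set.finite_univ Set.univ_nonempty
  have hs : ∀ σ : Labeling d n q, labelLaw d n q {σ} = ENNReal.ofReal (1 / (q : ℝ) ^ n ^ d) := by
    intro σ
    unfold labelLaw
    rw [Measure.pi_singleton]
    have : ∀ a : Fin q, uniformOn (Set.univ : Set (Fin q)) {a} = ENNReal.ofReal (1 / q) := by
      intro a
      rw [uniformOn_univ]
      rw [ENNReal.ofReal_div_of_pos (by positivity)]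
      simp
    simp only [this]
    rw [Finset.prod_const, Finset.card_univ]
    rw [← ENNReal.ofReal_pow (by positivity)]
    simp
  have : {σ : Labeling d n q | E σ} =
      ((Finset.univ.filter E : Finset (Labeling d n q)) : Set _) := by
    ext; simp
  rw [this, ← sum_measure_singleton]
  simp only [hs]
  rw [Finset.sum_const, nsmul_eq_mul, prob_eq_card, ← ENNReal.ofReal_natCast,
    ← ENNReal.ofReal_mul (by positivity), mul_one_div]

/-- A property has high probability iff its failures have vanishing proportion. -/
theorem withHighProbability_iff (hq : 0 < q) (E : ∀ n : ℕ, Labeling d n q → Prop) :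
    WithHighProbability d q E ↔ Tendsto (fun n => prob fun σ => ¬ E n σ) atTop (𝓝 0) := by
  unfold WithHighProbability
  simp only [labelLaw_eq_prob hq]
  have e1 : (1 : ENNReal) = ENNReal.ofReal 1 := by simp
  rw [e1]
  constructor
  · intro h
    have h2 := (ENNReal.tendsto_toReal (by simp)).comp h
    have : Tendsto (fun n => 1 - (ENNReal.ofReal (prob (E n))).toReal) atTop (𝓝 (1 - 1)) := by
      refine tendsto_const_nhds.sub ?_
      simpa [Function.comp_def] using h2
    rw [sub_self] at this
    refine this.congr fun n => ?_
    rw [ENNReal.toReal_ofReal (prob_nonneg _), prob_not hq]; ring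
  · intro h
    have : Tendsto (fun n => 1 - prob fun σ => ¬ E n σ) atTop (𝓝 (1 - 0)) :=
      tendsto_const_nhds.sub h
    rw [sub_zero] at this
    refine ENNReal.tendsto_ofReal (this.congr fun n => ?_)
    rw [← prob_not hq]

theorem withHighProbability_of_le (hq : 0 < q) (E : ∀ n : ℕ, Labeling d n q → Prop) (b : ℕ → ℝ)
    (hb : Tendsto b atTop (𝓝 0)) (h : ∀ᶠ n in atTop, prob (fun σ => ¬ E n σ) ≤ b n) :
    WithHighProbability d q E := by
  rw [withHighProbability_iff hq]
  exact squeeze_zero' (Eventually.of_forall fun n => prob_nonneg _) h hb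

theorem WithHighProbability.mono {E F : ∀ n : ℕ, Labeling d n q → Prop} (hq : 0 < q)
    (hE : WithHighProbability d q E) (h : ∀ᶠ n in atTop, ∀ σ, E n σ → F n σ) :
    WithHighProbability d q F := by
  refine withHighProbability_of_le hq F _ ((withHighProbability_iff hq E).1 hE) ?_
  filter_upwards [h] with n hn
  exact prob_mono fun σ => mt (hn σ)

end prob

/-! ### Labelings under constraints -/

section constraints
variable {V : Type*} [Fintype V] [DecidableEq V] {q : ℕ}

/-- If the labels on `E` are functions of the labels at "parents" `f v`, and the parents decrease a
height `ρ`, then a labeling is determined by its values off `E`. -/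
theorem card_constrained_le (E : Finset V) (f : V → V) (τ : V → Fin q → Fin q)
    (ρ : V → ℤ) (hρ : ∀ v ∈ E, ρ (f v) < ρ v)
    [DecidablePred fun σ : V → Fin q => ∀ v ∈ E, σ v = τ v (σ (f v))] :
    (Finset.univ.filter fun σ : V → Fin q => ∀ v ∈ E, σ v = τ v (σ (f v))).card * q ^ E.card
      ≤ q ^ Fintype.card V := by
  have hc : Fintype.card {v // v ∉ E} + E.card = Fintype.card V := by
    rw [Fintype.card_subtype_compl]
    simp [Nat.sub_add_cancel (Finset.card_le_univ E)]
  have h1 : (Finset.univ.filter fun σ : V → Fin q => ∀ v ∈ E, σ v = τ v (σ (f v))).card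
      ≤ q ^ Fintype.card {v // v ∉ E} := by
    have : q ^ Fintype.card {v // v ∉ E} = (Finset.univ : Finset ({v // v ∉ E} → Fin q)).card := by
      rw [Finset.card_univ]; simp
    rw [this]
    refine Finset.card_le_card_of_injOn (fun σ v => σ v.1) (fun _ _ => Finset.mem_univ _) ?_
    intro σ hσ σ' hσ' h
    simp only [Finset.coe_filter, Finset.mem_univ, true_and, Set.mem_ofPred_eq] at hσ hσ'
    by_contra hne
    have hS : (Finset.univ.filter fun v => σ v ≠ σ' v).Nonempty := by
      obtain ⟨v, hv⟩ := Function.ne_iff.1 hne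
      exact ⟨v, by simpa using hv⟩
    obtain ⟨v, hv, hmin⟩ := Finset.exists_min_image _ ρ hS
    simp only [Finset.mem_filter, Finset.mem_univ, true_and] at hv hmin
    by_cases hE : v ∈ E
    · apply hv
      rw [hσ v hE, hσ' v hE]
      by_cases hf : σ (f v) = σ' (f v)
      · rw [hf]
      · exact absurd (hmin _ hf) (not_le.2 (hρ v hE))
    · exact hv (congrFun h ⟨v, hE⟩)
  calc _ ≤ q ^ Fintype.card {v // v ∉ E} * q ^ E.card := by gcongr
    _ = _ := by rw [← pow_add, hc]

/-- If all parents lie off `E`, the values off `E` are arbitrary. -/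
theorem card_constrained_ge (E : Finset V) (f : V → V) (τ : V → Fin q → Fin q)
    (hf : ∀ v ∈ E, f v ∉ E) [DecidablePred fun σ : V → Fin q => ∀ v ∈ E, σ v = τ v (σ (f v))] :
    q ^ Fintype.card V ≤
    (Finset.univ.filter fun σ : V → Fin q => ∀ v ∈ E, σ v = τ v (σ (f v))).card * q ^ E.card := by
  have hc : Fintype.card {v // v ∉ E} + E.card = Fintype.card V := by
    rw [Fintype.card_subtype_compl]
    simp [Nat.sub_add_cancel (Finset.card_le_univ E)]
  have h1 : q ^ Fintype.card {v // v ∉ E} ≤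
      (Finset.univ.filter fun σ : V → Fin q => ∀ v ∈ E, σ v = τ v (σ (f v))).card := by
    have : q ^ Fintype.card {v // v ∉ E} = (Finset.univ : Finset ({v // v ∉ E} → Fin q)).card := by
      rw [Finset.card_univ]; simp
    rw [this]
    refine Finset.card_le_card_of_injOn
      (fun g v => if h : v ∈ E then τ v (g ⟨f v, hf v h⟩) else g ⟨v, h⟩) ?_ ?_
    · intro g _
      simp only [Finset.coe_filter, Finset.mem_univ, true_and, Set.mem_ofPred_eq]
      intro v hv
      rw [dif_pos hv, dif_neg (hf v hv)]
    · intro g _ g' _ h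
      funext ⟨v, hv⟩
      have := congrFun h v
      simpa [hv] using this
  calc _ = q ^ Fintype.card {v // v ∉ E} * q ^ E.card := by rw [← pow_add, hc]
    _ ≤ _ := by gcongr

end constraints

/-! ### From recovery to identifiability -/

/-- If the profile is injective on a set `S n` of labelings of high probability, then labelings are
identifiable with high probability: another labeling with the profile of a member of `S n` lies
off `S n`, and it determines that member. -/
theorem identifiable_of_injOn {d q : ℕ} (hq : 0 < q) (r : ℕ → ℕ)
    (S : ∀ n : ℕ, Labeling d n q → Prop) (hS : WithHighProbability d q S)
    (hinj : ∀ᶠ n in atTop, ∀ σ σ' : Labeling d n q, S n σ → S n σ' →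
      profile (r n) σ = profile (r n) σ' → σ = σ') :
    WithHighProbability d q fun n σ => Identifiable (r n) σ := by
  classical
  have h0 := (withHighProbability_iff hq S).1 hS
  have h2 := h0.const_mul 2
  rw [mul_zero] at h2
  refine withHighProbability_of_le hq _ _ h2 ?_
  filter_upwards [hinj] with n hn
  have key : prob (fun σ : Labeling d n q => ¬ Identifiable (r n) σ ∧ S n σ) ≤
      prob fun σ : Labeling d n q => ¬ S n σ := by
    rw [prob_eq_card, prob_eq_card]
    gcongr ?_ / _
    rw [Nat.cast_le]
    have hex : ∀ σ : Labeling d n q, ∃ σ' : Labeling d n q, ¬ Identifiable (r n) σ →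
        profile (r n) σ' = profile (r n) σ ∧ σ' ≠ σ := by
      intro σ
      by_cases h : Identifiable (r n) σ
      · exact ⟨σ, fun h' => absurd h h'⟩
      · unfold Identifiable at h
        push Not at h
        obtain ⟨σ', h1, h2⟩ := h
        exact ⟨σ', fun _ => ⟨h1, h2⟩⟩
    choose g hg using hex
    refine Finset.card_le_card_of_injOn g ?_ ?_
    · intro σ hσ
      simp only [Finset.coe_filter, Finset.mem_univ, true_and, Set.mem_ofPred_eq] at hσ ⊢
      intro h
      exact (hg σ hσ.1).2 (hn _ _ h hσ.2 (hg σ hσ.1).1)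
    · intro σ hσ σ' hσ' h
      simp only [Finset.coe_filter, Finset.mem_univ, true_and, Set.mem_ofPred_eq] at hσ hσ'
      refine hn _ _ hσ.2 hσ'.2 ?_
      rw [← (hg σ hσ.1).1, ← (hg σ' hσ'.1).1, h]
  calc _ ≤ prob (fun σ : Labeling d n q => (¬ Identifiable (r n) σ ∧ S n σ) ∨ ¬ S n σ) :=
        prob_mono fun σ h => by tauto
    _ ≤ _ := prob_or _ _
    _ ≤ _ := by linarith

/-! ### Boxes in the integer lattice -/

section lattice
variable {d : ℕ}

/-- The box `Λ_n` as a set of integer points. -/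
noncomputable def vertices (d n : ℕ) : Finset (Fin d → ℤ) :=
  Fintype.piFinset fun _ => Finset.Ico 0 (n : ℤ)

/-- The `r`-box with smallest corner `c`. -/
noncomputable def cube (r : ℕ) (c : Fin d → ℤ) : Finset (Fin d → ℤ) :=
  Fintype.piFinset fun i => Finset.Ico (c i) (c i + r)

/-- The `r`-box with smallest corner `c`, without its outermost layer. It is contained in all
`r`-boxes obtained from this one by moving it one step along an axis. -/
noncomputable def core (r : ℕ) (c : Fin d → ℤ) : Finset (Fin d → ℤ) :=
  Fintype.piFinset fun i => Finset.Ico (c i + 1) (c i + r - 1)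

/-- `c` is the smallest corner of an `r`-box in `Λ_n`. -/
def IsSite (n r : ℕ) (c : Fin d → ℤ) : Prop := ∀ i, 0 ≤ c i ∧ c i + r ≤ n

theorem mem_vertices {n : ℕ} {v : Fin d → ℤ} : v ∈ vertices d n ↔ ∀ i, 0 ≤ v i ∧ v i < n := by
  simp [vertices]

theorem mem_cube {r : ℕ} {c v : Fin d → ℤ} : v ∈ cube r c ↔ ∀ i, c i ≤ v i ∧ v i < c i + r := by
  simp [cube]

theorem mem_core {r : ℕ} {c v : Fin d → ℤ} :
    v ∈ core r c ↔ ∀ i, c i + 1 ≤ v i ∧ v i < c i + r - 1 := by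
  simp [core]

theorem core_subset_cube (r : ℕ) (c : Fin d → ℤ) : core r c ⊆ cube r c := by
  intro v hv
  rw [mem_core] at hv
  rw [mem_cube]
  intro i
  have := hv i
  omega

theorem cube_subset_vertices {n r : ℕ} {c : Fin d → ℤ} (hc : IsSite n r c) :
    cube r c ⊆ vertices d n := by
  intro v hv
  rw [mem_cube] at hv
  rw [mem_vertices]
  intro i
  have := hv i
  have := hc i
  omega

/-! ### Spreading through the good sites -/

/-- `K` is closed under completing the `r`-box at a good site whose core lies in `K`. -/
def ClosedUnder (n r : ℕ) (Bad K : Set (Fin d → ℤ)) : Prop :=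
  ∀ c, IsSite n r c → c ∉ Bad → (∀ v ∈ core r c, v ∈ K) → ∀ v ∈ cube r c, v ∈ K

variable {n r : ℕ} {Bad K : Set (Fin d → ℤ)}

theorem ClosedUnder.step (hK : ClosedUnder n r Bad K) {c c' : Fin d → ℤ}
    (hc : ∀ v ∈ cube r c, v ∈ K) (hs : IsSite n r c') (hb : c' ∉ Bad)
    (hcc : ∀ k, c k ≤ c' k + 1 ∧ c' k ≤ c k + 1) : ∀ v ∈ cube r c', v ∈ K := by
  refine hK c' hs hb fun v hv => hc v ?_
  rw [mem_core] at hv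
  rw [mem_cube]
  intro i
  have := hv i
  have := hcc i
  omega

theorem ClosedUnder.line (hK : ClosedUnder n r Bad K) (i : Fin d) (m : ℕ) :
    ∀ {c c' : Fin d → ℤ}, (∀ v ∈ cube r c, v ∈ K) → (∀ k, k ≠ i → c k = c' k) →
      (c' i - c i).natAbs = m →
      (∀ p : Fin d → ℤ, (∀ k, min (c k) (c' k) ≤ p k ∧ p k ≤ max (c k) (c' k)) →
        IsSite n r p ∧ p ∉ Bad) →
      ∀ v ∈ cube r c', v ∈ K := by
  induction m with
  | zero =>
    intro c c' hc hk hm _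
    have : c = c' := by
      funext k
      by_cases h : k = i
      · subst h; omega
      · exact hk k h
    rwa [← this]
  | succ m ih =>
    intro c c' hc hk hm hp
    let x : ℤ := if c i < c' i then c i + 1 else c i - 1
    have hx : x = if c i < c' i then c i + 1 else c i - 1 := rfl
    have hb : ∀ k, k ≠ i → Function.update c i x k = c k := fun k h => Function.update_of_ne h _ _
    have hbi : Function.update c i x i = x := Function.update_self ..
    refine ih (c := Function.update c i x) ?_ ?_ ?_ ?_
    · have hq : ∀ k, min (c k) (c' k) ≤ Function.update c i x k ∧
          Function.update c i x k ≤ max (c k) (c' k) := by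
        intro k
        by_cases h : k = i
        · subst h; rw [hbi]; split_ifs at hx <;> omega
        · rw [hb k h]; omega
      refine hK.step hc (hp _ hq).1 (hp _ hq).2 fun k => ?_
      by_cases h : k = i
      · subst h; rw [hbi]; split_ifs at hx <;> omega
      · rw [hb k h]; omega
    · intro k h
      rw [hb k h, hk k h]
    · rw [hbi]; split_ifs at hx <;> omega
    · intro p hpp
      refine hp p fun k => ?_
      have := hpp k
      by_cases h : k = i
      · subst h; rw [hbi] at this; split_ifs at hx <;> omega
      · rw [hb k h] at this; omega

/-- If all points of the coordinate hull of `c` and `c'` are good sites, then `K` spreads from the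
box at `c` to the box at `c'`. -/
theorem ClosedUnder.path (hK : ClosedUnder n r Bad K) {c c' : Fin d → ℤ}
    (hc : ∀ v ∈ cube r c, v ∈ K)
    (hp : ∀ p : Fin d → ℤ, (∀ k, min (c k) (c' k) ≤ p k ∧ p k ≤ max (c k) (c' k)) →
        IsSite n r p ∧ p ∉ Bad) :
    ∀ v ∈ cube r c', v ∈ K := by
  classical
  have key : ∀ T : Finset (Fin d),
      ∀ v ∈ cube r (fun k => if k ∈ T then c' k else c k), v ∈ K := by
    intro T
    induction T using Finset.induction_on with
    | empty => simpa using hc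
    | insert i T hi ih =>
      refine hK.line i _ ih (fun k hk => ?_) rfl fun p hpp => hp p fun k => ?_
      · simp [hk]
      · have := hpp k
        by_cases h1 : k = i
        · subst h1; simp [hi] at this; omega
        · by_cases h2 : k ∈ T <;> simp [h1, h2] at this <;> omega
  simpa using key Finset.univ

/-- Without bad sites, `K` spreads everywhere. -/
theorem ClosedUnder.eq_of_no_bad (hK : ClosedUnder n r Bad K) (hr : 1 ≤ r) (hrn : r ≤ n)
    (h0 : ∀ v ∈ cube r (0 : Fin d → ℤ), v ∈ K) (hb : ∀ c, IsSite n r c → c ∉ Bad) :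
    ∀ v ∈ vertices d n, v ∈ K := by
  intro v hv
  rw [mem_vertices] at hv
  refine hK.path (c := 0) (c' := fun k => min (v k) (n - r)) h0 (fun p hp => ?_) v ?_
  · have : IsSite n r p := by
      intro k
      have h1 := hp k
      have := hv k
      simp only [Pi.zero_apply] at h1
      omega
    exact ⟨this, hb p this⟩
  · rw [mem_cube]
    intro k
    have := hv k
    omega

/-! ### Clean slices of windows -/

/-- The points of the window of side `l` with smallest corner `w`. -/
def InWindow (l : ℕ) (w c : Fin d → ℤ) : Prop := ∀ k, w k ≤ c k ∧ c k < w k + l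

/-- The window at `w` has no bad site whose `i`-th coordinate is `x`. -/
def Clean (Bad : Set (Fin d → ℤ)) (l : ℕ) (w : Fin d → ℤ) (i : Fin d) (x : ℤ) : Prop :=
  ∀ c ∈ Bad, InWindow l w c → c i ≠ x

/-- In every window of sites, all but `U` values of each coordinate are clean. -/
def MostlyClean (n r l U : ℕ) (Bad : Set (Fin d → ℤ)) : Prop :=
  ∀ w : Fin d → ℤ, (∀ c, InWindow l w c → IsSite n r c) → ∀ i, ∃ X : Finset ℤ, X.card ≤ U ∧
    ∀ c ∈ Bad, InWindow l w c → c i ∈ X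

/-- `K` contains the boxes at all sites in clean slices of the window at `w`. -/
def SlicesIn (K : Set (Fin d → ℤ)) (Bad : Set (Fin d → ℤ)) (r l : ℕ) (w : Fin d → ℤ) : Prop :=
  ∀ c, InWindow l w c → (∃ i, Clean Bad l w i (c i)) → ∀ v ∈ cube r c, v ∈ K

theorem exists_notMem_of_card_lt (X : Finset ℤ) (a b : ℤ) (h : (X.card : ℤ) < b - a) :
    ∃ x, a ≤ x ∧ x < b ∧ x ∉ X := by
  by_contra! hc
  have : Finset.Ico a b ⊆ X := fun x hx => by
    rw [Finset.mem_Ico] at hx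
    exact hc x hx.1 hx.2
  have := Finset.card_le_card this
  rw [Int.card_Ico] at this
  omega

theorem MostlyClean.exists_clean {l U : ℕ} (h : MostlyClean n r l U Bad) {w : Fin d → ℤ}
    (hw : ∀ c, InWindow l w c → IsSite n r c) (i : Fin d) (a b : ℤ) (hab : (U : ℤ) < b - a) :
    ∃ x, a ≤ x ∧ x < b ∧ Clean Bad l w i x := by
  obtain ⟨X, hX, hX'⟩ := h w hw i
  obtain ⟨x, h1, h2, h3⟩ := exists_notMem_of_card_lt X a b (by omega)
  refine ⟨x, h1, h2, fun c hc hcw hci => h3 ?_⟩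
  rw [← hci]
  exact hX' c hc hcw

/-- The clean slices of a window are connected: slices in different directions meet. -/
theorem slicesIn_of_mem (hd : 2 ≤ d) (hK : ClosedUnder n r Bad K) {l U : ℕ}
    (hU : MostlyClean n r l U Bad) (hl : U < l) {w : Fin d → ℤ}
    (hw : ∀ c, InWindow l w c → IsSite n r c) {c : Fin d → ℤ} (hcw : InWindow l w c)
    {i : Fin d} (hci : Clean Bad l w i (c i)) (hc : ∀ v ∈ cube r c, v ∈ K) :
    SlicesIn K Bad r l w := by
  classical
  have slice : ∀ {c c' : Fin d → ℤ} {i : Fin d}, InWindow l w c → InWindow l w c' →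
      c i = c' i → Clean Bad l w i (c i) → (∀ v ∈ cube r c, v ∈ K) → ∀ v ∈ cube r c', v ∈ K := by
    intro c c' i h1 h2 h3 h4 h5
    refine hK.path h5 fun p hp => ?_
    have hpw : InWindow l w p := fun k => by
      have := hp k; have := h1 k; have := h2 k; omega
    refine ⟨hw p hpw, fun hb => h4 p hb hpw ?_⟩
    have := hp i
    omega
  have diff : ∀ {c c' : Fin d → ℤ} {i i' : Fin d}, i ≠ i' → InWindow l w c → InWindow l w c' →
      Clean Bad l w i (c i) → Clean Bad l w i' (c' i') → (∀ v ∈ cube r c, v ∈ K) →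
      ∀ v ∈ cube r c', v ∈ K := by
    intro c c' i i' hne h1 h2 h3 h4 h5
    have hmid : InWindow l w (Function.update c' i (c i)) := fun k => by
      by_cases h : k = i
      · subst h; simpa using h1 k
      · simpa [h] using h2 k
    have := slice (c' := Function.update c' i (c i)) h1 hmid (by simp) h3 h5
    refine slice (i := i') hmid h2 ?_ ?_ this
    · simp [hne.symm]
    · simpa [hne.symm] using h4
  rintro c' hcw' ⟨i', hci'⟩
  by_cases hne : i = i'
  · have : Nontrivial (Fin d) := Fin.nontrivial_iff_two_le.2 hd
    obtain ⟨j, hj⟩ := exists_ne i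
    obtain ⟨x, hx1, hx2, hx⟩ := hU.exists_clean hw j (w j) (w j + l) (by omega)
    have hmid : InWindow l w (Function.update c j x) := fun k => by
      by_cases h : k = j
      · subst h; simpa using ⟨hx1, hx2⟩
      · simpa [h] using hcw k
    have h1 := diff (c := c) (c' := Function.update c j x) (i' := j) hj.symm hcw hmid hci
      (by simpa using hx) hc
    exact diff (i := j) (i' := i') (by rwa [← hne]) hmid hcw' (by simpa using hx) hci' h1
  · exact diff hne hcw hcw' hci hci' hc

theorem SlicesIn.shift (hd : 2 ≤ d) (hK : ClosedUnder n r Bad K) {l U : ℕ}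
    (hU : MostlyClean n r l U Bad) (hl : 2 * U + 1 < l) {w w' : Fin d → ℤ} {j : Fin d}
    (hww : w' = Function.update w j (w j + 1))
    (hw : ∀ c, InWindow l w c → IsSite n r c) (hw' : ∀ c, InWindow l w' c → IsSite n r c)
    (h : SlicesIn K Bad r l w) : SlicesIn K Bad r l w' := by
  classical
  have : Nontrivial (Fin d) := Fin.nontrivial_iff_two_le.2 hd
  obtain ⟨i, hi⟩ := exists_ne j
  obtain ⟨X, hX, hX'⟩ := hU w hw i
  obtain ⟨Y, hY, hY'⟩ := hU w' hw' i
  have := Finset.card_union_le X Y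
  obtain ⟨x, h1, h2, h3⟩ := exists_notMem_of_card_lt (X ∪ Y) (w i) (w i + l) (by omega)
  rw [Finset.mem_union, not_or] at h3
  have e1 : ∀ k, w' k = if k = j then w k + 1 else w k := by
    intro k
    rw [hww]
    by_cases h : k = j
    · subst h; simp
    · simp [h]
  have hc : InWindow l w (Function.update w' i x) := fun k => by
    by_cases h : k = i
    · subst h; simpa using ⟨h1, h2⟩
    · rw [Function.update_of_ne h, e1]
      split_ifs <;> omega
  have hc' : InWindow l w' (Function.update w' i x) := fun k => by
    by_cases h : k = i
    · subst h; rw [e1]; simpa [hi] using ⟨h1, h2⟩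
    · rw [Function.update_of_ne h]
      omega
  refine slicesIn_of_mem hd hK hU (by omega) hw' hc' (i := i) (fun p hp hpw hpi => h3.2 ?_)
    (h _ hc ⟨i, fun p hp hpw hpi => h3.1 ?_⟩)
  · rw [Function.update_self] at hpi
    rw [← hpi]; exact hY' p hp hpw
  · rw [Function.update_self] at hpi
    rw [← hpi]; exact hX' p hp hpw

/-- `K` contains all boxes at the sites of clean slices of windows. -/
theorem slicesIn_of_zero (hd : 2 ≤ d) (hK : ClosedUnder n r Bad K) {l U : ℕ}
    (hU : MostlyClean n r l U Bad) (hl : 2 * U + 1 < l) (h0 : SlicesIn K Bad r l 0)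
    (w : Fin d → ℤ) (hw : ∀ k, 0 ≤ w k ∧ w k + l + r ≤ n + 1) : SlicesIn K Bad r l w := by
  have site : ∀ w : Fin d → ℤ, (∀ k, 0 ≤ w k ∧ w k + l + r ≤ n + 1) →
      ∀ c, InWindow l w c → IsSite n r c := by
    intro w hw c hc k
    have := hw k
    have := hc k
    omega
  have key : ∀ m : ℕ, ∀ w : Fin d → ℤ, (∀ k, 0 ≤ w k ∧ w k + l + r ≤ n + 1) → ∑ k, w k = m →
      SlicesIn K Bad r l w := by
    intro m
    induction m with
    | zero =>
      intro w hw hs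
      have : w = 0 := by
        funext k
        exact (Finset.sum_eq_zero_iff_of_nonneg fun i _ => (hw i).1).1 (by simpa using hs) k
          (Finset.mem_univ k)
      rwa [this]
    | succ m ih =>
      intro w hw hs
      have : ∃ k, w k ≠ 0 := by
        by_contra! h
        simp [h] at hs
        omega
      obtain ⟨k, hk⟩ := this
      have hw' : ∀ i, 0 ≤ Function.update w k (w k - 1) i ∧
          Function.update w k (w k - 1) i + l + r ≤ n + 1 := by
        intro i
        have := hw i
        by_cases h : i = k
        · subst h; simp; omega
        · simpa [h] using this
      refine SlicesIn.shift hd hK hU hl (w := Function.update w k (w k - 1)) (j := k) ?_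
        (site _ hw') (site _ hw) (ih _ hw' ?_)
      · simp
      · rw [Finset.sum_update_of_mem (Finset.mem_univ k)]
        rw [← Finset.add_sum_erase _ _ (Finset.mem_univ k)] at hs
        rw [Finset.sdiff_singleton_eq_erase]
        push_cast at hs
        linarith
  refine key (∑ k, w k).toNat w hw ?_
  rw [Int.toNat_of_nonneg]
  exact Finset.sum_nonneg fun i _ => (hw i).1

end lattice

/-! ### Filling the holes -/

section fill
variable {d : ℕ} {n r : ℕ} {Bad K : Set (Fin d → ℤ)}

/-- If slices of windows are mostly clean, there are no bad sites near the corners of the lattice of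
sites, and no `r` consecutive sites on a line are bad, then every closed set that contains the
corner box is everything. A point missing from `K` lies in a room whose walls, of thickness `r`, are
clean slices; away from the corners the room is far from the boundary in some direction `j`. Take a
missing point `u` of the room which is extremal in another direction `i`: the boxes that have `u` on
their `i`-face form a line in direction `j`, their cores are in `K`, and one of them is good. -/
theorem ClosedUnder.eq_of_mostlyClean (hd : 2 ≤ d) (hK : ClosedUnder n r Bad K) (hr : 1 ≤ r)
    (hrn : r ≤ n) {l U : ℕ} (hU : MostlyClean n r l U Bad) (hl : 2 * U + 2 * r + 4 ≤ l)
    (h0 : ∀ v ∈ cube r (0 : Fin d → ℤ), v ∈ K)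
    (hcorner : ∀ c, IsSite n r c → (∀ k, c k ≤ 2 * l ∨ (n : ℤ) - r - 2 * l ≤ c k) → c ∉ Bad)
    (hline : ∀ (c : Fin d → ℤ) (j : Fin d),
      (∀ t : ℕ, t < r → IsSite n r (Function.update c j (c j + t))) →
      ∃ t : ℕ, t < r ∧ Function.update c j (c j + t) ∉ Bad) :
    ∀ v ∈ vertices d n, v ∈ K := by
  classical
  by_cases hsmall : n < r + 2 * l
  · refine hK.eq_of_no_bad hr hrn h0 fun c hc => hcorner c hc fun k => ?_
    have := hc k
    omega
  have : Nontrivial (Fin d) := Fin.nontrivial_iff_two_le.2 hd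
  have site : ∀ w : Fin d → ℤ, (∀ k, 0 ≤ w k ∧ w k + l + r ≤ n + 1) →
      ∀ c, InWindow l w c → IsSite n r c := by
    intro w hw c hc k
    have := hw k
    have := hc k
    omega
  have hw0 : ∀ k : Fin d, 0 ≤ (0 : Fin d → ℤ) k ∧ (0 : Fin d → ℤ) k + l + r ≤ n + 1 := by
    intro k
    simp only [Pi.zero_apply]
    omega
  have cleanCorner : ∀ w : Fin d → ℤ, (∀ k, 0 ≤ w k ∧ w k + l + r ≤ n + 1) →
      (∀ k, w k = 0 ∨ w k + l + r = n + 1) → ∀ i x, Clean Bad l w i x := by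
    intro w hw hw' i x c hc hcw
    refine absurd hc (hcorner c (site w hw c hcw) fun k => ?_)
    have := hw' k
    have := hcw k
    omega
  have hZ0 : SlicesIn K Bad r l 0 := by
    refine slicesIn_of_mem hd hK hU (by omega) (site 0 hw0) (c := 0) (fun k => ?_)
      (i := ⟨0, by omega⟩) (cleanCorner 0 hw0 (fun k => Or.inl rfl) _ _) h0
    simp only [Pi.zero_apply]
    omega
  have hZ := slicesIn_of_zero hd hK hU (by omega) hZ0
  intro u hu
  rw [mem_vertices] at hu
  by_contra huK
  -- a window around `u`
  obtain ⟨h, hh⟩ : ∃ h : ℕ, h = U + r + 1 := ⟨_, rfl⟩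
  obtain ⟨w, hwdef⟩ : ∃ w : Fin d → ℤ, ∀ k, w k = max 0 (min (u k - h) (n - r - l + 1)) :=
    ⟨_, fun k => rfl⟩
  have hw : ∀ k, 0 ≤ w k ∧ w k + l + r ≤ n + 1 := by
    intro k
    have := hwdef k
    omega
  have hslices := hZ w hw
  by_cases hall : ∀ k, w k = 0 ∨ w k + l + r = n + 1
  · refine huK (hslices (fun k => min (u k) (w k + l - 1)) (fun k => ?_)
      ⟨⟨0, by omega⟩, cleanCorner w hw hall _ _⟩ u ?_)
    · beta_reduce
      have := hu k
      have := hwdef k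
      have := hw k
      omega
    · rw [mem_cube]
      intro k
      have := hu k
      have := hwdef k
      have := hw k
      omega
  push Not at hall
  obtain ⟨j, hj0, hj1⟩ := hall
  obtain ⟨i, hij⟩ := exists_ne j
  -- the room of `u`
  have hlo : ∀ k, ∃ lo : ℤ, 0 ≤ lo ∧ lo ≤ u k ∧
      ((lo = 0 ∧ w k = 0) ∨ (w k + r ≤ lo ∧ Clean Bad l w k (lo - r))) := by
    intro k
    by_cases hk : w k = 0
    · exact ⟨0, le_rfl, (hu k).1, Or.inl ⟨rfl, hk⟩⟩
    · obtain ⟨x, h1, h2, h3⟩ := hU.exists_clean (site w hw) k (w k) (u k - r + 1) (by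
        have := hwdef k
        omega)
      have := hw k
      refine ⟨x + r, by omega, by omega, Or.inr ⟨by omega, ?_⟩⟩
      rwa [add_sub_cancel_right]
  have hhi : ∀ k, ∃ hi : ℤ, hi < n ∧ u k ≤ hi ∧
      ((hi = n - 1 ∧ w k + l + r = n + 1) ∨ (hi + 1 < w k + l ∧ Clean Bad l w k (hi + 1))) := by
    intro k
    by_cases hk : w k + l + r = n + 1
    · have := hu k
      exact ⟨n - 1, by omega, by omega, Or.inl ⟨rfl, hk⟩⟩
    · obtain ⟨x, h1, h2, h3⟩ := hU.exists_clean (site w hw) k (u k + 1) (w k + l) (by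
        have := hwdef k
        have := hw k
        have := hu k
        omega)
      have := hw k
      refine ⟨x - 1, by omega, by omega, Or.inr ⟨by omega, ?_⟩⟩
      rwa [sub_add_cancel]
  choose lo hlo0 hlou hlo using hlo
  choose hi hin hui hhi using hhi
  -- the walls of the room lie in `K`
  have wall : ∀ v ∈ vertices d n, (∀ k, lo k - r ≤ v k ∧ v k ≤ hi k + r) →
      (∃ k, v k < lo k ∨ hi k < v k) → v ∈ K := by
    intro v hv hvr hk0
    rw [mem_vertices] at hv
    have hbound : ∀ m, w m ≤ v m ∧ v m ≤ w m + l + r - 2 := by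
      intro m
      have := hlo m
      have := hhi m
      have := hv m
      have := hvr m
      have := hw m
      omega
    have hx : ∃ k0 x, x ≤ v k0 ∧ v k0 < x + r ∧ w k0 ≤ x ∧ x < w k0 + l ∧ Clean Bad l w k0 x := by
      obtain ⟨k0, hk⟩ := hk0
      have h1 := hvr k0
      have h2 := hv k0
      have h3 := hw k0
      have h4 := hbound k0
      have h5 := hlou k0
      have h6 := hui k0
      have h7 := hwdef k0
      have h8 := hu k0
      rcases hk with hk | hk
      · refine ⟨k0, lo k0 - r, by omega, by omega, ?_, ?_, ?_⟩
        · rcases hlo k0 with h | h <;> omega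
        · omega
        · rcases hlo k0 with h | h
          · omega
          · exact h.2
      · rcases hhi k0 with h | h
        · omega
        · exact ⟨k0, hi k0 + 1, by omega, by omega, by omega, by omega, h.2⟩
    obtain ⟨k0, x, hx1, hx2, hx3, hx4, hx⟩ := hx
    refine hslices (Function.update (fun m => min (v m) (w m + l - 1)) k0 x) (fun m => ?_)
      ⟨k0, by simpa using hx⟩ v ?_
    · have := hbound m
      by_cases hm : m = k0
      · subst hm; simp; omega
      · simp [hm]; omega
    · rw [mem_cube]
      intro m
      have := hbound m
      by_cases hm : m = k0
      · subst hm; simp; omega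
      · simp [hm]; omega
  -- the missing points of the room
  let H := (vertices d n).filter fun v => (∀ k, lo k ≤ v k ∧ v k ≤ hi k) ∧ v ∉ K
  have hH : H.Nonempty := ⟨u, by
    simp only [H, Finset.mem_filter, mem_vertices]
    exact ⟨hu, fun k => ⟨hlou k, hui k⟩, huK⟩⟩
  have hjlo : w j + r ≤ lo j := by
    rcases hlo j with h | h <;> omega
  have hjhi : hi j + 1 < w j + l := by
    rcases hhi j with h | h <;> omega
  have finish : ∀ u' ∈ H, ∀ x : ℤ, 0 ≤ x → x + r ≤ n → x ≤ u' i → u' i < x + r →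
      (∀ v ∈ H, ¬ (x + 1 ≤ v i ∧ v i < x + r - 1)) → False := by
    intro u' hu' x hx0 hx1 hx2 hx3 hempty
    simp only [H, Finset.mem_filter, mem_vertices] at hu'
    obtain ⟨hu1, hu2, hu3⟩ := hu'
    let c : Fin d → ℤ := fun k => if k = i then x else if k = j then u' k - r + 1
      else min (u' k) (n - r)
    have hci : c i = x := by simp [c]
    have hcj : c j = u' j - r + 1 := by simp [c, hij.symm]
    have hck : ∀ k, k ≠ i → k ≠ j → c k = min (u' k) (n - r) := fun k h1 h2 => by simp [c, h1, h2]
    have hcs : ∀ t : ℕ, t < r → ∀ k,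
        (0 ≤ Function.update c j (c j + t) k ∧ Function.update c j (c j + t) k + r ≤ n) ∧
        (Function.update c j (c j + t) k ≤ u' k ∧
          u' k < Function.update c j (c j + t) k + r) := by
      intro t ht k
      have h1 := hu1 k
      by_cases hkj : k = j
      · subst hkj
        rw [Function.update_self, hcj]
        have h2 := hu2 k
        have h3 := hw k
        omega
      · rw [Function.update_of_ne hkj]
        by_cases hki : k = i
        · subst hki; rw [hci]; omega
        · rw [hck k hki hkj]; omega
    obtain ⟨t, ht, hgood⟩ := hline c j fun t ht k => (hcs t ht k).1
    refine hu3 (hK _ (fun k => (hcs t ht k).1) hgood (fun v hv => ?_) u' ?_)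
    · have hvn : v ∈ vertices d n :=
        cube_subset_vertices (fun k => (hcs t ht k).1) (core_subset_cube _ _ hv)
      rw [mem_core] at hv
      by_cases hroom : ∀ k, lo k ≤ v k ∧ v k ≤ hi k
      · by_contra hvK
        refine hempty v (by simp only [H, Finset.mem_filter]; exact ⟨hvn, hroom, hvK⟩) ?_
        have := hv i
        rw [Function.update_of_ne hij, hci] at this
        exact this
      · refine wall v hvn (fun k => ?_) ?_
        · have := hv k
          have := (hcs t ht k).2
          have := hu2 k
          omega
        · by_contra! hcon
          exact hroom hcon
    · rw [mem_cube]
      exact fun k => (hcs t ht k).2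
  by_cases hloi : lo i = 0
  · obtain ⟨u', hu', hmax⟩ := H.exists_max_image (fun v => v i) hH
    have hu'' := hu'
    simp only [H, Finset.mem_filter, mem_vertices] at hu''
    have h1 := hu''.1 i
    have h2 := hu''.2.1 i
    have hwi : w i = 0 := by
      rcases hlo i with h | h
      · exact h.2
      · have := hw i
        omega
    have hhii : hi i + 1 < w i + l := by
      rcases hhi i with h | h <;> omega
    refine finish u' hu' (u' i) (by omega) (by omega) le_rfl (by omega) fun v hv hvi => ?_
    have := hmax v hv
    omega
  · obtain ⟨u', hu', hmin⟩ := H.exists_min_image (fun v => v i) hH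
    have hu'' := hu'
    simp only [H, Finset.mem_filter, mem_vertices] at hu''
    have h1 := hu''.1 i
    have h2 := hu''.2.1 i
    have hloi' : w i + r ≤ lo i := by
      rcases hlo i with h | h
      · exact absurd h.1 hloi
      · exact h.1
    have h3 := hw i
    refine finish u' hu' (u' i - r + 1) (by omega) (by omega) (by omega) (by omega)
      fun v hv hvi => ?_
    have := hmin v hv
    omega

end fill

/-! ### Repeated cores and bad sites -/

section bad
variable {d n q : ℕ}

/-- The labeling `σ` as a function on all integer points, `0` outside `Λ_n`. -/
def ext (σ : Labeling d n q) (v : Fin d → ℤ) : ℕ :=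
  if h : ∀ i, 0 ≤ v i ∧ v i < n then
    (σ fun i => ⟨(v i).toNat, by have := h i; omega⟩ : ℕ) else 0

/-- The labels on the core of the `r`-box at `c` reappear on its translate by `a`. -/
def Repeats (r : ℕ) (c a : Fin d → ℤ) (σ : Labeling d n q) : Prop :=
  ∀ x ∈ core r c, x + a ∈ vertices d n ∧ ext σ (x + a) = ext σ x

/-- The set of bad sites of `σ`: the labels on the core reappear on some other translate. -/
def badSites (r : ℕ) (σ : Labeling d n q) : Set (Fin d → ℤ) :=
  {c | ∃ a ≠ 0, Repeats r c a σ}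

/-- The point of `Λ_n` with the coordinates of `v`, if there is one. -/
def toVertex (hn : 0 < n) (v : Fin d → ℤ) : Fin d → Fin n :=
  fun i => ⟨(v i).toNat % n, Nat.mod_lt _ hn⟩

theorem ext_eq (hn : 0 < n) (σ : Labeling d n q) {v : Fin d → ℤ} (hv : v ∈ vertices d n) :
    ext σ v = (σ (toVertex hn v) : ℕ) := by
  rw [mem_vertices] at hv
  rw [ext, dif_pos hv]
  congr 2
  funext i
  have := hv i
  simp only [toVertex, Fin.mk.injEq]
  rw [Nat.mod_eq_of_lt]
  omega

theorem toVertex_cast (hn : 0 < n) {v : Fin d → ℤ} (hv : v ∈ vertices d n) :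
    (fun i => ((toVertex hn v i : ℕ) : ℤ)) = v := by
  rw [mem_vertices] at hv
  funext i
  have := hv i
  simp only [toVertex]
  rw [Nat.mod_eq_of_lt (by omega)]
  omega

/-- Constraints that express the label of each point of `E` by that of a point of smaller height
cost a factor `q` each. -/
theorem prob_constrained_le (E : Finset (Fin d → ℤ)) (f : (Fin d → ℤ) → Fin d → ℤ)
    (ρ : (Fin d → ℤ) → ℤ) (hE : ∀ v ∈ E, v ∈ vertices d n) (hf : ∀ v ∈ E, f v ∈ vertices d n)
    (hρ : ∀ v ∈ E, ρ (f v) < ρ v) (hq : 0 < q) :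
    prob (fun σ : Labeling d n q => ∀ v ∈ E, ext σ v = ext σ (f v)) ≤ ((q : ℝ) ^ E.card)⁻¹ := by
  classical
  rcases Nat.eq_zero_or_pos n with h0 | hn
  · subst h0
    have hE0 : E.card ≤ 0 ∨ d = 0 := by
      by_cases hd : d = 0
      · exact Or.inr hd
      · left
        rw [Nat.le_zero, Finset.card_eq_zero, Finset.eq_empty_iff_forall_notMem]
        intro v hv
        have := (mem_vertices.1 (hE v hv)) ⟨0, by omega⟩
        simp at this
        omega
    rcases hE0 with h | h
    · rw [Nat.le_zero.1 h, pow_zero, inv_one]; exact prob_le_one _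
    · subst h
      have : E = ∅ := by
        rw [Finset.eq_empty_iff_forall_notMem]
        intro v hv
        have := hρ v hv
        rw [Subsingleton.elim (f v) v] at this
        exact lt_irrefl _ this
      subst this
      simpa using prob_le_one _
  let g : (Fin d → Fin n) → Fin d → ℤ := fun v i => ((v i : ℕ) : ℤ)
  have hgi : ∀ v, toVertex hn (g v) = v := by
    intro v; funext i
    ext
    simp [toVertex, g, Nat.mod_eq_of_lt (v i).2]
  have hgn : ∀ v, g v ∈ vertices d n := by
    intro v
    rw [mem_vertices]
    intro i
    have := (v i).2
    simp only [g]
    omega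
  have hinj : Set.InjOn (toVertex hn) (E : Set (Fin d → ℤ)) := by
    intro v hv w hw h
    rw [← toVertex_cast hn (hE v hv), ← toVertex_cast hn (hE w hw), h]
  have hcard : (E.image (toVertex hn)).card = E.card := Finset.card_image_of_injOn hinj
  have key := card_constrained_le (q := q) (E.image (toVertex hn))
    (fun v => toVertex hn (f (g v))) (fun _ => id) (fun v => ρ (g v)) (by
      intro v hv
      obtain ⟨w, hw, rfl⟩ := Finset.mem_image.1 hv
      have e1 : g (toVertex hn w) = w := toVertex_cast hn (hE w hw)
      rw [e1]
      have e2 : g (toVertex hn (f w)) = f w := toVertex_cast hn (hf w hw)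
      rw [e2]
      exact hρ w hw)
  rw [hcard] at key
  rw [prob_eq_card, div_le_iff₀ (by positivity), inv_mul_eq_div, le_div_iff₀ (by positivity)]
  have hV : Fintype.card (Fin d → Fin n) = n ^ d := by simp
  rw [hV] at key
  have h1 : (Finset.univ.filter fun σ : Labeling d n q => ∀ v ∈ E, ext σ v = ext σ (f v)).card *
      q ^ E.card ≤ q ^ n ^ d := by
    refine le_trans (Nat.mul_le_mul_right _ (Finset.card_le_card fun σ hσ => ?_)) key
    simp only [Finset.mem_filter, Finset.mem_univ, true_and] at hσ ⊢
    intro v hv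
    obtain ⟨w, hw, rfl⟩ := Finset.mem_image.1 hv
    have e1 : g (toVertex hn w) = w := toVertex_cast hn (hE w hw)
    have := hσ w hw
    rw [ext_eq hn σ (hE w hw), ext_eq hn σ (hf w hw)] at this
    rw [e1]
    exact Fin.ext this
  rw [← Nat.cast_pow, ← Nat.cast_pow, ← Nat.cast_mul, Nat.cast_le]
  exact h1

theorem prob_false : prob (fun _ : Labeling d n q => False) = 0 := by
  simp [prob]

theorem prob_and_le (P : Prop) (E : Labeling d n q → Prop) {B : ℝ} (hB : 0 ≤ B)
    (h : P → prob E ≤ B) : prob (fun σ => P ∧ E σ) ≤ B := by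
  by_cases hP : P
  · exact (prob_mono fun σ hσ => hσ.2).trans (h hP)
  · exact (prob_mono (F := fun _ => False) fun σ hσ => hP hσ.1).trans (by rw [prob_false]; exact hB)

theorem card_core (r : ℕ) (c : Fin d → ℤ) : (core r c).card = (r - 2) ^ d := by
  rw [core, Fintype.card_piFinset]
  have : ∀ i, (Finset.Ico (c i + 1) (c i + r - 1)).card = r - 2 := by
    intro i
    rw [Int.card_Ico]
    omega
  simp [this]

theorem core_subset_vertices {r : ℕ} {c : Fin d → ℤ} (hc : IsSite n r c) :
    core r c ⊆ vertices d n :=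
  (core_subset_cube r c).trans (cube_subset_vertices hc)

/-- A given repetition. The equations follow the orbits of a translation, along which some
coordinate is strictly monotone. -/
theorem prob_repeats_le {r : ℕ} {c a : Fin d → ℤ} (hc : IsSite n r c) (ha : a ≠ 0) (hq : 0 < q) :
    prob (Repeats (q := q) (n := n) r c a) ≤ ((q : ℝ) ^ (r - 2) ^ d)⁻¹ := by
  have hiff : ∀ σ : Labeling d n q, Repeats r c a σ ↔
      (∀ x ∈ core r c, x + a ∈ vertices d n) ∧ ∀ x ∈ core r c, ext σ x = ext σ (x + a) := by
    intro σ
    exact ⟨fun h => ⟨fun x hx => (h x hx).1, fun x hx => (h x hx).2.symm⟩,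
      fun h x hx => ⟨h.1 x hx, (h.2 x hx).symm⟩⟩
  simp only [funext_iff, Pi.zero_apply, ne_eq, not_forall] at ha
  obtain ⟨i, hi⟩ := ha
  have : Repeats (q := q) (n := n) r c a = fun σ => (∀ x ∈ core r c, x + a ∈ vertices d n) ∧
      ∀ x ∈ core r c, ext σ x = ext σ (x + a) := by
    funext σ; exact propext (hiff σ)
  rw [this]
  refine prob_and_le _ _ (by positivity) fun h => ?_
  rw [← card_core r c]
  refine prob_constrained_le _ (fun x => x + a) (fun x => if 0 < a i then - x i else x i)
    (fun v hv => core_subset_vertices hc hv) h (fun v hv => ?_) hq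
  simp only [Pi.add_apply]
  split_ifs <;> omega

/-- Two given repetitions with different translations. The graph of the equations has no cycle: a
path in it moves monotonically in the direction of the difference of the translations. -/
theorem prob_repeats_two_le {r : ℕ} {c c' a b : Fin d → ℤ} (hc : IsSite n r c)
    (hc' : IsSite n r c') (hab : a ≠ b)
    (ha : ∀ x ∈ core r c, x + a ∉ core r c ∧ x + a ∉ core r c')
    (hb : ∀ x ∈ core r c', x + b ∉ core r c ∧ x + b ∉ core r c') (hq : 0 < q) :
    prob (fun σ : Labeling d n q => Repeats r c a σ ∧ Repeats r c' b σ) ≤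
      (((q : ℝ) ^ (r - 2) ^ d)⁻¹) ^ 2 := by
  classical
  have hab' : ∃ i, a i ≠ b i := Function.ne_iff.1 hab
  obtain ⟨i, hi⟩ := hab'
  let f : (Fin d → ℤ) → Fin d → ℤ := fun v => if v ∈ core r c' then v + b else v - a
  let h : (Fin d → ℤ) → ℤ := fun v => if b i < a i then v i else - v i
  let ρ : (Fin d → ℤ) → ℤ := fun v =>
    if v ∈ core r c ∨ v ∈ core r c' then 2 * h v else 2 * h (v - b) - 1
  let T := (core r c).image (fun x => x + a)
  have hT : ∀ v ∈ T, v ∉ core r c ∧ v ∉ core r c' ∧ v - a ∈ core r c := by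
    intro v hv
    obtain ⟨x, hx, rfl⟩ := Finset.mem_image.1 hv
    exact ⟨(ha x hx).1, (ha x hx).2, by simpa using hx⟩
  have hdisj : Disjoint (core r c') T := by
    rw [Finset.disjoint_left]
    intro v hv hvT
    exact (hT v hvT).2.1 hv
  have hcard : (core r c' ∪ T).card = (r - 2) ^ d * 2 := by
    rw [Finset.card_union_of_disjoint hdisj, card_core,
      Finset.card_image_of_injective _ (add_left_injective a), card_core, mul_two]
  have hpow : (((q : ℝ) ^ (r - 2) ^ d)⁻¹) ^ 2 = ((q : ℝ) ^ (core r c' ∪ T).card)⁻¹ := by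
    rw [hcard, pow_mul, inv_pow]
  rw [hpow]
  refine (prob_mono (F := fun σ => ((∀ x ∈ core r c, x + a ∈ vertices d n) ∧
    ∀ x ∈ core r c', x + b ∈ vertices d n) ∧ ∀ v ∈ core r c' ∪ T, ext σ v = ext σ (f v))
    fun σ hσ => ⟨⟨fun x hx => (hσ.1 x hx).1, fun x hx => (hσ.2 x hx).1⟩, fun v hv => ?_⟩).trans
    (prob_and_le _ _ (by positivity) fun hin => ?_)
  · rcases Finset.mem_union.1 hv with hv | hv
    · simp only [f, if_pos hv]
      exact (hσ.2 v hv).2.symm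
    · simp only [f, if_neg (hT v hv).2.1]
      have := (hσ.1 _ (hT v hv).2.2).2
      rwa [sub_add_cancel] at this
  · refine prob_constrained_le _ f ρ (fun v hv => ?_) (fun v hv => ?_) (fun v hv => ?_) hq
    · rcases Finset.mem_union.1 hv with hv | hv
      · exact core_subset_vertices hc' hv
      · have := hin.1 _ (hT v hv).2.2
        rwa [sub_add_cancel] at this
    · rcases Finset.mem_union.1 hv with hv | hv
      · simp only [f, if_pos hv]
        exact hin.2 v hv
      · simp only [f, if_neg (hT v hv).2.1]
        exact core_subset_vertices hc (hT v hv).2.2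
    · rcases Finset.mem_union.1 hv with hv | hv
      · have h1 : ¬ (v + b ∈ core r c ∨ v + b ∈ core r c') := by
          rw [not_or]; exact hb v hv
        have h2 : v ∈ core r c ∨ v ∈ core r c' := Or.inr hv
        simp only [f, ρ, if_pos hv, if_neg h1, if_pos h2, add_sub_cancel_right]
        omega
      · have h1 : ¬ (v ∈ core r c ∨ v ∈ core r c') := by
          rw [not_or]; exact ⟨(hT v hv).1, (hT v hv).2.1⟩
        have h2 : v - a ∈ core r c ∨ v - a ∈ core r c' := Or.inl (hT v hv).2.2
        simp only [f, ρ, if_neg (hT v hv).2.1, if_neg h1, if_pos h2, h, Pi.sub_apply]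
        split_ifs <;> omega

/-- The union of the translates on which the cores of a family of sites reappear. -/
noncomputable def targets {ι : Type*} [Fintype ι] (r : ℕ) (c a : ι → Fin d → ℤ) :
    Finset (Fin d → ℤ) :=
  Finset.univ.biUnion fun y => (core r (c y)).image fun x => x + a y

/-- A family of given repetitions, none of whose targets meets the cores. -/
theorem prob_repeats_family_le {ι : Type*} [Fintype ι] [Nonempty ι] {r : ℕ} {c a : ι → Fin d → ℤ}
    (hc : ∀ y, IsSite n r (c y))
    (ha : ∀ y y', ∀ x ∈ core r (c y), x + a y ∉ core r (c y')) (hq : 0 < q) :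
    prob (fun σ : Labeling d n q => ∀ y, Repeats r (c y) (a y) σ) ≤
      ((q : ℝ) ^ (targets r c a).card)⁻¹ := by
  classical
  have hex : ∀ v, ∃ y, v ∈ targets r c a → v - a y ∈ core r (c y) := by
    intro v
    by_cases hv : v ∈ targets r c a
    · have hv' := hv
      simp only [targets, Finset.mem_biUnion, Finset.mem_univ, true_and, Finset.mem_image] at hv'
      obtain ⟨y, x, hx, rfl⟩ := hv'
      exact ⟨y, fun _ => by simpa using hx⟩
    · exact ⟨Classical.arbitrary ι, fun h => absurd h hv⟩
  choose y hy using hex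
  let f : (Fin d → ℤ) → Fin d → ℤ := fun v => v - a (y v)
  let ρ : (Fin d → ℤ) → ℤ := fun v => if ∃ y, v ∈ core r (c y) then 0 else 1
  refine (prob_mono (F := fun σ => (∀ y, ∀ x ∈ core r (c y), x + a y ∈ vertices d n) ∧
    ∀ v ∈ targets r c a, ext σ v = ext σ (f v))
    fun σ hσ => ⟨fun y x hx => (hσ y x hx).1, fun v hv => ?_⟩).trans
    (prob_and_le _ _ (by positivity) fun hin => ?_)
  · have := (hσ _ _ (hy v hv)).2
    rwa [sub_add_cancel] at this
  · refine prob_constrained_le _ f ρ (fun v hv => ?_) (fun v hv => ?_) (fun v hv => ?_) hq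
    · have := hin _ _ (hy v hv)
      rwa [sub_add_cancel] at this
    · exact core_subset_vertices (hc _) (hy v hv)
    · have h1 : ∃ y, f v ∈ core r (c y) := ⟨_, hy v hv⟩
      have h2 : ¬ ∃ y, v ∈ core r (c y) := by
        rintro ⟨y', hy'⟩
        have := ha (y v) y' _ (hy v hv)
        rw [sub_add_cancel] at this
        exact this hy'
      simp only [ρ, if_pos h1, if_neg h2]
      norm_num

end bad

/-! ### Union bounds for configurations of bad sites -/

section union
variable {d n q : ℕ}

/-- The integer points with all coordinates smaller than `D` in absolute value. -/
noncomputable def smallOffsets (d D : ℕ) : Finset (Fin d → ℤ) :=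
  Fintype.piFinset fun _ => Finset.Ioo (-(D : ℤ)) D

theorem mem_smallOffsets {D : ℕ} {a : Fin d → ℤ} :
    a ∈ smallOffsets d D ↔ ∀ k, -(D : ℤ) < a k ∧ a k < D := by
  simp [smallOffsets]

theorem card_smallOffsets_le (D : ℕ) : ((smallOffsets d D).card : ℝ) ≤ (2 * D : ℝ) ^ d := by
  rw [smallOffsets, Fintype.card_piFinset]
  simp only [Int.card_Ioo, Finset.prod_const, Finset.card_univ, Fintype.card_fin]
  push_cast
  gcongr
  have : ((D : ℤ) - -(D : ℤ) - 1).toNat ≤ 2 * D := by omega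
  exact_mod_cast this

theorem card_vertices : (vertices d n).card = n ^ d := by
  simp [vertices, Fintype.card_piFinset]

theorem IsSite.mem_vertices {r : ℕ} (hr : 1 ≤ r) {c : Fin d → ℤ} (hc : IsSite n r c) :
    c ∈ vertices d n := by
  rw [Shotgun.mem_vertices]
  intro i
  have := hc i
  omega

theorem core_nonempty {r : ℕ} (hr : 3 ≤ r) (c : Fin d → ℤ) : (core r c).Nonempty :=
  ⟨fun i => c i + 1, by rw [mem_core]; intro i; omega⟩

theorem Repeats.mem_smallOffsets {r : ℕ} (hr : 3 ≤ r) {c a : Fin d → ℤ} {σ : Labeling d n q}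
    (hc : IsSite n r c) (h : Repeats r c a σ) : a ∈ smallOffsets d n := by
  obtain ⟨x, hx⟩ := core_nonempty hr c
  have h1 := core_subset_vertices hc hx
  have h2 := (h x hx).1
  rw [mem_vertices] at h1 h2
  rw [Shotgun.mem_smallOffsets]
  intro k
  have := h1 k
  have := h2 k
  simp only [Pi.add_apply] at this
  omega

/-- No core reappears at a small nonzero translate. -/
def NoNear (r D : ℕ) (σ : Labeling d n q) : Prop :=
  ∀ c, IsSite n r c → ∀ a ∈ smallOffsets d D, a ≠ 0 → ¬ Repeats r c a σ

/-- The cores of two sites at distance less than `l` do not reappear at two large translates that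
are different but close to each other. -/
def NoClose (r l D : ℕ) (σ : Labeling d n q) : Prop :=
  ∀ c c', IsSite n r c → IsSite n r c' → c' - c ∈ smallOffsets d l →
    ∀ a b, a ≠ b → b - a ∈ smallOffsets d D → a ∉ smallOffsets d D → b ∉ smallOffsets d D →
      ¬ (Repeats r c a σ ∧ Repeats r c' b σ)

theorem prob_not_noNear_le {r D : ℕ} (hr : 3 ≤ r) (hq : 0 < q) :
    prob (fun σ : Labeling d n q => ¬ NoNear r D σ) ≤
      (n : ℝ) ^ d * ((2 * D : ℝ) ^ d * ((q : ℝ) ^ (r - 2) ^ d)⁻¹) := by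
  calc _ ≤ prob (fun σ : Labeling d n q => ∃ c ∈ vertices d n, ∃ a ∈ smallOffsets d D,
        (IsSite n r c ∧ a ≠ 0) ∧ Repeats r c a σ) := by
        refine prob_mono fun σ h => ?_
        unfold NoNear at h
        push Not at h
        obtain ⟨c, hc, a, ha, ha0, hrep⟩ := h
        exact ⟨c, hc.mem_vertices (by omega), a, ha, ⟨hc, ha0⟩, hrep⟩
    _ ≤ (vertices d n).card * ((2 * D : ℝ) ^ d * ((q : ℝ) ^ (r - 2) ^ d)⁻¹) := by
        refine prob_exists_le _ _ fun c _ => (prob_exists_le _ _ fun a _ =>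
          prob_and_le _ _ (by positivity) fun h => prob_repeats_le h.1 h.2 hq).trans ?_
        gcongr
        exact card_smallOffsets_le D
    _ = _ := by rw [card_vertices]; push_cast; rfl

/-- Two points of cores of sites at distance less than `l` are at distance less than `2 * l`. -/
theorem sub_mem_smallOffsets {r l : ℕ} (hrl : r ≤ l) {c c' x y : Fin d → ℤ}
    (hcc : c' - c ∈ smallOffsets d l) (hx : x ∈ core r c) (hy : y ∈ core r c') :
    y - x ∈ smallOffsets d (2 * l) := by
  rw [mem_core] at hx hy
  rw [mem_smallOffsets] at hcc ⊢
  intro k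
  have := hx k
  have := hy k
  have := hcc k
  simp only [Pi.sub_apply] at *
  push_cast
  omega

theorem neg_mem_smallOffsets {D : ℕ} {a : Fin d → ℤ} (h : a ∈ smallOffsets d D) :
    -a ∈ smallOffsets d D := by
  rw [mem_smallOffsets] at h ⊢
  intro k
  have := h k
  simp only [Pi.neg_apply]
  omega

theorem add_notMem_core {r l : ℕ} (hrl : r ≤ l) {c c' a x : Fin d → ℤ}
    (hcc : c' - c ∈ smallOffsets d l) (ha : a ∉ smallOffsets d (2 * l)) (hx : x ∈ core r c) :
    x + a ∉ core r c' := by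
  intro h
  have := sub_mem_smallOffsets hrl hcc hx h
  rw [add_sub_cancel_left] at this
  exact ha this

theorem prob_not_noClose_le {r l : ℕ} (hr : 3 ≤ r) (hrl : r ≤ l) (hq : 0 < q) :
    prob (fun σ : Labeling d n q => ¬ NoClose r l (2 * l) σ) ≤
      (n : ℝ) ^ d * ((2 * l : ℝ) ^ d * ((2 * n : ℝ) ^ d * ((2 * (2 * l : ℕ) : ℝ) ^ d *
        (((q : ℝ) ^ (r - 2) ^ d)⁻¹) ^ 2))) := by
  have h0 : (0 : Fin d → ℤ) ∈ smallOffsets d l := by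
    rw [mem_smallOffsets]; intro k; simp; omega
  calc _ ≤ prob (fun σ : Labeling d n q => ∃ c ∈ vertices d n, ∃ e ∈ smallOffsets d l,
        ∃ a ∈ smallOffsets d n, ∃ f ∈ smallOffsets d (2 * l),
        (IsSite n r c ∧ IsSite n r (c + e) ∧ e ∈ smallOffsets d l ∧ a ≠ a + f ∧
          a ∉ smallOffsets d (2 * l) ∧ a + f ∉ smallOffsets d (2 * l)) ∧
          (Repeats r c a σ ∧ Repeats r (c + e) (a + f) σ)) := by
        refine prob_mono fun σ h => ?_
        unfold NoClose at h
        push Not at h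
        obtain ⟨c, c', hc, hc', hcc, a, b, hab, hba, ha, hb, hra, hrb⟩ := h
        refine ⟨c, hc.mem_vertices (by omega), c' - c, hcc, a, hra.mem_smallOffsets hr hc, b - a,
          hba, ?_, ?_⟩
        · simp only [add_sub_cancel]
          exact ⟨hc, hc', hcc, hab, ha, hb⟩
        · simp only [add_sub_cancel]
          exact ⟨hra, hrb⟩
    _ ≤ (vertices d n).card * ((2 * l : ℝ) ^ d * ((2 * n : ℝ) ^ d * ((2 * (2 * l : ℕ) : ℝ) ^ d *
        (((q : ℝ) ^ (r - 2) ^ d)⁻¹) ^ 2))) := by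
        refine prob_exists_le _ _ fun c _ => (prob_exists_le _ _ fun e _ =>
          (prob_exists_le _ _ fun a _ => (prob_exists_le _ _ fun f _ =>
          prob_and_le _ _ (by positivity) fun h => ?_).trans (mul_le_mul_of_nonneg_right
            (card_smallOffsets_le _) (by positivity))).trans (mul_le_mul_of_nonneg_right
            (card_smallOffsets_le _) (by positivity))).trans (mul_le_mul_of_nonneg_right
            (card_smallOffsets_le _) (by positivity))
        obtain ⟨hc, hc', hcc, hab, ha, hb⟩ := h
        refine prob_repeats_two_le hc hc' hab (fun x hx => ⟨?_, ?_⟩) (fun x hx => ⟨?_, ?_⟩) hq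
        · exact add_notMem_core hrl (by simpa using h0) ha hx
        · exact add_notMem_core hrl (by simpa using hcc) ha hx
        · exact add_notMem_core hrl (by simpa using neg_mem_smallOffsets hcc) hb hx
        · exact add_notMem_core hrl (by simpa using h0) hb hx
    _ = _ := by rw [card_vertices]; push_cast; rfl

/-- A site all of whose coordinates are within `2 * l` of the ends of their range. -/
def IsCorner (n r l : ℕ) (c : Fin d → ℤ) : Prop := ∀ k, c k ≤ 2 * l ∨ (n : ℤ) - r - 2 * l ≤ c k

theorem prob_corner_le {r l : ℕ} (hr : 3 ≤ r) (hq : 0 < q) :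
    prob (fun σ : Labeling d n q => ∃ c, IsSite n r c ∧ IsCorner n r l c ∧ c ∈ badSites r σ) ≤
      (4 * l + 2 : ℝ) ^ d * ((2 * n : ℝ) ^ d * ((q : ℝ) ^ (r - 2) ^ d)⁻¹) := by
  classical
  let I : Finset (Fin d → ℤ) := Fintype.piFinset fun _ =>
    Finset.Icc (0 : ℤ) (2 * l) ∪ Finset.Icc ((n : ℤ) - r - 2 * l) (n - r)
  have hI : (I.card : ℝ) ≤ (4 * l + 2 : ℝ) ^ d := by
    have : I.card ≤ (4 * l + 2) ^ d := by
      simp only [I, Fintype.card_piFinset, Finset.prod_const, Finset.card_univ, Fintype.card_fin]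
      refine Nat.pow_le_pow_left ?_ d
      refine (Finset.card_union_le _ _).trans ?_
      rw [Int.card_Icc, Int.card_Icc]
      omega
    exact_mod_cast this
  calc _ ≤ prob (fun σ : Labeling d n q => ∃ c ∈ I, ∃ a ∈ smallOffsets d n,
        (IsSite n r c ∧ a ≠ 0) ∧ Repeats r c a σ) := by
        refine prob_mono fun σ h => ?_
        obtain ⟨c, hc, hcc, a, ha0, hrep⟩ := h
        refine ⟨c, ?_, a, hrep.mem_smallOffsets hr hc, ⟨hc, ha0⟩, hrep⟩
        simp only [I, Fintype.mem_piFinset, Finset.mem_union, Finset.mem_Icc]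
        intro k
        have := hc k
        have := hcc k
        omega
    _ ≤ I.card * ((2 * n : ℝ) ^ d * ((q : ℝ) ^ (r - 2) ^ d)⁻¹) := by
        refine prob_exists_le _ _ fun c _ => (prob_exists_le _ _ fun a _ =>
          prob_and_le _ _ (by positivity) fun h => prob_repeats_le h.1 h.2 hq).trans ?_
        gcongr
        exact card_smallOffsets_le n
    _ ≤ _ := by gcongr

/-- All sites are good, except with the probability of a repetition. -/
theorem prob_exists_bad_le {r : ℕ} (hr : 3 ≤ r) (hq : 0 < q) :
    prob (fun σ : Labeling d n q => ∃ c, IsSite n r c ∧ c ∈ badSites r σ) ≤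
      (n : ℝ) ^ d * ((2 * n : ℝ) ^ d * ((q : ℝ) ^ (r - 2) ^ d)⁻¹) := by
  calc _ ≤ prob (fun σ : Labeling d n q => ∃ c ∈ vertices d n, ∃ a ∈ smallOffsets d n,
        (IsSite n r c ∧ a ≠ 0) ∧ Repeats r c a σ) := by
        refine prob_mono fun σ h => ?_
        obtain ⟨c, hc, a, ha0, hrep⟩ := h
        exact ⟨c, hc.mem_vertices (by omega), a, hrep.mem_smallOffsets hr hc, ⟨hc, ha0⟩, hrep⟩
    _ ≤ (vertices d n).card * ((2 * n : ℝ) ^ d * ((q : ℝ) ^ (r - 2) ^ d)⁻¹) := by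
        refine prob_exists_le _ _ fun c _ => (prob_exists_le _ _ fun a _ =>
          prob_and_le _ _ (by positivity) fun h => prob_repeats_le h.1 h.2 hq).trans ?_
        gcongr
        exact card_smallOffsets_le n
    _ = _ := by rw [card_vertices]; push_cast; rfl

/-! ### Separated families of bad sites -/

/-- The `r`-boxes at `c` and `c'` are disjoint. -/
def Separated (r : ℕ) (c c' : Fin d → ℤ) : Prop := ∃ k, c k + r ≤ c' k ∨ c' k + r ≤ c k

theorem disjoint_core {r : ℕ} {c c' : Fin d → ℤ} (h : Separated r c c') :
    Disjoint (core r c) (core r c') := by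
  rw [Finset.disjoint_left]
  intro v hv hv'
  rw [mem_core] at hv hv'
  obtain ⟨k, hk⟩ := h
  have := hv k
  have := hv' k
  omega

/-- The translations chosen for a family of bad sites in a window are large, and pairwise equal or
far apart. -/
theorem far_of_noNear_of_noClose {r l : ℕ} {σ : Labeling d n q} (h1 : NoNear r (2 * l) σ)
    (h2 : NoClose r l (2 * l) σ) {c c' a b : Fin d → ℤ} (hc : IsSite n r c)
    (hc' : IsSite n r c') (hcc : c' - c ∈ smallOffsets d l) (ha0 : a ≠ 0) (hb0 : b ≠ 0)
    (ha : Repeats r c a σ) (hb : Repeats r c' b σ) :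
    a ∉ smallOffsets d (2 * l) ∧ (a = b ∨ b - a ∉ smallOffsets d (2 * l)) := by
  have ha' : a ∉ smallOffsets d (2 * l) := fun h => h1 c hc a h ha0 ha
  have hb' : b ∉ smallOffsets d (2 * l) := fun h => h1 c' hc' b h hb0 hb
  refine ⟨ha', ?_⟩
  by_contra! h
  exact h2 c c' hc hc' hcc a b h.1 h.2 ha' hb' ⟨ha, hb⟩

theorem disjoint_translates {r l : ℕ} (hrl : r ≤ l) {c c' a b : Fin d → ℤ}
    (hcc : c' - c ∈ smallOffsets d l) (hab : b - a ∉ smallOffsets d (2 * l)) :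
    ∀ x ∈ core r c, ∀ y ∈ core r c', x + a ≠ y + b := by
  intro x hx y hy h
  have := neg_mem_smallOffsets (sub_mem_smallOffsets hrl hcc hx hy)
  have e : -(y - x) = b - a := by
    rw [neg_sub, sub_eq_sub_iff_add_eq_add, h, add_comm]
  exact hab (e ▸ this)

/-- Some window of side `l` contains `C` separated bad sites. -/
def ManyBad (r l C : ℕ) (σ : Labeling d n q) : Prop :=
  ∃ w ∈ vertices d n, ∃ c : Fin C → Fin d → ℤ, (∀ y, IsSite n r (c y) ∧ InWindow l w (c y)) ∧
    (∀ y y', y ≠ y' → Separated r (c y) (c y')) ∧ ∀ y, c y ∈ badSites r σ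

theorem InWindow.sub_mem_smallOffsets {l : ℕ} {w c c' : Fin d → ℤ} (h : InWindow l w c)
    (h' : InWindow l w c') : c' - c ∈ smallOffsets d l := by
  rw [Shotgun.mem_smallOffsets]
  intro k
  have := h k
  have := h' k
  simp only [Pi.sub_apply]
  omega

theorem prob_manyBad_le {r l C : ℕ} (hr : 3 ≤ r) (hrl : r ≤ l) (hC : 0 < C) (hq : 0 < q) :
    prob (fun σ : Labeling d n q => (NoNear r (2 * l) σ ∧ NoClose r l (2 * l) σ) ∧
        ManyBad r l C σ) ≤
      (n : ℝ) ^ d * ((l : ℝ) ^ d * ((2 * n : ℝ) ^ d * ((q : ℝ) ^ (r - 2) ^ d)⁻¹)) ^ C := by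
  classical
  have : Nonempty (Fin C) := ⟨⟨0, hC⟩⟩
  let W : (Fin d → ℤ) → Finset (Fin d → ℤ) := fun w =>
    Fintype.piFinset fun k => Finset.Ico (w k) (w k + l)
  have hW : ∀ w, (W w).card = l ^ d := by
    intro w
    simp [W, Fintype.card_piFinset]
  calc _ ≤ prob (fun σ : Labeling d n q => ∃ w ∈ vertices d n,
        ∃ c ∈ Fintype.piFinset fun _ : Fin C => W w,
        ∃ a ∈ Fintype.piFinset fun _ : Fin C => smallOffsets d n,
        ((∀ y, IsSite n r (c y)) ∧ (∀ y y', y ≠ y' → Separated r (c y) (c y')) ∧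
          (∀ y y', c y' - c y ∈ smallOffsets d l) ∧
          (∀ y, a y ∉ smallOffsets d (2 * l)) ∧
          (∀ y y', a y = a y' ∨ a y' - a y ∉ smallOffsets d (2 * l))) ∧
          ∀ y, Repeats r (c y) (a y) σ) := by
        refine prob_mono fun σ h => ?_
        obtain ⟨⟨h1, h2⟩, w, hw, c, hc, hsep, hbad⟩ := h
        choose a ha0 ha using hbad
        have hcc : ∀ y y', c y' - c y ∈ smallOffsets d l := fun y y' =>
          (hc y).2.sub_mem_smallOffsets (hc y').2
        have hfar := fun y y' => far_of_noNear_of_noClose h1 h2 (hc y).1 (hc y').1 (hcc y y')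
          (ha0 y) (ha0 y') (ha y) (ha y')
        refine ⟨w, hw, c, ?_, a, ?_, ⟨fun y => (hc y).1, hsep, hcc, fun y => (hfar y y).1,
          fun y y' => (hfar y y').2⟩, ha⟩
        · rw [Fintype.mem_piFinset]
          intro y
          simp only [W, Fintype.mem_piFinset, Finset.mem_Ico]
          exact (hc y).2
        · rw [Fintype.mem_piFinset]
          exact fun y => (ha y).mem_smallOffsets hr (hc y).1
    _ ≤ (vertices d n).card * (((l ^ d : ℕ) : ℝ) ^ C *
        (((2 * n : ℝ) ^ d) ^ C * (((q : ℝ) ^ (r - 2) ^ d)⁻¹) ^ C)) := by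
        refine prob_exists_le _ _ fun w _ => (prob_exists_le _ _ fun c _ =>
          (prob_exists_le _ _ fun a _ => prob_and_le _ _ (B := (((q : ℝ) ^ (r - 2) ^ d)⁻¹) ^ C)
          (by positivity) fun h => ?_).trans (mul_le_mul_of_nonneg_right (c := ((2 * n : ℝ) ^ d) ^ C)
            ?_ (by positivity))).trans (mul_le_mul_of_nonneg_right ?_ (by positivity))
        · obtain ⟨hs, hsep, hcc, ha, hab⟩ := h
          refine (prob_repeats_family_le hs (fun y y' x hx =>
            add_notMem_core hrl (hcc y y') (ha y) hx) hq).trans ?_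
          have hcard : (targets r c a).card = (r - 2) ^ d * C := by
            rw [targets, Finset.card_biUnion]
            · simp only [Finset.card_image_of_injective _ (add_left_injective _), card_core]
              simp [mul_comm]
            · intro y _ y' _ hyy
              refine Finset.disjoint_left.2 fun v hv hv' => ?_
              obtain ⟨x, hx, rfl⟩ := Finset.mem_image.1 hv
              obtain ⟨x', hx', hxx⟩ := Finset.mem_image.1 hv'
              rcases hab y y' with h | h
              · rw [h] at hxx
                have : x' = x := add_left_injective _ hxx
                subst this
                exact Finset.disjoint_left.1 (disjoint_core (hsep y y' hyy)) hx hx'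
              · exact disjoint_translates hrl (hcc y y') h x hx x' hx' hxx.symm
          rw [hcard, pow_mul, inv_pow]
        · rw [Fintype.card_piFinset]
          simp only [Finset.prod_const, Finset.card_univ, Fintype.card_fin]
          push_cast
          gcongr
          exact card_smallOffsets_le n
        · rw [Fintype.card_piFinset]
          simp [hW]
    _ = _ := by
        rw [card_vertices]; push_cast; ring

/-- A window without `C` separated bad sites has at most `2 * r * C` unclean values of each
coordinate: all bad sites are near one of the members of a maximal separated family. -/
theorem mostlyClean_of_not_manyBad {r l C : ℕ} (hl : 0 < l) (hr : 1 ≤ r) {σ : Labeling d n q}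
    (h : ¬ ManyBad r l C σ) : MostlyClean n r l (2 * r * C) (badSites r σ) := by
  classical
  intro w hw i
  let W : Finset (Fin d → ℤ) :=
    (Fintype.piFinset fun k => Finset.Ico (w k) (w k + l)).filter fun c => c ∈ badSites r σ
  have hWmem : ∀ c, c ∈ W ↔ InWindow l w c ∧ c ∈ badSites r σ := by
    intro c
    simp [W, InWindow]
  let F := W.powerset.filter fun Y => ∀ y ∈ Y, ∀ y' ∈ Y, y ≠ y' → Separated r y y'
  have hF : F.Nonempty := ⟨∅, by simp [F]⟩
  obtain ⟨Y, hY, hmax⟩ := F.exists_max_image Finset.card hF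
  simp only [F, Finset.mem_filter, Finset.mem_powerset] at hY hmax
  have hYC : Y.card ≤ C := by
    by_contra! hlt
    obtain ⟨Z, hZ, hZC⟩ := Finset.exists_subset_card_eq hlt.le
    let e := Z.equivFinOfCardEq hZC
    refine h ⟨w, ?_, fun y => (e.symm y : Fin d → ℤ), fun y => ?_, fun y y' hyy => ?_, fun y => ?_⟩
    · exact (hw w fun k => ⟨le_rfl, by omega⟩).mem_vertices hr
    · have := (hWmem _).1 (hY.1 (hZ (e.symm y).2))
      exact ⟨hw _ this.1, this.1⟩
    · refine hY.2 _ (hZ (e.symm y).2) _ (hZ (e.symm y').2) fun he => hyy ?_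
      exact e.symm.injective (Subtype.ext he)
    · exact ((hWmem _).1 (hY.1 (hZ (e.symm y).2))).2
  refine ⟨Y.biUnion fun y => Finset.Ioo (y i - r) (y i + r), ?_, fun c hc hcw => ?_⟩
  · calc _ ≤ ∑ y ∈ Y, (Finset.Ioo (y i - r) (y i + r)).card := Finset.card_biUnion_le
      _ ≤ Y.card • (2 * r) := Finset.sum_le_card_nsmul _ _ _ fun y _ => by
          rw [Int.card_Ioo]; omega
      _ ≤ 2 * r * C := by rw [smul_eq_mul, mul_comm]; gcongr
  · by_contra hcX
    simp only [Finset.mem_biUnion, Finset.mem_Ioo, not_exists, not_and] at hcX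
    have hsep : ∀ y ∈ Y, Separated r c y := by
      intro y hy
      refine ⟨i, ?_⟩
      have := hcX y hy
      omega
    have hcY : c ∉ Y := by
      intro hcY
      obtain ⟨k, hk⟩ := hsep c hcY
      omega
    have := hmax (insert c Y) ⟨?_, ?_⟩
    · rw [Finset.card_insert_of_notMem hcY] at this
      omega
    · intro y hy
      rcases Finset.mem_insert.1 hy with rfl | hy
      · exact (hWmem _).2 ⟨hcw, hc⟩
      · exact hY.1 hy
    · intro y hy y' hy' hne
      rcases Finset.mem_insert.1 hy with h1 | h1 <;> rcases Finset.mem_insert.1 hy' with h2 | h2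
      · exact absurd (h1.trans h2.symm) hne
      · exact h1 ▸ hsep y' h2
      · obtain ⟨k, hk⟩ := hsep y h1
        exact h2 ▸ ⟨k, hk.symm⟩
      · exact hY.2 y h1 y' h2 hne

end union

/-! ### Lines of bad sites -/

section line
variable {d n q : ℕ}

/-- Some line of `r` consecutive sites in direction `j` consists of bad sites. -/
def BadLine (r : ℕ) (σ : Labeling d n q) : Prop :=
  ∃ c ∈ vertices d n, ∃ j, ∀ t : Fin r, IsSite n r (Function.update c j (c j + (t : ℕ))) ∧
    Function.update c j (c j + (t : ℕ)) ∈ badSites r σ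

open Pointwise in
/-- The cores at the sites of a line indexed by `S` cover a product of intervals with a set that is
the sum of `S` and an interval. -/
theorem exists_subset_cores {r : ℕ} (hr : 3 ≤ r) (c : Fin d → ℤ) (j : Fin d) (S : Finset (Fin r))
    (hS : S.Nonempty) : ∃ R : Finset (Fin d → ℤ),
      (∀ x ∈ R, ∃ t ∈ S, x ∈ core r (Function.update c j (c j + (t : ℕ)))) ∧
      (r - 3) ^ (d - 1) * (S.card + (r - 3)) ≤ R.card := by
  classical
  let X : Finset ℤ := S.image fun t : Fin r => c j + 1 + ((t : ℕ) : ℤ)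
  let Y : Finset ℤ := Finset.Ico 0 ((r - 2 : ℕ) : ℤ)
  have hX : X.card = S.card := by
    refine Finset.card_image_of_injective _ fun t t' h => Fin.ext ?_
    simpa using h
  have hY : Y.card = r - 2 := by simp [Y]
  have hXY : S.card + (r - 3) ≤ (X + Y).card := by
    have := cauchy_davenport_add_of_linearOrder_isCancelAdd (s := X) (t := Y)
      (by simpa [X] using hS) (by rw [← Finset.card_pos, hY]; omega)
    omega
  refine ⟨Fintype.piFinset (Function.update
    (fun k => Finset.Ico (c k + 1) (c k + r - 1)) j (X + Y)), fun x hx => ?_, ?_⟩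
  · rw [Fintype.mem_piFinset] at hx
    have hj := hx j
    rw [Function.update_self, Finset.mem_add] at hj
    obtain ⟨u, hu, y, hy, huy⟩ := hj
    obtain ⟨t, ht, rfl⟩ := Finset.mem_image.1 hu
    refine ⟨t, ht, ?_⟩
    rw [mem_core]
    intro k
    by_cases h : k = j
    · subst h
      simp only [Y, Finset.mem_Ico] at hy
      rw [Function.update_self]
      omega
    · have := hx k
      rw [Function.update_of_ne h, Finset.mem_Ico] at this
      rw [Function.update_of_ne h]
      omega
  · rw [Fintype.card_piFinset, ← Finset.mul_prod_erase _ _ (Finset.mem_univ j),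
      Function.update_self]
    have : ∀ k ∈ Finset.univ.erase j, (Function.update
        (fun k => Finset.Ico (c k + 1) (c k + r - 1)) j (X + Y) k).card = r - 2 := by
      intro k hk
      rw [Function.update_of_ne (Finset.ne_of_mem_erase hk), Int.card_Ico]
      omega
    rw [Finset.prod_congr rfl this, Finset.prod_const, Finset.card_erase_of_mem (Finset.mem_univ j),
      Finset.card_univ, Fintype.card_fin, mul_comm]
    gcongr
    omega

/-- If the sites of a line repeat at `m` large translates that are far from each other, then the
number of independent equations is almost `m + 1` boxes, by the estimate `|S + T| ≥ |S| + |T| - 1`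
for sets of integers. -/
theorem le_card_targets {r l m : ℕ} (hr : 3 ≤ r) (hrl : r ≤ l) (hd : 1 ≤ d) (c : Fin d → ℤ)
    (j : Fin d) (p : Fin r → Fin m) (hp : Function.Surjective p) (g : Fin m → Fin d → ℤ)
    (hg : ∀ α β, α ≠ β → g β - g α ∉ smallOffsets d (2 * l)) :
    (m + 1) * (r - 3) ^ d ≤
      (targets r (fun t : Fin r => Function.update c j (c j + (t : ℕ))) fun t => g (p t)).card := by
  classical
  let S : Fin m → Finset (Fin r) := fun α => Finset.univ.filter fun t => p t = α
  have hS : ∀ α, (S α).Nonempty := fun α => by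
    obtain ⟨t, ht⟩ := hp α
    exact ⟨t, by simp [S, ht]⟩
  choose R hR hRc using fun α => exists_subset_cores hr c j (S α) (hS α)
  have hclose : ∀ t t' : Fin r, Function.update c j (c j + ((t' : ℕ) : ℤ)) -
      Function.update c j (c j + ((t : ℕ) : ℤ)) ∈ smallOffsets d l := by
    intro t t'
    rw [mem_smallOffsets]
    intro k
    simp only [Pi.sub_apply]
    by_cases h : k = j
    · subst h
      simp only [Function.update_self]
      omega
    · simp only [Function.update_of_ne h]
      omega
  have hsub : (Finset.univ.biUnion fun α => (R α).image fun x => x + g α) ⊆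
      targets r (fun t : Fin r => Function.update c j (c j + (t : ℕ))) fun t => g (p t) := by
    intro v hv
    simp only [Finset.mem_biUnion, Finset.mem_univ, true_and, Finset.mem_image] at hv
    obtain ⟨α, x, hx, rfl⟩ := hv
    obtain ⟨t, ht, hxt⟩ := hR α x hx
    simp only [targets, Finset.mem_biUnion, Finset.mem_univ, true_and, Finset.mem_image]
    refine ⟨t, x, hxt, ?_⟩
    simp only [S, Finset.mem_filter, Finset.mem_univ, true_and] at ht
    rw [ht]
  refine le_trans ?_ (Finset.card_le_card hsub)
  rw [Finset.card_biUnion]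
  · simp only [Finset.card_image_of_injective _ (add_left_injective _)]
    refine le_trans ?_ (Finset.sum_le_sum fun α _ => hRc α)
    rw [← Finset.mul_sum, Finset.sum_add_distrib]
    have h1 : ∑ α, (S α).card = r := by
      have := Finset.card_eq_sum_card_fiberwise (f := p) (s := Finset.univ) (t := Finset.univ)
        (fun _ _ => Finset.mem_coe.2 (Finset.mem_univ _))
      simpa [S] using this.symm
    rw [h1]
    simp only [Finset.sum_const, Finset.card_univ, Fintype.card_fin, smul_eq_mul]
    obtain ⟨e, rfl⟩ : ∃ e, d = e + 1 := ⟨d - 1, by omega⟩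
    rw [Nat.add_sub_cancel, pow_succ]
    calc (m + 1) * ((r - 3) ^ e * (r - 3)) = (r - 3) ^ e * ((r - 3) + m * (r - 3)) := by ring
      _ ≤ _ := by gcongr; omega
  · intro α _ β _ hαβ
    refine Finset.disjoint_left.2 fun v hv hv' => ?_
    obtain ⟨x, hx, rfl⟩ := Finset.mem_image.1 hv
    obtain ⟨x', hx', hxx⟩ := Finset.mem_image.1 hv'
    obtain ⟨t, ht, hxt⟩ := hR α x hx
    obtain ⟨t', ht', hxt'⟩ := hR β x' hx'
    exact disjoint_translates hrl (hclose t t') (hg α β hαβ) x hxt x' hxt' hxx.symm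

theorem prob_badLine_le {r l : ℕ} (hr : 3 ≤ r) (hrl : r ≤ l) (hd : 1 ≤ d) (hq : 0 < q) :
    prob (fun σ : Labeling d n q => (NoNear r (2 * l) σ ∧ NoClose r l (2 * l) σ) ∧
        BadLine r σ) ≤
      (n : ℝ) ^ d * (d * ∑ m ∈ Finset.Icc 1 r, ((r : ℝ) ^ r * (((2 * n : ℝ) ^ d) ^ m *
        (((q : ℝ) ^ (r - 3) ^ d)⁻¹) ^ (m + 1)))) := by
  classical
  have : Nonempty (Fin r) := ⟨⟨0, by omega⟩⟩
  let c' : (Fin d → ℤ) → Fin d → Fin r → Fin d → ℤ := fun c j t =>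
    Function.update c j (c j + ((t : ℕ) : ℤ))
  have hclose : ∀ c j t t', c' c j t' - c' c j t ∈ smallOffsets d l := by
    intro c j t t'
    rw [mem_smallOffsets]
    intro k
    simp only [Pi.sub_apply, c']
    by_cases h : k = j
    · subst h
      simp only [Function.update_self]
      omega
    · simp only [Function.update_of_ne h]
      omega
  let E : (Fin d → ℤ) → Fin d → ℕ → Labeling d n q → Prop := fun c j m σ =>
    ∃ p ∈ (Finset.univ : Finset (Fin r → Fin m)),
      ∃ g ∈ Fintype.piFinset fun _ : Fin m => smallOffsets d n,
      ((∀ t, IsSite n r (c' c j t)) ∧ Function.Surjective p ∧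
        (∀ α, g α ∉ smallOffsets d (2 * l)) ∧
        (∀ α β, α ≠ β → g β - g α ∉ smallOffsets d (2 * l))) ∧
        ∀ t, Repeats r (c' c j t) (g (p t)) σ
  have hE : ∀ c j m, m ∈ Finset.Icc 1 r → prob (E c j m) ≤ (r : ℝ) ^ r * (((2 * n : ℝ) ^ d) ^ m *
        (((q : ℝ) ^ (r - 3) ^ d)⁻¹) ^ (m + 1)) := by
    intro c j m hm
    rw [Finset.mem_Icc] at hm
    refine (prob_exists_le _ _ fun p _ => (prob_exists_le _ _ fun g _ => prob_and_le _ _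
      (B := (((q : ℝ) ^ (r - 3) ^ d)⁻¹) ^ (m + 1)) (by positivity) fun h => ?_).trans
      (mul_le_mul_of_nonneg_right (c := ((2 * n : ℝ) ^ d) ^ m) ?_ (by positivity))).trans
      (mul_le_mul_of_nonneg_right ?_ (by positivity))
    · obtain ⟨hs, hp, hg, hgg⟩ := h
      refine (prob_repeats_family_le hs (fun y y' x hx =>
            add_notMem_core hrl (hclose c j y y') (hg _) hx) hq).trans ?_
      rw [inv_pow, ← pow_mul]
      have h1 : (1 : ℝ) ≤ q := by exact_mod_cast hq
      refine inv_anti₀ (by positivity) (pow_le_pow_right₀ h1 ?_)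
      rw [mul_comm]
      exact le_card_targets hr hrl hd c j p hp g hgg
    · rw [Fintype.card_piFinset]
      simp only [Finset.prod_const, Finset.card_univ, Fintype.card_fin]
      push_cast
      gcongr
      exact card_smallOffsets_le n
    · rw [Finset.card_univ, Fintype.card_fun, Fintype.card_fin, Fintype.card_fin]
      push_cast
      gcongr
      exact hm.2
  have hsum : ∀ c j, prob (fun σ => ∃ m ∈ Finset.Icc 1 r, E c j m σ) ≤
      ∑ m ∈ Finset.Icc 1 r, ((r : ℝ) ^ r * (((2 * n : ℝ) ^ d) ^ m *
        (((q : ℝ) ^ (r - 3) ^ d)⁻¹) ^ (m + 1))) := fun c j =>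
    (prob_exists_le_sum _ _).trans (Finset.sum_le_sum fun m hm => hE c j m hm)
  calc _ ≤ prob (fun σ : Labeling d n q => ∃ c ∈ vertices d n,
        ∃ j ∈ (Finset.univ : Finset (Fin d)), ∃ m ∈ Finset.Icc 1 r, E c j m σ) := by
        refine prob_mono fun σ h => ?_
        obtain ⟨⟨h1, h2⟩, c, hc, j, hbad⟩ := h
        choose hs a ha0 ha using hbad
        have hfar := fun t t' => far_of_noNear_of_noClose h1 h2 (hs t) (hs t') (hclose c j t t')
          (ha0 t) (ha0 t') (ha t) (ha t')
        let I := Finset.univ.image a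
        let e := I.equivFin
        have hI : ∀ α, ∃ t, a t = (e.symm α : Fin d → ℤ) := fun α => by
          obtain ⟨t, _, ht⟩ := Finset.mem_image.1 (e.symm α).2
          exact ⟨t, ht⟩
        have hIa : ∀ t, a t ∈ I := fun t => Finset.mem_image_of_mem _ (Finset.mem_univ t)
        refine ⟨c, hc, j, Finset.mem_univ _, I.card, ?_, fun t => e ⟨a t, hIa t⟩,
          Finset.mem_univ _, fun α => (e.symm α : Fin d → ℤ), ?_, ⟨hs, ?_, ?_, ?_⟩, ?_⟩
        · rw [Finset.mem_Icc]
          refine ⟨Finset.card_pos.2 ⟨a ⟨0, by omega⟩, hIa _⟩, ?_⟩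
          simpa using (Finset.card_image_le (s := Finset.univ) (f := a))
        · rw [Fintype.mem_piFinset]
          intro α
          obtain ⟨t, ht⟩ := hI α
          rw [← ht]
          exact (ha t).mem_smallOffsets hr (hs t)
        · intro α
          obtain ⟨t, ht⟩ := hI α
          exact ⟨t, by simp [ht]⟩
        · intro α
          obtain ⟨t, ht⟩ := hI α
          beta_reduce
          rw [← ht]
          exact (hfar t t).1
        · intro α β hαβ
          obtain ⟨t, ht⟩ := hI α
          obtain ⟨t', ht'⟩ := hI β
          beta_reduce
          rw [← ht, ← ht']
          refine (hfar t t').2.resolve_left fun h => hαβ ?_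
          rw [ht, ht'] at h
          exact e.symm.injective (Subtype.ext h)
        · intro t
          simpa using ha t
    _ ≤ (vertices d n).card * (d * ∑ m ∈ Finset.Icc 1 r, ((r : ℝ) ^ r * (((2 * n : ℝ) ^ d) ^ m *
        (((q : ℝ) ^ (r - 3) ^ d)⁻¹) ^ (m + 1)))) := by
        refine prob_exists_le _ _ fun c _ => (prob_exists_le _ _ fun j _ => hsum c j).trans ?_
        simp
    _ = _ := by rw [card_vertices]; push_cast; rfl

end line

/-! ### Labelings that fill up from the corner box -/

section fillable

/-- The corner site is good, and every set that contains the corner box and is closed under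
completing good boxes is everything. -/
def Fillable {d n q : ℕ} (r : ℕ) (σ : Labeling d n q) : Prop :=
  0 ∉ badSites r σ ∧ ∀ K : Set (Fin d → ℤ), ClosedUnder n r (badSites r σ) K →
    (∀ v ∈ cube r (0 : Fin d → ℤ), v ∈ K) → ∀ v ∈ vertices d n, v ∈ K

variable {d n q : ℕ}

theorem isSite_zero {r : ℕ} (h : r ≤ n) : IsSite n r (0 : Fin d → ℤ) := by
  intro k
  simp only [Pi.zero_apply]
  omega

theorem fillable_of_no_bad {r : ℕ} (hr : 1 ≤ r) (hrn : r ≤ n) {σ : Labeling d n q}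
    (h : ∀ c, IsSite n r c → c ∉ badSites r σ) : Fillable r σ :=
  ⟨h 0 (isSite_zero hrn), fun _ hK h0 => hK.eq_of_no_bad hr hrn h0 h⟩

theorem prob_not_fillable_le {r C : ℕ} (hd : 2 ≤ d) (hr : 3 ≤ r) (hrn : r ≤ n) (hC : 0 < C)
    (hq : 0 < q) {l : ℕ} (hl : l = (4 * C + 6) * r) :
    prob (fun σ : Labeling d n q => ¬ Fillable r σ) ≤
      (n : ℝ) ^ d * ((2 * (2 * l : ℕ) : ℝ) ^ d * ((q : ℝ) ^ (r - 2) ^ d)⁻¹) +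
      (n : ℝ) ^ d * ((2 * l : ℝ) ^ d * ((2 * n : ℝ) ^ d * ((2 * (2 * l : ℕ) : ℝ) ^ d *
        (((q : ℝ) ^ (r - 2) ^ d)⁻¹) ^ 2))) +
      (4 * l + 2 : ℝ) ^ d * ((2 * n : ℝ) ^ d * ((q : ℝ) ^ (r - 2) ^ d)⁻¹) +
      (n : ℝ) ^ d * ((l : ℝ) ^ d * ((2 * n : ℝ) ^ d * ((q : ℝ) ^ (r - 2) ^ d)⁻¹)) ^ C +
      (n : ℝ) ^ d * (d * ∑ m ∈ Finset.Icc 1 r, ((r : ℝ) ^ r * (((2 * n : ℝ) ^ d) ^ m *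
        (((q : ℝ) ^ (r - 3) ^ d)⁻¹) ^ (m + 1)))) := by
  have hrl : r ≤ l := by rw [hl]; nlinarith
  let E1 : Labeling d n q → Prop := fun σ => ¬ NoNear r (2 * l) σ
  let E2 : Labeling d n q → Prop := fun σ => ¬ NoClose r l (2 * l) σ
  let E3 : Labeling d n q → Prop := fun σ =>
    ∃ c, IsSite n r c ∧ IsCorner n r l c ∧ c ∈ badSites r σ
  let E4 : Labeling d n q → Prop := fun σ =>
    (NoNear r (2 * l) σ ∧ NoClose r l (2 * l) σ) ∧ ManyBad r l C σ
  let E5 : Labeling d n q → Prop := fun σ =>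
    (NoNear r (2 * l) σ ∧ NoClose r l (2 * l) σ) ∧ BadLine r σ
  have hmain : ∀ σ : Labeling d n q, ¬ Fillable r σ → (((E1 σ ∨ E2 σ) ∨ E3 σ) ∨ E4 σ) ∨ E5 σ := by
    intro σ hσ
    by_contra hE
    simp only [not_or] at hE
    obtain ⟨⟨⟨⟨h1, h2⟩, h3⟩, h4⟩, h5⟩ := hE
    simp only [E1, E2, E3, E4, E5, not_not] at h1 h2 h3 h4 h5
    have hM : ¬ ManyBad r l C σ := fun h => h4 ⟨⟨h1, h2⟩, h⟩
    have hL : ¬ BadLine r σ := fun h => h5 ⟨⟨h1, h2⟩, h⟩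
    have hcorner : ∀ c, IsSite n r c → (∀ k, c k ≤ 2 * l ∨ (n : ℤ) - r - 2 * l ≤ c k) →
        c ∉ badSites r σ := fun c hc hcc hb => h3 ⟨c, hc, hcc, hb⟩
    refine hσ ⟨hcorner 0 (isSite_zero hrn) fun k => Or.inl (by simp only [Pi.zero_apply]; omega),
      fun K hK h0 => hK.eq_of_mostlyClean hd (by omega) hrn
        (mostlyClean_of_not_manyBad (by omega) (by omega) hM) ?_ h0 hcorner fun c j hs => ?_⟩
    · rw [hl]; nlinarith
    · by_contra! hbad
      refine hL ⟨c, ?_, j, fun t => ⟨hs t t.2, hbad t t.2⟩⟩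
      have := hs 0 (by omega)
      simp only [Nat.cast_zero, add_zero, Function.update_eq_self] at this
      exact this.mem_vertices (by omega)
  calc _ ≤ prob (fun σ => (((E1 σ ∨ E2 σ) ∨ E3 σ) ∨ E4 σ) ∨ E5 σ) := prob_mono hmain
    _ ≤ prob E1 + prob E2 + prob E3 + prob E4 + prob E5 := by
      refine (prob_or _ _).trans ?_
      gcongr
      refine (prob_or _ _).trans ?_
      gcongr
      refine (prob_or _ _).trans ?_
      gcongr
      exact prob_or _ _
    _ ≤ _ := by
      gcongr
      · exact prob_not_noNear_le hr hq
      · exact prob_not_noClose_le hr hrl hq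
      · exact prob_corner_le hr hq
      · exact prob_manyBad_le hr hrl hC hq
      · exact prob_badLine_le hr hrl (by omega) hq

/-- The preceding bound in terms of `r` only. Here `y` bounds the expected number of translates
at which a given box, two layers thinner, is repeated. -/
theorem exists_prob_not_fillable_le (hd : 2 ≤ d) {C : ℕ} (hC : 0 < C) :
    ∃ (M : ℝ) (k : ℕ), ∀ {n q r : ℕ} {y : ℝ}, 0 < q → 3 ≤ r → r ≤ n → 0 < y → 2 ^ d * y ≤ 1 →
      (n : ℝ) ^ d * ((q : ℝ) ^ (r - 3) ^ d)⁻¹ ≤ y → (n : ℝ) ^ d * y ^ C ≤ y →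
      prob (fun σ : Labeling d n q => ¬ Fillable r σ) ≤ M * ((r : ℝ) ^ (r + k) * y) := by
  obtain ⟨A, hA⟩ : ∃ A : ℝ, A = 4 * C + 6 := ⟨_, rfl⟩
  have hA1 : 1 ≤ A := by rw [hA]; linarith [(Nat.cast_nonneg C : (0 : ℝ) ≤ C)]
  refine ⟨(4 * A) ^ d + (2 * A) ^ d * 2 ^ d * (4 * A) ^ d + (6 * A) ^ d * 2 ^ d +
    (A ^ d * 2 ^ d) ^ C + d, d * C + 2 * d + 1, ?_⟩
  intro n q r y hq hr hrn hy hy2 hz hyC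
  have hrR : (3 : ℝ) ≤ r := by exact_mod_cast hr
  have hr1 : (1 : ℝ) ≤ r := by linarith
  have hq1 : (1 : ℝ) ≤ q := by exact_mod_cast hq
  have hy1 : y ≤ 1 := by
    have : (1 : ℝ) ≤ 2 ^ d := one_le_pow₀ (by norm_num)
    nlinarith
  have hl : (((4 * C + 6) * r : ℕ) : ℝ) = A * r := by push_cast; rw [hA]
  have hl2 : ((2 * ((4 * C + 6) * r) : ℕ) : ℝ) = 2 * (A * r) := by push_cast; rw [hA]
  refine (prob_not_fillable_le hd hr hrn hC hq rfl).trans ?_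
  rw [hl, hl2]
  have hb : ((q : ℝ) ^ (r - 2) ^ d)⁻¹ ≤ ((q : ℝ) ^ (r - 3) ^ d)⁻¹ := by
    refine inv_anti₀ (by positivity) (pow_le_pow_right₀ hq1 (Nat.pow_le_pow_left (by omega) d))
  have hz2 : (n : ℝ) ^ d * ((q : ℝ) ^ (r - 2) ^ d)⁻¹ ≤ y :=
    (mul_le_mul_of_nonneg_left hb (by positivity)).trans hz
  have hb0 : 0 ≤ ((q : ℝ) ^ (r - 2) ^ d)⁻¹ := by positivity
  generalize ((q : ℝ) ^ (r - 2) ^ d)⁻¹ = b2 at *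
  have hb3 : 0 ≤ ((q : ℝ) ^ (r - 3) ^ d)⁻¹ := by positivity
  generalize ((q : ℝ) ^ (r - 3) ^ d)⁻¹ = b3 at *
  have e2n : (2 * n : ℝ) ^ d = 2 ^ d * (n : ℝ) ^ d := mul_pow _ _ _
  rw [e2n]
  have hN : 0 ≤ (n : ℝ) ^ d := by positivity
  generalize (n : ℝ) ^ d = N at *
  have hpow : ∀ e ≤ r + (d * C + 2 * d + 1), (r : ℝ) ^ e * y ≤
      (r : ℝ) ^ (r + (d * C + 2 * d + 1)) * y := fun e he => by
    gcongr
  have hd2 : d ≤ r + (d * C + 2 * d + 1) := by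
    have := Nat.zero_le (d * C)
    omega
  have t1 : N * ((2 * (2 * (A * r))) ^ d * b2) ≤
      (4 * A) ^ d * ((r : ℝ) ^ (r + (d * C + 2 * d + 1)) * y) := by
    calc _ = (4 * A) ^ d * ((r : ℝ) ^ d * (N * b2)) := by
          rw [show 2 * (2 * (A * r)) = 4 * A * r by ring, mul_pow]; ring
      _ ≤ (4 * A) ^ d * ((r : ℝ) ^ d * y) := by gcongr
      _ ≤ _ := by gcongr ?_ * ?_; exact hpow d hd2
  have t2 : N * ((2 * (A * r)) ^ d * (2 ^ d * N * ((2 * (2 * (A * r))) ^ d * b2 ^ 2))) ≤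
      (2 * A) ^ d * 2 ^ d * (4 * A) ^ d * ((r : ℝ) ^ (r + (d * C + 2 * d + 1)) * y) := by
    calc _ = (2 * A) ^ d * 2 ^ d * (4 * A) ^ d * ((r : ℝ) ^ (2 * d) * ((N * b2) * (N * b2))) := by
          rw [show 2 * (2 * (A * r)) = 4 * A * r by ring, mul_pow (4 * A),
            show 2 * (A * r) = 2 * A * r by ring, mul_pow (2 * A) (r : ℝ)]; ring
      _ ≤ (2 * A) ^ d * 2 ^ d * (4 * A) ^ d * ((r : ℝ) ^ (2 * d) * (y * 1)) := by
          gcongr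
          exact hz2.trans hy1
      _ ≤ _ := by
          rw [mul_one]
          gcongr ?_ * ?_
          refine hpow _ ?_
          have := Nat.zero_le (d * C)
          omega
  have t3 : (4 * (A * r) + 2) ^ d * (2 ^ d * N * b2) ≤
      (6 * A) ^ d * 2 ^ d * ((r : ℝ) ^ (r + (d * C + 2 * d + 1)) * y) := by
    calc _ ≤ (6 * A * r) ^ d * (2 ^ d * (N * b2)) := by
          rw [mul_assoc (2 ^ d)]
          gcongr
          nlinarith
      _ = (6 * A) ^ d * 2 ^ d * ((r : ℝ) ^ d * (N * b2)) := by rw [mul_pow (6 * A)]; ring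
      _ ≤ (6 * A) ^ d * 2 ^ d * ((r : ℝ) ^ d * y) := by gcongr
      _ ≤ _ := by gcongr ?_ * ?_; exact hpow d hd2
  have t4 : N * ((A * r) ^ d * (2 ^ d * N * b2)) ^ C ≤
      (A ^ d * 2 ^ d) ^ C * ((r : ℝ) ^ (r + (d * C + 2 * d + 1)) * y) := by
    calc _ = (A ^ d * 2 ^ d) ^ C * ((r : ℝ) ^ (d * C) * (N * (N * b2) ^ C)) := by
          rw [pow_mul, mul_pow A]
          rw [show A ^ d * (r : ℝ) ^ d * (2 ^ d * N * b2) =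
            (A ^ d * 2 ^ d) * ((r : ℝ) ^ d) * (N * b2) by ring, mul_pow, mul_pow]
          ring
      _ ≤ (A ^ d * 2 ^ d) ^ C * ((r : ℝ) ^ (d * C) * (N * y ^ C)) := by gcongr
      _ ≤ (A ^ d * 2 ^ d) ^ C * ((r : ℝ) ^ (d * C) * y) := by gcongr
      _ ≤ _ := by
          gcongr ?_ * ?_
          exact hpow _ (by omega)
  have t5 : N * (d * ∑ m ∈ Finset.Icc 1 r, ((r : ℝ) ^ r * ((2 ^ d * N) ^ m * b3 ^ (m + 1)))) ≤
      d * ((r : ℝ) ^ (r + (d * C + 2 * d + 1)) * y) := by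
    have hterm : ∀ m ∈ Finset.Icc 1 r,
        N * ((r : ℝ) ^ r * ((2 ^ d * N) ^ m * b3 ^ (m + 1))) ≤ (r : ℝ) ^ r * y := by
      intro m _
      calc _ = (r : ℝ) ^ r * ((2 ^ d * (N * b3)) ^ m * (N * b3)) := by
            rw [pow_succ, mul_pow, mul_pow, mul_pow]; ring
        _ ≤ (r : ℝ) ^ r * (1 * y) := by
            gcongr
            refine pow_le_one₀ (by positivity) (le_trans ?_ hy2)
            gcongr
        _ = _ := by rw [one_mul]
    calc _ = d * ∑ m ∈ Finset.Icc 1 r, N * ((r : ℝ) ^ r * ((2 ^ d * N) ^ m * b3 ^ (m + 1))) := by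
          rw [mul_left_comm, Finset.mul_sum]
      _ ≤ d * (((Finset.Icc 1 r).card : ℝ) * ((r : ℝ) ^ r * y)) := by
          gcongr
          rw [← nsmul_eq_mul]
          exact Finset.sum_le_card_nsmul _ _ _ hterm
      _ = d * ((r : ℝ) ^ (r + 1) * y) := by
          rw [Nat.card_Icc, Nat.add_sub_cancel, pow_succ]; ring
      _ ≤ _ := by
          gcongr ?_ * ?_
          exact hpow _ (by omega)
  linarith

/-- A power of `r` of order `r` is negligible against `q ^ (κ r ^ d)`, as `d ≥ 2`. -/
theorem tendsto_pow_mul_rpow (hd : 2 ≤ d) (hq : 2 ≤ q) {κ : ℝ} (hκ : 0 < κ) (k : ℕ) :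
    Tendsto (fun r : ℕ => (r : ℝ) ^ (r + k) * (q : ℝ) ^ (-(κ * (r : ℝ) ^ d))) atTop (𝓝 0) := by
  have hq0 : (0 : ℝ) < q := by positivity
  have hlq : 0 < Real.log q := Real.log_pos (by exact_mod_cast hq)
  obtain ⟨c, hc⟩ : ∃ c, c = κ * Real.log q := ⟨_, rfl⟩
  have hc0 : 0 < c := by rw [hc]; positivity
  have hlog : ∀ᶠ r : ℕ in atTop, Real.log r ≤ c / 4 * r := by
    have h1 := Real.isLittleO_log_id_atTop.bound (c := c / 4) (by positivity)
    have h2 := tendsto_natCast_atTop_atTop (R := ℝ) |>.eventually h1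
    filter_upwards [h2, eventually_ge_atTop 1] with r hr hr1
    have hr1' : (1 : ℝ) ≤ r := by exact_mod_cast hr1
    simpa [abs_of_nonneg (Real.log_nonneg hr1')] using hr
  have hlim : Tendsto (fun r : ℕ => Real.exp (-(c / 2 * r))) atTop (𝓝 0) := by
    refine Real.tendsto_exp_neg_atTop_nhds_zero.comp ?_
    exact (tendsto_natCast_atTop_atTop (R := ℝ)).const_mul_atTop (by positivity)
  refine squeeze_zero' (Eventually.of_forall fun r => by positivity) ?_ hlim
  filter_upwards [hlog, eventually_ge_atTop (max k 1)] with r hr hrk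
  have hr1 : (1 : ℝ) ≤ r := by exact_mod_cast (le_max_right k 1).trans hrk
  have hk : (k : ℝ) ≤ r := by exact_mod_cast (le_max_left k 1).trans hrk
  have hr0 : (0 : ℝ) < r := by linarith
  rw [Real.rpow_def_of_pos hq0, ← Real.exp_log (pow_pos hr0 (r + k)), Real.log_pow,
    ← Real.exp_add, Real.exp_le_exp]
  push_cast
  have h2 : (r : ℝ) ^ 2 ≤ (r : ℝ) ^ d := pow_le_pow_right₀ hr1 hd
  have h3 : 0 ≤ Real.log r := Real.log_nonneg hr1
  have h4 : ((r : ℝ) + k) * Real.log r ≤ (2 * r) * (c / 4 * r) := by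
    refine mul_le_mul (by linarith) hr h3 (by positivity)
  have h5 : Real.log q * -(κ * (r : ℝ) ^ d) = - (c * (r : ℝ) ^ d) := by rw [hc]; ring
  rw [h5]
  have h6 : c * (r : ℝ) ^ 2 ≤ c * (r : ℝ) ^ d := by gcongr
  have h7 : c * (r : ℝ) ≤ c * (r : ℝ) ^ 2 := by
    gcongr
    nlinarith
  nlinarith

theorem AboveThreshold.tendsto {c ε : ℝ} {r : ℕ → ℕ} (hc : 0 < c) (hε : 0 < ε) (hq : 2 ≤ q)
    (h : AboveThreshold d q c ε r) : Tendsto r atTop atTop := by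
  have hlq : 0 < Real.log q := Real.log_pos (by exact_mod_cast hq)
  have hlim : Tendsto (fun n : ℕ => c * (1 + ε) * Real.log n / Real.log q) atTop atTop := by
    refine Tendsto.atTop_div_const hlq ?_
    exact (Real.tendsto_log_atTop.comp tendsto_natCast_atTop_atTop).const_mul_atTop (by positivity)
  rw [tendsto_atTop]
  intro b
  filter_upwards [h, hlim.eventually_gt_atTop ((b : ℝ) ^ d)] with n hn hb
  have := hb.trans_le hn.2.2
  have h1 : b ^ d < r n ^ d := by exact_mod_cast this
  exact (lt_of_pow_lt_pow_left₀ d (Nat.zero_le _) h1).le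

theorem fillable_whp_of_two_le {ε : ℝ} (hε : 0 < ε) (hd : 2 ≤ d) (hq : 2 ≤ q) {r : ℕ → ℕ}
    (h : AboveThreshold d q d ε r) :
    WithHighProbability d q fun n σ => Fillable (r n) σ := by
  have hd0 : (0 : ℝ) < d := by positivity
  have hq0 : (0 : ℝ) < q := by positivity
  have hq1 : (1 : ℝ) < q := by exact_mod_cast hq
  have hlq : 0 < Real.log q := Real.log_pos hq1
  have hr := h.tendsto hd0 hε hq
  obtain ⟨κ, hκ⟩ : ∃ κ, κ = ε / (2 * (1 + ε)) := ⟨_, rfl⟩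
  have hκ0 : 0 < κ := by rw [hκ]; positivity
  obtain ⟨C, hC⟩ := exists_nat_gt ((1 + κ) / κ)
  have hC0 : 0 < C := by
    have : 0 < (1 + κ) / κ := by positivity
    exact_mod_cast this.trans hC
  rw [div_lt_iff₀ hκ0] at hC
  obtain ⟨M, k, hM⟩ := exists_prob_not_fillable_le hd hC0
  have hlim := fun k => (tendsto_pow_mul_rpow hd hq hκ0 k).comp hr
  have hlimM := (hlim k).const_mul M
  rw [mul_zero] at hlimM
  refine withHighProbability_of_le (by omega) _ _ hlimM ?_
  have hsmall : ∀ᶠ n in atTop, 2 ^ d * (q : ℝ) ^ (-(κ * (r n : ℝ) ^ d)) ≤ 1 := by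
    have h1 := (hlim 0).const_mul (2 ^ d)
    rw [mul_zero] at h1
    filter_upwards [h1.eventually_le_const one_pos, h] with n hn hrn
    refine le_trans ?_ hn
    have : (1 : ℝ) ≤ (r n : ℝ) ^ (r n + 0) := one_le_pow₀ (by exact_mod_cast hrn.1)
    simp only [Function.comp]
    gcongr
    exact le_mul_of_one_le_left (by positivity) this
  have hbig : ∀ᶠ n in atTop, 3 * d / κ ≤ r n :=
    (tendsto_natCast_atTop_atTop.comp hr).eventually_ge_atTop _
  filter_upwards [h, hsmall, hbig, hr.eventually_ge_atTop 3] with n hn hy hb hr3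
  obtain ⟨h1, hrn, hthr⟩ := hn
  have hr0 : (0 : ℝ) < r n := by exact_mod_cast h1
  have hn0 : (0 : ℝ) < n := by exact_mod_cast (by omega : 0 < n)
  have hnq : (n : ℝ) ^ d ≤ (q : ℝ) ^ ((1 - 2 * κ) * (r n : ℝ) ^ d) := by
    rw [Real.rpow_def_of_pos hq0, ← Real.exp_log (pow_pos hn0 d), Real.exp_le_exp, Real.log_pow]
    rw [div_le_iff₀ hlq] at hthr
    have e : 1 - 2 * κ = 1 / (1 + ε) := by rw [hκ]; field_simp; ring
    rw [e]
    have : d * Real.log n = (d * (1 + ε) * Real.log n) / (1 + ε) := by field_simp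
    rw [this, div_le_iff₀ (by positivity)]
    refine hthr.trans_eq ?_
    field_simp
  refine hM (by omega) hr3 hrn (by positivity) hy ?_ ?_
  · have hB : (1 - κ) * (r n : ℝ) ^ d ≤ (((r n - 3) ^ d : ℕ) : ℝ) := by
      have e1 : (((r n - 3) ^ d : ℕ) : ℝ) = (1 + (-(3 / (r n : ℝ)))) ^ d * (r n : ℝ) ^ d := by
        rw [← mul_pow]
        push_cast [Nat.cast_sub hr3]
        congr 1
        field_simp
        ring
      rw [e1]
      refine mul_le_mul_of_nonneg_right ?_ (by positivity)
      have h3 : 3 / (r n : ℝ) ≤ 1 := by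
        rw [div_le_one hr0]; exact_mod_cast hr3
      refine le_trans ?_ (one_add_mul_le_pow (by linarith) d)
      have : d * (3 / (r n : ℝ)) ≤ κ := by
        rw [mul_div_assoc', div_le_iff₀ hr0]
        rw [div_le_iff₀ hκ0] at hb
        linarith
      linarith
    calc (n : ℝ) ^ d * ((q : ℝ) ^ (r n - 3) ^ d)⁻¹
        ≤ (q : ℝ) ^ ((1 - 2 * κ) * (r n : ℝ) ^ d) * (q : ℝ) ^ (-((1 - κ) * (r n : ℝ) ^ d)) := by
          gcongr
          rw [Real.rpow_neg hq0.le]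
          refine inv_anti₀ (by positivity) ?_
          rw [← Real.rpow_natCast (q : ℝ) ((r n - 3) ^ d)]
          exact Real.rpow_le_rpow_of_exponent_le hq1.le hB
      _ = (q : ℝ) ^ (-(κ * (r n : ℝ) ^ d)) := by
          rw [← Real.rpow_add hq0]; congr 1; ring
  · calc (n : ℝ) ^ d * ((q : ℝ) ^ (-(κ * (r n : ℝ) ^ d))) ^ C
        ≤ (q : ℝ) ^ ((1 - 2 * κ) * (r n : ℝ) ^ d) * ((q : ℝ) ^ (-(κ * (r n : ℝ) ^ d))) ^ C := by
          gcongr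
      _ = (q : ℝ) ^ ((1 - 2 * κ) * (r n : ℝ) ^ d + -(κ * (r n : ℝ) ^ d) * C) := by
          rw [Real.rpow_add hq0, Real.rpow_mul_natCast hq0.le]
      _ ≤ _ := by
          refine Real.rpow_le_rpow_of_exponent_le hq1.le ?_
          have : 0 ≤ (r n : ℝ) ^ d := by positivity
          nlinarith

theorem fillable_whp_one {ε : ℝ} (hε : 0 < ε) (hq : 2 ≤ q) {r : ℕ → ℕ}
    (h : AboveThreshold 1 q 2 ε r) :
    WithHighProbability 1 q fun n σ => Fillable (r n) σ := by
  have hq0 : (0 : ℝ) < q := by positivity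
  have hq1 : (1 : ℝ) < q := by exact_mod_cast hq
  have hlq : 0 < Real.log q := Real.log_pos hq1
  have hr := h.tendsto (by norm_num) hε hq
  have hlim : Tendsto (fun n : ℕ => 2 * (q : ℝ) ^ 2 * (n : ℝ) ^ (-(2 * ε))) atTop (𝓝 0) := by
    have := ((tendsto_rpow_neg_atTop (y := 2 * ε) (by positivity)).comp
      (tendsto_natCast_atTop_atTop (R := ℝ))).const_mul (2 * (q : ℝ) ^ 2)
    rw [mul_zero] at this
    exact this
  refine withHighProbability_of_le (by omega) _ _ hlim ?_
  filter_upwards [h, hr.eventually_ge_atTop 3] with n hn hr3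
  obtain ⟨h1, hrn, hthr⟩ := hn
  have hn0 : (0 : ℝ) < n := by exact_mod_cast (by omega : 0 < n)
  calc prob (fun σ : Labeling 1 n q => ¬ Fillable (r n) σ)
      ≤ prob (fun σ : Labeling 1 n q => ∃ c, IsSite n (r n) c ∧ c ∈ badSites (r n) σ) := by
        refine prob_mono fun σ hσ => ?_
        by_contra! hc
        exact hσ (fillable_of_no_bad h1 hrn hc)
    _ ≤ _ := prob_exists_bad_le hr3 (by omega)
    _ = 2 * (n : ℝ) ^ 2 * (q : ℝ) ^ 2 * ((q : ℝ) ^ (r n))⁻¹ := by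
        simp only [pow_one]
        have : (q : ℝ) ^ (r n) = (q : ℝ) ^ (r n - 2) * (q : ℝ) ^ 2 := by
          rw [← pow_add]; congr 1; omega
        rw [this]
        field_simp
    _ ≤ 2 * (n : ℝ) ^ 2 * (q : ℝ) ^ 2 * (n : ℝ) ^ (-(2 * (1 + ε))) := by
        gcongr
        rw [Real.rpow_neg hn0.le]
        refine inv_anti₀ (by positivity) ?_
        rw [← Real.exp_log (pow_pos hq0 (r n)), Real.rpow_def_of_pos hn0, Real.exp_le_exp,
          Real.log_pow]
        rw [div_le_iff₀ hlq, pow_one] at hthr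
        linarith
    _ = _ := by
        have : (n : ℝ) ^ 2 * (n : ℝ) ^ (-(2 * (1 + ε))) = (n : ℝ) ^ (-(2 * ε)) := by
          rw [← Real.rpow_natCast, ← Real.rpow_add hn0]
          congr 1
          push_cast
          ring
        rw [← this]
        ring

end fillable

/-! ### Too few profiles -/

section profiles
variable {d n q : ℕ}

theorem card_box_le (d n r : ℕ) : Fintype.card (Box d n r) ≤ n ^ d := by
  refine (Fintype.card_subtype_le _).trans ?_
  simp

/-- There are at most `(n ^ d + 1) ^ (q ^ (r ^ d))` profiles, as each pattern occurs at most `n ^ d`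
times. -/
theorem prob_identifiable_le (r : ℕ) :
    prob (fun σ : Labeling d n q => Identifiable r σ) ≤
      ((n : ℝ) ^ d + 1) ^ q ^ r ^ d / (q : ℝ) ^ n ^ d := by
  classical
  rw [prob_eq_card]
  gcongr
  have h : (Finset.univ.filter fun σ : Labeling d n q => Identifiable r σ).card ≤
      (Finset.univ : Finset (Labeling d r q → Fin (n ^ d + 1))).card := by
    refine Finset.card_le_card_of_injOn (fun σ w => ⟨(profile r σ).count w, ?_⟩)
      (fun _ _ => Finset.mem_coe.2 (Finset.mem_univ _)) ?_
    · refine Nat.lt_succ_of_le ((Multiset.count_le_card _ _).trans ?_)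
      simp only [profile, Multiset.card_map, Finset.card_val]
      exact card_box_le d n r
    · intro σ hσ σ' hσ' h
      simp only [Finset.coe_filter, Finset.mem_univ, true_and, Set.mem_ofPred_eq] at hσ'
      refine hσ' σ (Multiset.ext.2 fun w => ?_)
      have := congrFun h w
      simpa using this
  rw [Finset.card_univ, Fintype.card_fun, card_labeling, Fintype.card_fin] at h
  exact_mod_cast h

theorem not_identifiable_whp {ε : ℝ} (hε : 0 < ε) (hd : 1 ≤ d) (hq : 2 ≤ q) {r : ℕ → ℕ}
    (h : BelowThreshold d q d ε r) :
    WithHighProbability d q fun n σ => ¬ Identifiable (r n) σ := by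
  have hd0 : (0 : ℝ) < d := by positivity
  have hq0 : (0 : ℝ) < q := by positivity
  have hq1 : (1 : ℝ) < q := by exact_mod_cast hq
  have hlq : 0 < Real.log q := Real.log_pos hq1
  -- in terms of `x = n ^ d`, the logarithm of the bound is at most
  -- `x ^ (1 - ε) * log (x + 1) - x * log q`
  have hlog : ∀ᶠ x : ℝ in atTop, x ^ (1 - ε) * Real.log (x + 1) ≤ Real.log q / 2 * x := by
    have h1 := (isLittleO_log_rpow_atTop hε).bound (c := Real.log q / 4) (by positivity)
    filter_upwards [h1, eventually_ge_atTop 2] with x hx hx1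
    have hx0 : 0 < x := by linarith
    have e1 : Real.log (x + 1) ≤ 2 * Real.log x := by
      rw [← Real.log_rpow hx0]
      refine Real.log_le_log (by linarith) ?_
      rw [Real.rpow_two]
      nlinarith
    have e2 : Real.log x ≤ Real.log q / 4 * x ^ ε := by
      rw [Real.norm_of_nonneg (Real.log_nonneg (by linarith)),
        Real.norm_of_nonneg (by positivity)] at hx
      exact hx
    calc x ^ (1 - ε) * Real.log (x + 1) ≤ x ^ (1 - ε) * (2 * (Real.log q / 4 * x ^ ε)) := by
          gcongr; linarith
      _ = Real.log q / 2 * (x ^ (1 - ε) * x ^ ε) := by ring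
      _ = Real.log q / 2 * x := by
          rw [← Real.rpow_add hx0]; simp
  have hnd : Tendsto (fun n : ℕ => (n : ℝ) ^ d) atTop atTop :=
    (tendsto_pow_atTop (by omega)).comp tendsto_natCast_atTop_atTop
  have hlim : Tendsto (fun n : ℕ => Real.exp (-(Real.log q / 2 * (n : ℝ) ^ d))) atTop (𝓝 0) :=
    Real.tendsto_exp_neg_atTop_nhds_zero.comp (hnd.const_mul_atTop (by positivity))
  refine withHighProbability_of_le (by omega) _ _ hlim ?_
  filter_upwards [h, hnd.eventually hlog, eventually_ge_atTop 1] with n hn hlogn hn1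
  simp only [not_not]
  refine (prob_identifiable_le _).trans ?_
  have hn0 : (0 : ℝ) < n := by exact_mod_cast hn1
  have hx0 : (0 : ℝ) < (n : ℝ) ^ d := by positivity
  have hqr : (q : ℝ) ^ (r n) ^ d ≤ ((n : ℝ) ^ d) ^ (1 - ε) := by
    rw [← Real.exp_log (pow_pos hq0 _), Real.rpow_def_of_pos hx0, Real.exp_le_exp, Real.log_pow,
      Real.log_pow]
    have := hn.2
    rw [le_div_iff₀ hlq] at this
    push_cast
    linarith
  rw [div_le_iff₀ (by positivity), ← Real.exp_log (pow_pos hq0 (n ^ d)), ← Real.exp_add,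
    ← Real.exp_log (by positivity : (0 : ℝ) < ((n : ℝ) ^ d + 1) ^ q ^ r n ^ d), Real.exp_le_exp,
    Real.log_pow, Real.log_pow]
  push_cast
  have h0 : 0 ≤ Real.log ((n : ℝ) ^ d + 1) := Real.log_nonneg (by linarith)
  calc (q : ℝ) ^ (r n) ^ d * Real.log ((n : ℝ) ^ d + 1)
      ≤ ((n : ℝ) ^ d) ^ (1 - ε) * Real.log ((n : ℝ) ^ d + 1) := by gcongr
    _ ≤ Real.log q / 2 * (n : ℝ) ^ d := hlogn
    _ = _ := by ring

end profiles

/-! ### Interleaved repeats on a line -/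

section interleaved
variable {n q : ℕ}

/-- The vertex of the one-dimensional box with coordinate `i` (modulo `n`). -/
def pos (hn : 0 < n) (i : ℕ) : Fin 1 → Fin n := fun _ => ⟨i % n, Nat.mod_lt _ hn⟩

theorem pos_injOn (hn : 0 < n) {i j : ℕ} (hi : i < n) (hj : j < n) (h : pos hn i = pos hn j) :
    i = j := by
  have := congrArg Fin.val (congrFun h 0)
  simpa [pos, Nat.mod_eq_of_lt hi, Nat.mod_eq_of_lt hj] using this

theorem restrict_eq_pos (hn : 0 < n) {r : ℕ} (σ : Labeling 1 n q) (B : Box 1 n r)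
    (x : Fin 1 → Fin r) : restrict σ B x = σ (pos hn ((B.1 0 : ℕ) + x 0)) := by
  have h1 : (B.1 0 : ℕ) + r ≤ n := B.2 0
  have hx0 := (x 0).2
  refine congrArg σ (funext fun m => ?_)
  rw [Subsingleton.elim m 0]
  apply Fin.ext
  simp only [pos]
  rw [Nat.mod_eq_of_lt (by omega)]

/-- For `i ≤ j ≤ k ≤ l`, the map that exchanges the segments `[i, j)` and `[k, l)`, and moves the
segment `[j, k)` accordingly. -/
def swapSegments (i j k l v : ℕ) : ℕ :=
  if v < i then v else if v < i + (l - k) then v - i + k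
  else if v < i + (l - j) then v - (i + (l - k)) + j
  else if v < l then v - (i + (l - j)) + i else v

/-- If words `x` and `y` of length `r - 1` occur in the order `x … y … x … y`, then exchanging the
two segments from an `x` to the next `y` does not change the profile. -/
theorem not_identifiable_of_interleaved {r i j k l : ℕ} (hn : 0 < n) (hr : 1 ≤ r) (hij : i + r ≤ j)
    (hjk : j + r ≤ k) (hkl : k + r ≤ l) (hl : l + r ≤ n) (σ : Labeling 1 n q)
    (hx : ∀ t, t + 1 < r → σ (pos hn (i + t)) = σ (pos hn (k + t)))
    (hy : ∀ t, t + 1 < r → σ (pos hn (j + t)) = σ (pos hn (l + t)))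
    (hne : σ (pos hn (i + (r - 1))) ≠ σ (pos hn (k + (r - 1)))) : ¬ Identifiable r σ := by
  let π : ℕ → ℕ := swapSegments i j k l
  have hπdef : ∀ v, π v = swapSegments i j k l v := fun _ => rfl
  have hlt : ∀ v, v < n → π v < n := by
    intro v hv
    rw [hπdef, swapSegments]
    split_ifs <;> omega
  have hinj : ∀ v w, π v = π w → v = w := by
    intro v w h
    rw [hπdef, hπdef, swapSegments, swapSegments] at h
    split_ifs at h <;> omega
  have hbox : ∀ v, v + r ≤ n → π v + r ≤ n := by
    intro v hv
    rw [hπdef, swapSegments]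
    split_ifs <;> omega
  let σ' : Labeling 1 n q := fun v => σ (pos hn (π (v 0)))
  have hσ' : ∀ v, v < n → σ' (pos hn v) = σ (pos hn (π v)) := by
    intro v hv
    simp only [σ', pos, Nat.mod_eq_of_lt hv]
  have hwin : ∀ c t, c + r ≤ n → t < r → σ (pos hn (π (c + t))) = σ (pos hn (π c + t)) := by
    intro c t hc ht
    have hx' : ∀ a b : ℕ, (∃ s, s + 1 < r ∧ a = i + s ∧ b = k + s) →
        σ (pos hn a) = σ (pos hn b) := by
      rintro a b ⟨s, hs, rfl, rfl⟩; exact hx s hs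
    have hy' : ∀ a b : ℕ, (∃ s, s + 1 < r ∧ a = j + s ∧ b = l + s) →
        σ (pos hn a) = σ (pos hn b) := by
      rintro a b ⟨s, hs, rfl, rfl⟩; exact hy s hs
    by_cases h1 : c < i ∧ i ≤ c + t
    · refine (hx' _ _ ⟨c + t - i, by omega, ?_, ?_⟩).symm
      · rw [hπdef, swapSegments]; split_ifs <;> omega
      · rw [hπdef, swapSegments]; split_ifs <;> omega
    by_cases h2 : c < i + (l - k) ∧ i + (l - k) ≤ c + t
    · refine hy' _ _ ⟨c + t - (i + (l - k)), by omega, ?_, ?_⟩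
      · rw [hπdef, swapSegments]; split_ifs <;> omega
      · rw [hπdef, swapSegments]; split_ifs <;> omega
    by_cases h3 : c < i + (l - j) ∧ i + (l - j) ≤ c + t
    · refine hx' _ _ ⟨c + t - (i + (l - j)), by omega, ?_, ?_⟩
      · rw [hπdef, swapSegments]; split_ifs <;> omega
      · rw [hπdef, swapSegments]; split_ifs <;> omega
    by_cases h4 : c < l ∧ l ≤ c + t
    · refine (hy' _ _ ⟨c + t - l, by omega, ?_, ?_⟩).symm
      · rw [hπdef, swapSegments]; split_ifs <;> omega
      · rw [hπdef, swapSegments]; split_ifs <;> omega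
    · congr 2
      rw [hπdef, hπdef, swapSegments, swapSegments]
      split_ifs <;> omega
  let shift : Box 1 n r → Box 1 n r := fun B =>
    ⟨pos hn (π (B.1 0)), fun m => by
      have h1 : (B.1 0 : ℕ) + r ≤ n := B.2 0
      have h2 := hbox _ h1
      simp only [pos, Nat.mod_eq_of_lt (hlt _ (B.1 0).2)]
      exact h2⟩
  have hshift : Function.Bijective shift := by
    refine Finite.injective_iff_bijective.1 fun B B' h => ?_
    have h1 := pos_injOn hn (hlt _ (B.1 0).2) (hlt _ (B'.1 0).2) (congrArg Subtype.val h)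
    have h2 := hinj _ _ h1
    apply Subtype.ext
    funext m
    rw [Subsingleton.elim m 0]
    exact Fin.ext h2
  have hres : ∀ B, restrict σ' B = restrict σ (shift B) := by
    intro B
    funext x
    have h1 : (B.1 0 : ℕ) + r ≤ n := B.2 0
    have h2 := hbox _ h1
    have hx0 := (x 0).2
    have e2 : ((shift B).1 0 : ℕ) = π (B.1 0) := Nat.mod_eq_of_lt (hlt _ (B.1 0).2)
    rw [restrict_eq_pos hn, restrict_eq_pos hn, hσ' _ (by omega), hwin _ _ h1 hx0, e2]
  intro hid
  have hprof : profile r σ' = profile r σ := by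
    unfold profile
    have := Multiset.map_univ_val_equiv (Equiv.ofBijective shift hshift)
    conv_rhs => rw [← this]
    rw [Multiset.map_map]
    exact Multiset.map_congr rfl fun B _ => hres B
  have := hid σ' hprof
  apply hne
  rw [← congrFun this, hσ' _ (by omega)]
  congr 2
  rw [hπdef, swapSegments]
  split_ifs <;> omega

end interleaved

/-! ### The second moment method -/

section secondMoment
variable {d n q : ℕ}

theorem card_constrained_family {V ι : Type*} [Fintype V] [DecidableEq V] [Fintype ι] (e p : ι → V)
    (he : Function.Injective e) (hp : ∀ x y, p x ≠ e y) (τ : ι → Fin q → Fin q)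
    [DecidablePred fun σ : V → Fin q => ∀ x, σ (e x) = τ x (σ (p x))] :
    (Finset.univ.filter fun σ : V → Fin q => ∀ x, σ (e x) = τ x (σ (p x))).card
      * q ^ Fintype.card ι = q ^ Fintype.card V := by
  classical
  rcases isEmpty_or_nonempty ι with hι | hι
  · simp [Finset.filter_true]
  let E : Finset V := Finset.univ.image e
  have hE : E.card = Fintype.card ι := by
    rw [Finset.card_image_of_injective _ he, Finset.card_univ]
  let g := Function.invFun e
  have hg : ∀ x, g (e x) = x := Function.leftInverse_invFun he
  have hmem : ∀ v, v ∈ E ↔ ∃ x, e x = v := by simp [E]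
  have hset : (Finset.univ.filter fun σ : V → Fin q => ∀ x, σ (e x) = τ x (σ (p x))) =
      Finset.univ.filter fun σ : V → Fin q => ∀ v ∈ E, σ v = τ (g v) (σ (p (g v))) := by
    ext σ
    simp only [Finset.mem_filter, Finset.mem_univ, true_and]
    constructor
    · intro h v hv
      obtain ⟨x, rfl⟩ := (hmem v).1 hv
      rw [hg]; exact h x
    · intro h x
      have := h (e x) ((hmem _).2 ⟨x, rfl⟩)
      rwa [hg] at this
  have hpE : ∀ x, p x ∉ E := fun x hx => by
    obtain ⟨y, hy⟩ := (hmem _).1 hx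
    exact hp x y hy.symm
  rw [hset, ← hE]
  refine le_antisymm ?_ ?_
  · exact card_constrained_le E (fun v => p (g v)) (fun v => τ (g v))
      (fun v => if v ∈ E then 1 else 0) fun v hv => by simp [hv, hpE]
  · exact card_constrained_ge E (fun v => p (g v)) (fun v => τ (g v)) fun v _ => hpE _

theorem prob_constrained_family {ι : Type*} [Fintype ι] (hq : 0 < q) (e p : ι → Fin d → Fin n)
    (he : Function.Injective e) (hp : ∀ x y, p x ≠ e y) (τ : ι → Fin q → Fin q) :
    prob (fun σ : Labeling d n q => ∀ x, σ (e x) = τ x (σ (p x))) =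
      ((q : ℝ) ^ Fintype.card ι)⁻¹ := by
  classical
  have := card_constrained_family e p he hp τ
  rw [Fintype.card_fun, Fintype.card_fin, Fintype.card_fin] at this
  rw [prob_eq_card, div_eq_iff (by positivity), inv_mul_eq_div, eq_div_iff (by positivity)]
  rw [← Nat.cast_pow, ← Nat.cast_pow, ← Nat.cast_mul, Nat.cast_inj]
  exact this

theorem sum_card_filter_eq {ι : Type*} (I : Finset ι) (A : ι → Labeling d n q → Prop)
    [∀ i σ, Decidable (A i σ)] :
    ∑ σ : Labeling d n q, ((I.filter fun i => A i σ).card : ℝ) =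
      ∑ i ∈ I, ((Finset.univ.filter (A i)).card : ℝ) := by
  simp only [Finset.card_filter, Nat.cast_sum]
  rw [Finset.sum_comm]

/-- Chebyshev's inequality for the number of events that occur, among pairwise independent events of
the same probability. -/
theorem prob_forall_not_le {ι : Type*} (hq : 0 < q) (I : Finset ι) (A : ι → Labeling d n q → Prop)
    {p : ℝ} (hp : 0 < p) (hI : I.Nonempty) (h1 : ∀ i ∈ I, prob (A i) = p)
    (h2 : ∀ i ∈ I, ∀ j ∈ I, i ≠ j → prob (fun σ => A i σ ∧ A j σ) ≤ p ^ 2) :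
    prob (fun σ => ∀ i ∈ I, ¬ A i σ) ≤ (I.card * p)⁻¹ := by
  classical
  obtain ⟨T, hT⟩ : ∃ T : ℝ, T = (q : ℝ) ^ n ^ d := ⟨_, rfl⟩
  have hT0 : 0 < T := by rw [hT]; positivity
  have hcard : ∀ (E : Labeling d n q → Prop) [DecidablePred E],
      ((Finset.univ.filter E).card : ℝ) = prob E * T := by
    intro E _
    rw [prob_eq_card, hT, div_mul_cancel₀ _ (by positivity)]
  let X : Labeling d n q → ℝ := fun σ => ((I.filter fun i => A i σ).card : ℝ)
  obtain ⟨μ, hμ⟩ : ∃ μ : ℝ, μ = I.card * p := ⟨_, rfl⟩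
  have hIc : (0 : ℝ) < I.card := by exact_mod_cast hI.card_pos
  have hμ0 : 0 < μ := by rw [hμ]; positivity
  have hX1 : ∑ σ, X σ = μ * T := by
    simp only [X]
    rw [sum_card_filter_eq]
    rw [Finset.sum_congr rfl fun i hi => by rw [hcard, h1 i hi], Finset.sum_const, nsmul_eq_mul, hμ]
    ring
  have hX2 : ∑ σ, X σ ^ 2 ≤ (μ + μ ^ 2) * T := by
    have e : ∀ σ, X σ ^ 2 = (((I ×ˢ I).filter fun ij => A ij.1 σ ∧ A ij.2 σ).card : ℝ) := by
      intro σ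
      simp only [X]
      rw [Finset.filter_product (fun i => A i σ) (fun i => A i σ), Finset.card_product,
        Nat.cast_mul, sq]
    simp only [e]
    rw [sum_card_filter_eq (I ×ˢ I) fun ij σ => A ij.1 σ ∧ A ij.2 σ, Finset.sum_product]
    calc _ ≤ ∑ i ∈ I, ∑ j ∈ I, ((if i = j then p * T else 0) + p ^ 2 * T) := by
          refine Finset.sum_le_sum fun i hi => Finset.sum_le_sum fun j hj => ?_
          rw [hcard]
          split_ifs with hij
          · subst hij
            have : prob (fun σ => A i σ ∧ A i σ) = p := by simpa using h1 i hi
            rw [this]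
            have : 0 ≤ p ^ 2 * T := by positivity
            linarith
          · rw [zero_add]
            exact mul_le_mul_of_nonneg_right (h2 i hi j hj hij) hT0.le
      _ = (μ + μ ^ 2) * T := by
          simp only [Finset.sum_add_distrib, Finset.sum_ite_eq, Finset.sum_const, nsmul_eq_mul]
          rw [Finset.sum_congr rfl fun i hi => if_pos hi, Finset.sum_const, nsmul_eq_mul, hμ]
          ring
  have hvar : ∑ σ, (X σ - μ) ^ 2 ≤ μ * T := by
    have e : ∀ σ, (X σ - μ) ^ 2 = X σ ^ 2 - 2 * μ * X σ + μ ^ 2 := fun σ => by ring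
    simp only [e]
    rw [Finset.sum_add_distrib, Finset.sum_sub_distrib, ← Finset.mul_sum, hX1, Finset.sum_const,
      Finset.card_univ, card_labeling, nsmul_eq_mul]
    push_cast
    rw [← hT]
    nlinarith
  have hlow : prob (fun σ => ∀ i ∈ I, ¬ A i σ) * T * μ ^ 2 ≤ ∑ σ, (X σ - μ) ^ 2 := by
    rw [← hcard, ← nsmul_eq_mul]
    refine (Finset.card_nsmul_le_sum _ (fun σ => (X σ - μ) ^ 2) _ fun σ hσ => ?_).trans
      (Finset.sum_le_sum_of_subset_of_nonneg (Finset.filter_subset _ _) fun _ _ _ => sq_nonneg _)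
    simp only [Finset.mem_filter, Finset.mem_univ, true_and] at hσ
    have : X σ = 0 := by
      simp only [X, Nat.cast_eq_zero, Finset.card_eq_zero]
      exact Finset.filter_eq_empty_iff.2 fun {i} hi => hσ i hi
    rw [this]
    simp
  have := hlow.trans hvar
  rw [← hμ, ← one_div, le_div_iff₀ hμ0]
  have h3 : prob (fun σ => ∀ i ∈ I, ¬ A i σ) * μ * (T * μ) ≤ 1 * (T * μ) := by nlinarith
  exact le_of_mul_le_mul_right h3 (by positivity)

end secondMoment

/-! ### Interleaved repeats exist -/

section repeats
variable {n q : ℕ}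

/-- The words of length `r` at `i` and `k` agree up to the permutation `τ` of the last label. -/
def AlmostRepeat (hn : 0 < n) (r : ℕ) (τ : Equiv.Perm (Fin q)) (i k : ℕ) (σ : Labeling 1 n q) :
    Prop :=
  ∀ t : Fin r, σ (pos hn (k + t)) =
    (if (t : ℕ) + 1 = r then τ else Equiv.refl _ : Equiv.Perm (Fin q)) (σ (pos hn (i + t)))

theorem AlmostRepeat.symm {hn : 0 < n} {r : ℕ} {τ : Equiv.Perm (Fin q)} {i k : ℕ}
    {σ : Labeling 1 n q} (h : AlmostRepeat hn r τ i k σ) : AlmostRepeat hn r τ.symm k i σ := by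
  intro t
  have := h t
  split_ifs at this ⊢ <;> simp [this]

theorem prob_almostRepeat (hn : 0 < n) (hq : 0 < q) {r : ℕ} (τ : Equiv.Perm (Fin q)) {i k : ℕ}
    (hik : i + r ≤ k) (hk : k + r ≤ n) :
    prob (AlmostRepeat hn r τ i k) = ((q : ℝ) ^ r)⁻¹ := by
  have := prob_constrained_family (d := 1) (n := n) hq (fun t : Fin r => pos hn (k + t))
    (fun t : Fin r => pos hn (i + t)) (fun t t' h => ?_) (fun t t' h => ?_)
    (fun t => (if (t : ℕ) + 1 = r then τ else Equiv.refl _ : Equiv.Perm (Fin q)))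
  · rw [Fintype.card_fin] at this
    exact this
  · have := pos_injOn hn (by omega) (by omega) h
    exact Fin.ext (by omega)
  · have := pos_injOn hn (by omega) (by omega) h
    omega

/-- Two almost repeats with distinct last words, none of which meets a first word. -/
theorem prob_almostRepeat_and_le (hn : 0 < n) (hq : 0 < q) {r : ℕ} (τ : Equiv.Perm (Fin q))
    {i k i' k' : ℕ} (hi : i + r ≤ n) (hi' : i' + r ≤ n) (hk : k + r ≤ n) (hk' : k' + r ≤ n)
    (h1 : i + r ≤ k ∨ k + r ≤ i) (h2 : i + r ≤ k' ∨ k' + r ≤ i) (h3 : i' + r ≤ k ∨ k + r ≤ i')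
    (h4 : i' + r ≤ k' ∨ k' + r ≤ i') (hkk : k + r ≤ k' ∨ k' + r ≤ k) :
    prob (fun σ => AlmostRepeat hn r τ i k σ ∧ AlmostRepeat hn r τ i' k' σ) ≤
      (((q : ℝ) ^ r)⁻¹) ^ 2 := by
  have := prob_constrained_family (d := 1) (n := n) hq
    (Sum.elim (fun t : Fin r => pos hn (k + t)) fun t : Fin r => pos hn (k' + t))
    (Sum.elim (fun t : Fin r => pos hn (i + t)) fun t : Fin r => pos hn (i' + t)) ?_ ?_
    (Sum.elim (fun t => (if (t : ℕ) + 1 = r then τ else Equiv.refl _ : Equiv.Perm (Fin q)))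
      (fun t => (if (t : ℕ) + 1 = r then τ else Equiv.refl _ : Equiv.Perm (Fin q))))
  · rw [Fintype.card_sum, Fintype.card_fin, ← two_mul, mul_comm, pow_mul, ← inv_pow] at this
    rw [← this]
    refine prob_mono fun σ hσ x => ?_
    rcases x with t | t
    · exact hσ.1 t
    · exact hσ.2 t
  · rintro (t | t) (t' | t') h <;> simp only [Sum.elim_inl, Sum.elim_inr] at h <;>
      have h := pos_injOn hn (by omega) (by omega) h
    · exact congrArg Sum.inl (Fin.ext (by omega))
    · omega
    · omega
    · exact congrArg Sum.inr (Fin.ext (by omega))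
  · rintro (t | t) (t' | t') h <;> simp only [Sum.elim_inl, Sum.elim_inr] at h <;>
      have h := pos_injOn hn (by omega) (by omega) h <;> omega

/-- Among `m` consecutive words from `P` on and `m` consecutive words from `Q` on, there is an
almost repeat, as the possible almost repeats are pairwise independent. -/
theorem prob_no_almostRepeat_le (hn : 0 < n) (hq : 0 < q) {r m P Q : ℕ} (τ : Equiv.Perm (Fin q))
    (hm : 0 < m) (hPQ : P + m * r ≤ Q) (hQ : Q + m * r ≤ n) :
    prob (fun σ : Labeling 1 n q => ¬ ∃ i k, P ≤ i ∧ i + r ≤ P + m * r ∧ Q ≤ k ∧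
      k + r ≤ Q + m * r ∧ AlmostRepeat hn r τ i k σ) ≤ ((m : ℝ) ^ 2 * ((q : ℝ) ^ r)⁻¹)⁻¹ := by
  have hblock : ∀ b < m, b * r + r ≤ m * r := fun b hb => by
    calc b * r + r = (b + 1) * r := by ring
      _ ≤ m * r := Nat.mul_le_mul_right r hb
  have hsep : ∀ b c, b ≠ c → b * r + r ≤ c * r ∨ c * r + r ≤ b * r := by
    intro b c hbc
    rcases Nat.lt_or_gt_of_ne hbc with h | h
    · left
      calc b * r + r = (b + 1) * r := by ring
        _ ≤ c * r := Nat.mul_le_mul_right r h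
    · right
      calc c * r + r = (c + 1) * r := by ring
        _ ≤ b * r := Nat.mul_le_mul_right r h
  have key := prob_forall_not_le (d := 1) (n := n) hq (Finset.range m ×ˢ Finset.range m)
    (fun b => AlmostRepeat hn r τ (P + b.1 * r) (Q + b.2 * r)) (p := ((q : ℝ) ^ r)⁻¹)
    (by positivity) (by simp; omega) ?_ ?_
  · rw [Finset.card_product, Finset.card_range, Nat.cast_mul, ← sq] at key
    refine (prob_mono fun σ hσ b hb hrep => hσ ?_).trans key
    rw [Finset.mem_product, Finset.mem_range, Finset.mem_range] at hb
    have := hblock _ hb.1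
    have := hblock _ hb.2
    exact ⟨_, _, by omega, by omega, by omega, by omega, hrep⟩
  · intro b hb
    rw [Finset.mem_product, Finset.mem_range, Finset.mem_range] at hb
    have := hblock _ hb.1
    have := hblock _ hb.2
    exact prob_almostRepeat hn hq τ (by omega) (by omega)
  · intro b hb c hc hbc
    rw [Finset.mem_product, Finset.mem_range, Finset.mem_range] at hb hc
    have h1 := hblock _ hb.1
    have h2 := hblock _ hb.2
    have h3 := hblock _ hc.1
    have h4 := hblock _ hc.2
    by_cases h : b.2 = c.2
    · have h5 : b.1 ≠ c.1 := fun h' => hbc (Prod.ext h' h)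
      have h6 := hsep _ _ h5
      refine (prob_mono fun σ hσ => ⟨hσ.1.symm, hσ.2.symm⟩).trans
        (prob_almostRepeat_and_le hn hq τ.symm ?_ ?_ ?_ ?_ ?_ ?_ ?_ ?_ ?_) <;> omega
    · have h6 := hsep _ _ h
      refine prob_almostRepeat_and_le hn hq τ ?_ ?_ ?_ ?_ ?_ ?_ ?_ ?_ ?_ <;> omega

theorem exists_perm_ne (hq : 2 ≤ q) : ∃ τ : Equiv.Perm (Fin q), ∀ x, τ x ≠ x := by
  obtain ⟨k, rfl⟩ : ∃ k, q = k + 2 := ⟨q - 2, by omega⟩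
  refine ⟨Equiv.addRight 1, fun x h => ?_⟩
  simp at h

theorem not_identifiable_of_almostRepeat (hn : 0 < n) {r i j k l : ℕ} {τ : Equiv.Perm (Fin q)}
    (hτ : ∀ x, τ x ≠ x) (hr : 1 ≤ r) (hij : i + r ≤ j) (hjk : j + r ≤ k) (hkl : k + r ≤ l)
    (hl : l + r ≤ n) {σ : Labeling 1 n q} (hx : AlmostRepeat hn r τ i k σ)
    (hy : AlmostRepeat hn r τ j l σ) : ¬ Identifiable r σ := by
  refine not_identifiable_of_interleaved hn hr hij hjk hkl hl σ (fun t ht => ?_) (fun t ht => ?_) ?_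
  · have := hx ⟨t, by omega⟩
    rw [if_neg (by simp; omega)] at this
    exact this.symm
  · have := hy ⟨t, by omega⟩
    rw [if_neg (by simp; omega)] at this
    exact this.symm
  · have := hx ⟨r - 1, by omega⟩
    rw [if_pos (by simp; omega)] at this
    simp only at this
    rw [this]
    exact (hτ _).symm

theorem not_identifiable_whp_one {ε : ℝ} (hε : 0 < ε) (hq : 2 ≤ q) {r : ℕ → ℕ}
    (h : BelowThreshold 1 q 2 ε r) :
    WithHighProbability 1 q fun n σ => ¬ Identifiable (r n) σ := by
  obtain ⟨τ, hτ⟩ := exists_perm_ne hq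
  have hq0 : (0 : ℝ) < q := by positivity
  have hq1 : (1 : ℝ) < q := by exact_mod_cast hq
  have hlq : 0 < Real.log q := Real.log_pos hq1
  -- `r` is at most `2 log n / log q`, so there are about `n / r` disjoint words in each quarter
  have hrlog : ∀ᶠ n : ℕ in atTop, (r n : ℝ) ≤ 2 / Real.log q * Real.log n := by
    filter_upwards [h, eventually_ge_atTop 1] with n hn hn1
    have := hn.2
    rw [pow_one] at this
    refine this.trans ?_
    have hl : 0 ≤ Real.log n := Real.log_nonneg (by exact_mod_cast hn1)
    rw [div_mul_eq_mul_div]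
    gcongr
    nlinarith
  have hlim : Tendsto (fun n : ℕ => 2 * (256 * ((2 / Real.log q * Real.log n) ^ 2 *
      (n : ℝ) ^ (-(2 * ε))))) atTop (𝓝 0) := by
    have h1 : Tendsto (fun x : ℝ => Real.log x / x ^ ε) atTop (𝓝 0) :=
      (isLittleO_log_rpow_atTop hε).tendsto_div_nhds_zero
    have h2 := ((h1.comp (tendsto_natCast_atTop_atTop (R := ℝ))).pow 2).const_mul
      (2 * 256 * (2 / Real.log q) ^ 2)
    rw [zero_pow two_ne_zero, mul_zero] at h2
    refine h2.congr' ?_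
    filter_upwards [eventually_ge_atTop 1] with n hn
    have hn0 : (0 : ℝ) < n := by exact_mod_cast hn
    simp only [Function.comp]
    rw [div_pow (Real.log (n : ℝ)), ← Real.rpow_mul_natCast hn0.le, Real.rpow_neg hn0.le]
    push_cast
    rw [mul_comm ε 2]
    field_simp
  have hsmall : ∀ᶠ n : ℕ in atTop, 16 * (2 / Real.log q * Real.log n) ≤ n := by
    have h1 := Real.isLittleO_log_id_atTop.bound (c := (16 * (2 / Real.log q))⁻¹) (by positivity)
    filter_upwards [tendsto_natCast_atTop_atTop.eventually h1, eventually_ge_atTop 1] with n hn hn1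
    have hl : 0 ≤ Real.log n := Real.log_nonneg (by exact_mod_cast hn1)
    simp only [Real.norm_eq_abs, abs_of_nonneg hl, id_eq, Nat.abs_cast] at hn
    rw [inv_mul_eq_div, le_div_iff₀ (by positivity)] at hn
    linarith
  refine withHighProbability_of_le (by omega) _ _ hlim ?_
  filter_upwards [h, hrlog, hsmall, eventually_ge_atTop 1] with n hn hrl hs hn1
  have hn0 : 0 < n := hn1
  have hnR : (0 : ℝ) < n := by exact_mod_cast hn1
  have hr1 : 1 ≤ r n := hn.1
  have hrR : (0 : ℝ) < r n := by exact_mod_cast hr1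
  have h16 : 16 * r n ≤ n := by
    have : (16 : ℝ) * r n ≤ n := by linarith
    exact_mod_cast this
  obtain ⟨q4, hq4⟩ : ∃ q4, q4 = n / 4 := ⟨_, rfl⟩
  obtain ⟨m, hm⟩ : ∃ m, m = q4 / r n := ⟨_, rfl⟩
  have hmr : m * r n ≤ q4 := by rw [hm]; exact Nat.div_mul_le_self _ _
  have hmr' : q4 < (m + 1) * r n := by
    rw [hm]; exact Nat.lt_mul_of_div_lt (Nat.lt_succ_self _) hr1
  have hm0 : 0 < m := by
    rw [hm]; exact Nat.div_pos (by omega) hr1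
  have hmn : (n : ℝ) ≤ 16 * (m * r n) := by
    have : n ≤ 16 * (m * r n) := by
      have : (m + 1) * r n = m * r n + r n := by ring
      omega
    exact_mod_cast this
  have hbound : ((m : ℝ) ^ 2 * ((q : ℝ) ^ r n)⁻¹)⁻¹ ≤
      256 * ((2 / Real.log q * Real.log n) ^ 2 * (n : ℝ) ^ (-(2 * ε))) := by
    have hqr : (q : ℝ) ^ r n ≤ (n : ℝ) ^ (2 * (1 - ε)) := by
      rw [← Real.exp_log (pow_pos hq0 _), Real.rpow_def_of_pos hnR, Real.exp_le_exp, Real.log_pow]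
      have := hn.2
      rw [le_div_iff₀ hlq, pow_one] at this
      linarith
    have hmR : (0 : ℝ) < m := by exact_mod_cast hm0
    rw [mul_inv, inv_inv, ← div_eq_inv_mul, div_le_iff₀ (by positivity)]
    calc (q : ℝ) ^ r n ≤ (n : ℝ) ^ (2 * (1 - ε)) := hqr
      _ = (n : ℝ) ^ 2 * (n : ℝ) ^ (-(2 * ε)) := by
          rw [← Real.rpow_natCast, ← Real.rpow_add hnR]
          congr 1
          push_cast
          ring
      _ ≤ (16 * (m * r n)) ^ 2 * (n : ℝ) ^ (-(2 * ε)) := by gcongr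
      _ = 256 * ((r n : ℝ) ^ 2 * (n : ℝ) ^ (-(2 * ε))) * (m : ℝ) ^ 2 := by ring
      _ ≤ _ := by gcongr
  have p1 := prob_no_almostRepeat_le hn0 (by omega : 0 < q) τ hm0 (P := 0) (Q := 2 * q4)
    (r := r n) (by omega) (by omega)
  have p2 := prob_no_almostRepeat_le hn0 (by omega : 0 < q) τ hm0 (P := q4) (Q := 3 * q4)
    (r := r n) (by omega) (by omega)
  simp only [not_not]
  refine (prob_mono fun σ hσ => ?_).trans
    ((prob_or _ _).trans ((add_le_add (p1.trans hbound) (p2.trans hbound)).trans_eq (by ring)))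
  by_contra hcon
  rw [not_or, not_not, not_not] at hcon
  obtain ⟨⟨i, k, hi1, hi2, hk1, hk2, hx⟩, ⟨j, l, hj1, hj2, hl1, hl2, hy⟩⟩ := hcon
  exact not_identifiable_of_almostRepeat hn0 hτ hr1 (by omega) (by omega) (by omega) (by omega)
    hx hy hσ

end repeats

/-! ### Total correctness of programs with a time bound -/

section machine

/-- Started in `s`, the program `P` halts within `T` steps in a state with the property `Q`. -/
def Halts (P : Program) (s : State) (T : ℕ) (Q : State → Prop) : Prop :=
  ∃ t ≤ T, ∃ s', Run P s t s' ∧ Q s'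

/-- The machine is deterministic. -/
theorem Run.unique {P : Program} {s s₁ s₂ : State} {t₁ t₂ : ℕ} (h₁ : Run P s t₁ s₁)
    (h₂ : Run P s t₂ s₂) : s₁ = s₂ := by
  induction h₁ generalizing t₂ s₂ with
  | skip | const | copy | add | sub | load | store => cases h₂; rfl
  | seq _ _ ih ih' => cases h₂ with | seq h h' => cases ih h; exact ih' h'
  | iteTrue hi _ ih => cases h₂ with
    | iteTrue _ h => exact ih h
    | iteFalse h0 _ => exact absurd h0 hi
  | iteFalse hi _ ih => cases h₂ with
    | iteTrue h0 _ => exact absurd hi h0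
    | iteFalse _ h => exact ih h
  | loopDone hi => cases h₂ with
    | loopDone => rfl
    | loopStep h0 => exact absurd hi h0
  | loopStep hi _ _ ih ih' => cases h₂ with
    | loopDone h0 => exact absurd h0 hi
    | loopStep _ h h' => cases ih h; exact ih' h'

theorem State.setReg_reg (s : State) (i v j : ℕ) :
    (s.setReg i v).reg j = if j = i then v else s.reg j := by
  simp [State.setReg, Function.update_apply]

theorem State.setReg_arr (s : State) (i v : ℕ) : (s.setReg i v).arr = s.arr := rfl

theorem State.setArr_reg (s : State) (a k v : ℕ) : (s.setArr a k v).reg = s.reg := rfl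

theorem State.setArr_arr (s : State) (a k v : ℕ) :
    (s.setArr a k v).arr = Function.update s.arr a (Function.update (s.arr a) k v) := rfl

theorem Halts.mono {P : Program} {s : State} {T T' : ℕ} {Q Q' : State → Prop}
    (h : Halts P s T Q) (hT : T ≤ T') (hQ : ∀ s, Q s → Q' s) : Halts P s T' Q' := by
  obtain ⟨t, ht, s', hr, hq⟩ := h
  exact ⟨t, ht.trans hT, s', hr, hQ _ hq⟩

/-- The programs of the list, one after the other. -/
def block : List Program → Program
  | [] => .skip
  | P :: l => .seq P (block l)

variable {s : State} {T : ℕ} {Q : State → Prop} {l : List Program}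

theorem halts_nil (h : Q s) : Halts (block []) s (T + 1) Q :=
  ⟨1, by omega, s, .skip s, h⟩

theorem halts_call {P : Program} {T₁ T₂ : ℕ}
    (h : Halts P s T₁ fun s' => Halts (block l) s' T₂ Q) (hT : T₁ + T₂ ≤ T) :
    Halts (block (P :: l)) s T Q := by
  obtain ⟨t, ht, s', hr, t', ht', s'', hr', hq⟩ := h
  exact ⟨t + t', by omega, s'', .seq hr hr', hq⟩

theorem halts_step {P : Program} {s' : State} (hP : Run P s 1 s') (h : Halts (block l) s' T Q) :
    Halts (block (P :: l)) s (T + 1) Q :=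
  halts_call (T₁ := 1) ⟨1, le_rfl, s', hP, h⟩ (by omega)

theorem halts_const {i k : ℕ} (h : Halts (block l) (s.setReg i k) T Q) :
    Halts (block (.const i k :: l)) s (T + 1) Q := halts_step (.const i k s) h

theorem halts_copy (v : ℕ) {i j : ℕ} (hv : s.reg j = v) (h : Halts (block l) (s.setReg i v) T Q) :
    Halts (block (.copy i j :: l)) s (T + 1) Q := halts_step (.copy i j s) (hv ▸ h)

theorem halts_add (v : ℕ) {i j k : ℕ} (hv : s.reg j + s.reg k = v)
    (h : Halts (block l) (s.setReg i v) T Q) :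
    Halts (block (.add i j k :: l)) s (T + 1) Q := halts_step (.add i j k s) (hv ▸ h)

theorem halts_sub (v : ℕ) {i j k : ℕ} (hv : s.reg j - s.reg k = v)
    (h : Halts (block l) (s.setReg i v) T Q) :
    Halts (block (.sub i j k :: l)) s (T + 1) Q := halts_step (.sub i j k s) (hv ▸ h)

theorem halts_load (v : ℕ) {i a j : ℕ} (hv : s.arr a (s.reg j) = v)
    (h : Halts (block l) (s.setReg i v) T Q) :
    Halts (block (.load i a j :: l)) s (T + 1) Q := halts_step (.load i a j s) (hv ▸ h)

theorem halts_store (k v : ℕ) {a i j : ℕ} (hk : s.reg i = k) (hv : s.reg j = v)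
    (h : Halts (block l) (s.setArr a k v) T Q) :
    Halts (block (.store a i j :: l)) s (T + 1) Q := halts_step (.store a i j s) (hk ▸ hv ▸ h)

theorem halts_ite {i : ℕ} {P P' : Program} (h : s.reg i ≠ 0 → Halts P s T Q)
    (h' : s.reg i = 0 → Halts P' s T Q) : Halts (.ite i P P') s (T + 1) Q := by
  by_cases hi : s.reg i = 0
  · obtain ⟨t, ht, s', hr, hq⟩ := h' hi
    exact ⟨t + 1, by omega, s', .iteFalse hi hr, hq⟩
  · obtain ⟨t, ht, s', hr, hq⟩ := h hi
    exact ⟨t + 1, by omega, s', .iteTrue hi hr, hq⟩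

/-- Repeats `P` as often as register `i` says, counting down; register `2` holds `1`. -/
def times (i : ℕ) (P : Program) : Program := .loop i (.seq P (.sub i i 2))

theorem halts_times {i N : ℕ} {P : Program} (Inv : ℕ → State → Prop) (hN : s.reg i = N)
    (h0 : Inv 0 s)
    (hP : ∀ k < N, ∀ s, Inv k s → s.reg i = N - k → Halts P s T fun s' =>
      s'.reg i = N - k ∧ s'.reg 2 = 1 ∧ Inv (k + 1) (s'.setReg i (N - (k + 1)))) :
    Halts (times i P) s (N * (T + 2) + 1) (Inv N) := by
  have key : ∀ m k, k + m = N → ∀ s, Inv k s → s.reg i = m →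
      Halts (times i P) s (m * (T + 2) + 1) (Inv N) := by
    intro m
    induction m with
    | zero =>
      intro k hk s hs hi
      obtain rfl : k = N := by omega
      exact ⟨1, by omega, s, .loopDone hi, hs⟩
    | succ m ih =>
      intro k hk s hs hi
      obtain ⟨t, ht, s', hr, h1, h2, h3⟩ := hP k (by omega) s hs (by omega)
      have e : s'.reg i - s'.reg 2 = N - (k + 1) := by rw [h1, h2]; omega
      obtain ⟨t', ht', s'', hr', hq⟩ := ih (k + 1) (by omega) (s'.setReg i (N - (k + 1))) h3
        (by rw [State.setReg_reg, if_pos rfl]; omega)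
      have hsub := Run.sub i i 2 s'
      rw [e] at hsub
      refine ⟨t + 1 + t' + 1, ?_, s'', .loopStep (by omega) (.seq hr hsub) hr', hq⟩
      have : (m + 1) * (T + 2) = m * (T + 2) + (T + 2) := by ring
      omega
  exact key N 0 (by omega) s h0 hN

/-- `reg dst := reg x * reg y`, with the auxiliary register `c`. -/
def mulProg (dst x y c : ℕ) : Program :=
  block [.const dst 0, .copy c x, times c (block [.add dst dst y])]

theorem halts_mulProg {dst x y c : ℕ} (h1 : s.reg 2 = 1) (hd2 : dst ≠ 2) (hc2 : c ≠ 2)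
    (hdc : dst ≠ c) (hxd : x ≠ dst) (hyd : y ≠ dst) (hyc : y ≠ c) :
    Halts (mulProg dst x y c) s (4 * s.reg x + 4) fun s' => s'.arr = s.arr ∧
      s'.reg dst = s.reg x * s.reg y ∧ ∀ j, j ≠ dst → j ≠ c → s'.reg j = s.reg j := by
  refine halts_const (T := 4 * s.reg x + 3) <|
    halts_copy (s.reg x) (T := 4 * s.reg x + 2) (by simp [State.setReg_reg, hxd]) <|
    halts_call (T₁ := s.reg x * (2 + 2) + 1) (T₂ := 1) ?_ (by omega)
  refine (halts_times (T := 2) (N := s.reg x) (fun k s' => s'.arr = s.arr ∧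
    s'.reg dst = k * s.reg y ∧ ∀ j, j ≠ dst → j ≠ c → s'.reg j = s.reg j) ?_ ?_ ?_).mono le_rfl
    fun s' hs' => halts_nil hs'
  · simp [State.setReg_reg]
  · refine ⟨rfl, by simp [State.setReg_reg, hdc], fun j hj hj' => ?_⟩
    simp [State.setReg_reg, hj, hj']
  · rintro k hk s' ⟨ha, hd, hf⟩ hi
    refine halts_add _ rfl <| halts_nil ⟨?_, ?_, ?_, ?_, fun j hj hj' => ?_⟩
    · simp [State.setReg_reg, hdc.symm, hi]
    · simp only [State.setReg_reg, if_neg hd2.symm]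
      rw [hf 2 hd2.symm hc2.symm, h1]
    · simpa [State.setReg_arr] using ha
    · simp only [State.setReg_reg, if_neg hdc, if_pos]
      rw [hd, hf y hyd hyc]; ring
    · simp only [State.setReg_reg, if_neg hj, if_neg hj']
      exact hf j hj hj'

end machine

/-! ### Checking and placing a pattern -/

section patterns
variable {s : State}

/-- The pattern that starts at `pat` in the input `A` agrees with the known labels `K` when it is
placed at the address `base`; only its first `R` vertices count. In `K`, the number `0` stands for
an unknown label and `c + 1` for the label `c`. -/
def Consistent (γ A K : ℕ → ℕ) (R base pat : ℕ) : Prop :=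
  ∀ x < R, K (γ x + base) = 0 ∨ K (γ x + base) = A (pat + x) + 1

/-- The known labels after the first `R` vertices of the pattern at `pat` were placed at `base`. -/
def place (γ A : ℕ → ℕ) (base pat : ℕ) (K : ℕ → ℕ) : ℕ → ℕ → ℕ
  | 0 => K
  | R + 1 => Function.update (place γ A base pat K R) (γ R + base) (A (pat + R) + 1)

/-- The known labels after the cells of the first `R` vertices at `base` were reset. -/
def clear (γ : ℕ → ℕ) (base : ℕ) (K : ℕ → ℕ) : ℕ → ℕ → ℕ
  | 0 => K
  | R + 1 => Function.update (clear γ base K R) (γ R + base) 0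

/-- Register `12` becomes `1` or `0` according as the pattern at `reg 11` is consistent with array
`1` at the address `reg 10`. Register `4` holds the size of a pattern, array `2` the addresses of
its vertices. For each vertex, register `33` becomes `1` if its label is known and differs from
that of the pattern, and `0` otherwise. -/
def checkProg : Program :=
  block [.const 12 1, .const 30 0, .copy 31 4, times 31 (block [
    .load 32 2 30, .add 32 32 10, .load 33 1 32, .add 34 11 30, .load 35 0 34, .add 35 35 2,
    .sub 36 33 35, .sub 37 35 33, .add 36 36 37, .sub 36 2 36, .sub 33 2 33, .add 33 33 36,
    .sub 33 2 33, .sub 12 12 33, .add 30 30 2])]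

theorem consistent_succ {γ A K : ℕ → ℕ} {R base pat : ℕ} :
    Consistent γ A K (R + 1) base pat ↔ Consistent γ A K R base pat ∧
      (K (γ R + base) = 0 ∨ K (γ R + base) = A (pat + R) + 1) := by
  unfold Consistent
  constructor
  · exact fun h => ⟨fun x hx => h x (by omega), h R (by omega)⟩
  · rintro ⟨h, h'⟩ x hx
    rcases Nat.lt_succ_iff_lt_or_eq.1 hx with hx | rfl
    · exact h x hx
    · exact h'

open Classical in
theorem halts_checkProg (h1 : s.reg 2 = 1) :
    Halts checkProg s (18 * s.reg 4 + 5) fun s' => s'.arr = s.arr ∧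
      (∀ j < 30, j ≠ 12 → s'.reg j = s.reg j) ∧
      s'.reg 12 = if Consistent (s.arr 2) (s.arr 0) (s.arr 1) (s.reg 4) (s.reg 10) (s.reg 11)
        then 1 else 0 := by
  refine halts_const (T := 18 * s.reg 4 + 4) <| halts_const (T := 18 * s.reg 4 + 3) <|
    halts_copy (s.reg 4) (T := 18 * s.reg 4 + 2) (by simp [State.setReg_reg]) <|
    halts_call (T₁ := s.reg 4 * (16 + 2) + 1) (T₂ := 1) ?_ (by omega)
  refine (halts_times (T := 16) (N := s.reg 4) (fun k s' => s'.arr = s.arr ∧ s'.reg 30 = k ∧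
    (∀ j < 30, j ≠ 12 → s'.reg j = s.reg j) ∧
    s'.reg 12 = if Consistent (s.arr 2) (s.arr 0) (s.arr 1) k (s.reg 10) (s.reg 11)
        then 1 else 0) ?_ ?_ ?_).mono le_rfl
    fun s' hs' => halts_nil ⟨hs'.1, hs'.2.2⟩
  · simp [State.setReg_reg]
  · refine ⟨rfl, by simp [State.setReg_reg], fun j hj hj' => ?_, ?_⟩
    · simp (disch := omega) only [State.setReg_reg, if_neg]
    · simp [State.setReg_reg, Consistent]
  · rintro k hk s' ⟨ha, hx, hf, hok⟩ hi
    have r2 := hf 2 (by norm_num) (by norm_num)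
    have r10 := hf 10 (by norm_num) (by norm_num)
    have r11 := hf 11 (by norm_num) (by norm_num)
    rw [h1] at r2
    -- `v` is the known entry, `a` that of the pattern; `e` is `1` if they are equal and `0` if not
    obtain ⟨γ, hγ⟩ : ∃ γ, γ = s.arr 2 k + s.reg 10 := ⟨_, rfl⟩
    obtain ⟨v, hv⟩ : ∃ v, v = s.arr 1 γ := ⟨_, rfl⟩
    obtain ⟨a, ha'⟩ : ∃ a, a = s.arr 0 (s.reg 11 + k) + 1 := ⟨_, rfl⟩
    obtain ⟨e, he⟩ : ∃ e, e = 1 - ((v - a) + (a - v)) := ⟨_, rfl⟩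
    refine halts_load (s.arr 2 k) ?_ <| halts_add γ ?_ <| halts_load v ?_ <|
      halts_add (s.reg 11 + k) ?_ <| halts_load (s.arr 0 (s.reg 11 + k)) ?_ <| halts_add a ?_ <|
      halts_sub (v - a) ?_ <| halts_sub (a - v) ?_ <| halts_add ((v - a) + (a - v)) ?_ <|
      halts_sub e ?_ <| halts_sub (1 - v) ?_ <| halts_add (1 - v + e) ?_ <|
      halts_sub (1 - (1 - v + e)) ?_ <| halts_sub (if Consistent (s.arr 2) (s.arr 0) (s.arr 1)
        (k + 1) (s.reg 10) (s.reg 11) then 1 else 0) ?ok <| halts_add (k + 1) ?_ <| halts_nil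
          ⟨?_, ?_, ?_, ?_, fun j hj hj' => ?frame, ?_⟩
    case frame =>
      have := hf j hj hj'
      simp (disch := omega) only [State.setReg_reg, if_neg, this]
    case ok =>
      simp only [State.setReg_reg, hok, consistent_succ, ← hγ, ← hv, ← ha']
      by_cases hc : Consistent (s.arr 2) (s.arr 0) (s.arr 1) k (s.reg 10) (s.reg 11)
      · simp [hc]
        split_ifs <;> omega
      · simp [hc]
    all_goals simp [State.setReg_reg, State.setReg_arr, *]

end patterns

/-! ### Placing patterns and counting those that fit -/

section routines
variable {s : State} {γ β A K pw : ℕ → ℕ} {R M V d n base pat : ℕ}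

/-- The state holds the data that the routines below share: the side `n` of the box, the number
`1`, the dimension, the size of a pattern, the number of patterns and the number of vertices; the
patterns, the addresses `γ` of the vertices of a pattern and `β` of the smallest corners of the
boxes, and the addresses of the unit vectors.

Registers below `10` are never changed by the routines. The registers `10` to `19` hold their
arguments and results, `20` to `29` loop counters, and from `30` on auxiliary values. -/
structure Ready (γ β A pw : ℕ → ℕ) (R M V d n : ℕ) (s : State) : Prop where
  reg_zero : s.reg 0 = n
  reg_two : s.reg 2 = 1
  reg_three : s.reg 3 = d
  reg_four : s.reg 4 = R
  reg_five : s.reg 5 = M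
  reg_six : s.reg 6 = V
  arr_zero : s.arr 0 = A
  arr_two : s.arr 2 = γ
  arr_three : s.arr 3 = β
  arr_five : s.arr 5 = pw

theorem Ready.congr {s' : State} (h : Ready γ β A pw R M V d n s)
    (hr : ∀ j < 10, s'.reg j = s.reg j) (ha : ∀ a, a ≠ 1 → s'.arr a = s.arr a) :
    Ready γ β A pw R M V d n s' where
  reg_zero := (hr 0 (by norm_num)).trans h.reg_zero
  reg_two := (hr 2 (by norm_num)).trans h.reg_two
  reg_three := (hr 3 (by norm_num)).trans h.reg_three
  reg_four := (hr 4 (by norm_num)).trans h.reg_four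
  reg_five := (hr 5 (by norm_num)).trans h.reg_five
  reg_six := (hr 6 (by norm_num)).trans h.reg_six
  arr_zero := (ha 0 (by norm_num)).trans h.arr_zero
  arr_two := (ha 2 (by norm_num)).trans h.arr_two
  arr_three := (ha 3 (by norm_num)).trans h.arr_three
  arr_five := (ha 5 (by norm_num)).trans h.arr_five

/-- Places the pattern at `reg 11` at the address `reg 10`. -/
def placeProg : Program :=
  block [.const 30 0, .copy 31 4, times 31 (block [
    .load 32 2 30, .add 32 32 10, .add 34 11 30, .load 35 0 34, .add 35 35 2, .store 1 32 35,
    .add 30 30 2])]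

theorem halts_placeProg (h : Ready γ β A pw R M V d n s) (hb : s.reg 10 = base)
    (hp : s.reg 11 = pat) :
    Halts placeProg s (10 * R + 4) fun s' =>
      s'.arr = Function.update s.arr 1 (place γ A base pat (s.arr 1) R) ∧
      ∀ j < 30, s'.reg j = s.reg j := by
  refine halts_const (T := 10 * R + 3) <|
    halts_copy R (T := 10 * R + 2) (by simp [State.setReg_reg, h.reg_four]) <|
    halts_call (T₁ := R * (8 + 2) + 1) (T₂ := 1) ?_ (by omega)
  refine (halts_times (T := 8) (N := R) (fun k s' =>
    s'.arr = Function.update s.arr 1 (place γ A base pat (s.arr 1) k) ∧ s'.reg 30 = k ∧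
    (∀ j < 30, s'.reg j = s.reg j)) ?_ ?_ ?_).mono le_rfl
    fun s' hs' => halts_nil ⟨hs'.1, hs'.2.2⟩
  · simp [State.setReg_reg]
  · refine ⟨by simp [place, State.setReg_arr], by simp [State.setReg_reg], fun j hj => ?_⟩
    simp (disch := omega) only [State.setReg_reg, if_neg]
  · rintro k hk s' ⟨ha, hx, hf⟩ hi
    have r2 := (hf 2 (by norm_num)).trans h.reg_two
    have r10 := (hf 10 (by norm_num)).trans hb
    have r11 := (hf 11 (by norm_num)).trans hp
    refine halts_load (γ k) ?_ <| halts_add (γ k + base) ?_ <|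
      halts_add (pat + k) ?_ <| halts_load (A (pat + k)) ?_ <| halts_add (A (pat + k) + 1) ?_ <|
      halts_store (γ k + base) (A (pat + k) + 1) ?_ ?_ <| halts_add (k + 1) ?_ <| halts_nil
          ⟨?_, ?_, ?_, ?_, fun j hj => ?frame⟩
    case frame =>
      have := hf j hj
      simp (disch := omega) only [State.setReg_reg, State.setArr_reg, if_neg, this]
    all_goals simp [State.setReg_reg, State.setReg_arr, State.setArr_reg, State.setArr_arr, place,
      h.arr_two, h.arr_zero, h.reg_two, *]

/-- Resets the cells of the pattern at the address `reg 10`. -/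
def clearProg : Program :=
  block [.const 30 0, .const 35 0, .copy 31 4, times 31 (block [
    .load 32 2 30, .add 32 32 10, .store 1 32 35, .add 30 30 2])]

theorem halts_clearProg (h : Ready γ β A pw R M V d n s) (hb : s.reg 10 = base) :
    Halts clearProg s (10 * R + 5) fun s' =>
      s'.arr = Function.update s.arr 1 (clear γ base (s.arr 1) R) ∧
      ∀ j < 30, s'.reg j = s.reg j := by
  refine halts_const (T := 10 * R + 4) <| halts_const (T := 10 * R + 3) <|
    halts_copy R (T := 10 * R + 2) (by simp [State.setReg_reg, h.reg_four]) <|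
    halts_call (T₁ := R * (8 + 2) + 1) (T₂ := 1) ?_ (by omega)
  refine (halts_times (T := 8) (N := R) (fun k s' =>
    s'.arr = Function.update s.arr 1 (clear γ base (s.arr 1) k) ∧ s'.reg 30 = k ∧ s'.reg 35 = 0 ∧
    (∀ j < 30, s'.reg j = s.reg j)) ?_ ?_ ?_).mono le_rfl
    fun s' hs' => halts_nil ⟨hs'.1, hs'.2.2.2⟩
  · simp [State.setReg_reg]
  · refine ⟨by simp [clear, State.setReg_arr], by simp [State.setReg_reg],
      by simp [State.setReg_reg], fun j hj => ?_⟩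
    simp (disch := omega) only [State.setReg_reg, if_neg]
  · rintro k hk s' ⟨ha, hx, h35, hf⟩ hi
    have r2 := (hf 2 (by norm_num)).trans h.reg_two
    have r10 := (hf 10 (by norm_num)).trans hb
    refine halts_load (γ k) ?_ <| halts_add (γ k + base) ?_ <|
      halts_store (γ k + base) 0 ?_ ?_ <| halts_add (k + 1) ?_ <| halts_nil
          ⟨?_, ?_, ?_, ?_, ?_, fun j hj => ?frame⟩
    case frame =>
      have := hf j hj
      simp (disch := omega) only [State.setReg_reg, State.setArr_reg, if_neg, this]
    all_goals simp [State.setReg_reg, State.setReg_arr, State.setArr_reg, State.setArr_arr, clear,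
      h.arr_two, h.reg_two, *]

open Classical in
/-- How many of the first `m` patterns are consistent with `K` at the address `base`. -/
noncomputable def numFits (γ A K : ℕ → ℕ) (R base : ℕ) : ℕ → ℕ
  | 0 => 0
  | m + 1 => numFits γ A K R base m + if Consistent γ A K R base (m * R) then 1 else 0

open Classical in
/-- The position in the input of the last of the first `m` patterns that is consistent with `K` at
the address `base`. -/
noncomputable def lastFit (γ A K : ℕ → ℕ) (R base : ℕ) : ℕ → ℕ
  | 0 => 0
  | m + 1 => if Consistent γ A K R base (m * R) then m * R else lastFit γ A K R base m

/-- Computes in the registers `13` and `14` the number of patterns that are consistent with array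
`1` at the address `reg 10`, and the position of the last one. -/
def countProg : Program :=
  block [.const 11 0, .const 13 0, .const 14 0, .copy 20 5, times 20 (block [
    checkProg, .ite 12 (block [.copy 14 11]) (block []), .add 13 13 12, .add 11 11 4])]

theorem halts_countProg (h : Ready γ β A pw R M V d n s) (hb : s.reg 10 = base)
    (hK : s.arr 1 = K) :
    Halts countProg s (M * (18 * R + 13) + 6) fun s' => s'.arr = s.arr ∧
      (∀ j < 30, j < 11 ∨ 14 < j → j ≠ 20 → s'.reg j = s.reg j) ∧
      s'.reg 13 = numFits γ A K R base M ∧ s'.reg 14 = lastFit γ A K R base M := by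
  refine halts_const (T := M * (18 * R + 13) + 5) <| halts_const (T := M * (18 * R + 13) + 4) <|
    halts_const (T := M * (18 * R + 13) + 3) <|
    halts_copy M (T := M * (18 * R + 13) + 2) (by simp [State.setReg_reg, h.reg_five]) <|
    halts_call (T₁ := M * (18 * R + 11 + 2) + 1) (T₂ := 1) ?_ le_rfl
  refine (halts_times (T := 18 * R + 11) (N := M) (fun k s' => s'.arr = s.arr ∧
    s'.reg 11 = k * R ∧ (∀ j < 30, j < 11 ∨ 14 < j → j ≠ 20 → s'.reg j = s.reg j) ∧
      s'.reg 13 = numFits γ A K R base k ∧ s'.reg 14 = lastFit γ A K R base k) ?_ ?_ ?_).mono le_rfl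
    fun s' hs' => halts_nil ⟨hs'.1, hs'.2.2⟩
  · simp [State.setReg_reg]
  · refine ⟨rfl, by simp [State.setReg_reg], fun j hj hj' hj'' => ?_,
      by simp [State.setReg_reg, numFits],
      by simp [State.setReg_reg, lastFit]⟩
    simp (disch := omega) only [State.setReg_reg, if_neg]
  · rintro k hk s' ⟨ha, hx, hf, h13, h14⟩ hi
    have h' : Ready γ β A pw R M V d n s' :=
      h.congr (fun j hj => hf j (by omega) (by omega) (by omega)) fun a _ => by rw [ha]
    have r10 := (hf 10 (by norm_num) (by norm_num) (by norm_num)).trans hb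
    have r2 := h'.reg_two
    refine halts_call (T₁ := 18 * R + 5) (T₂ := 6) ((halts_checkProg h'.reg_two).mono
      (by rw [h'.reg_four]) ?_) (by omega)
    rw [h'.arr_two, h'.arr_zero, h'.reg_four, r10, hx, ha, hK]
    rintro s₁ ⟨a₁, f₁, o₁⟩
    have key : ∀ s₂ : State, s₂.arr = s.arr → s₂.reg 12 = s₁.reg 12 → s₂.reg 13 = s₁.reg 13 →
        s₂.reg 14 = lastFit γ A K R base (k + 1) → (∀ j < 30, j ≠ 14 → s₂.reg j = s₁.reg j) →
        Halts (block [.add 13 13 12, .add 11 11 4]) s₂ 3 fun s' =>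
          s'.reg 20 = M - k ∧ s'.reg 2 = 1 ∧ (s'.setReg 20 (M - (k + 1))).arr = s.arr ∧
          (s'.setReg 20 (M - (k + 1))).reg 11 = (k + 1) * R ∧
          (∀ j < 30, j < 11 ∨ 14 < j → j ≠ 20 →
            (s'.setReg 20 (M - (k + 1))).reg j = s.reg j) ∧
          (s'.setReg 20 (M - (k + 1))).reg 13 = numFits γ A K R base (k + 1) ∧
          (s'.setReg 20 (M - (k + 1))).reg 14 = lastFit γ A K R base (k + 1) := by
      intro s₂ a₂ r₁₂ r₁₃ r₁₄ f₂
      have e : ∀ j < 30, j ≠ 12 → j ≠ 14 → s₂.reg j = s'.reg j := fun j hj hj' hj'' =>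
        (f₂ j hj hj'').trans (f₁ j hj hj')
      refine halts_add (numFits γ A K R base (k + 1)) ?_ <| halts_add ((k + 1) * R) ?_ <|
        halts_nil ⟨?_, ?_, ?_, ?_, fun j hj hj' hj'' => ?frame, ?_, ?_⟩
      case frame =>
        have := (e j hj (by omega) (by omega)).trans (hf j hj hj' hj'')
        simp (disch := omega) only [State.setReg_reg, if_neg, this]
      all_goals simp [State.setReg_reg, State.setReg_arr, numFits, h.reg_two, h'.reg_four,
        add_mul, *]
    refine halts_call (T₁ := 2 + 1) (T₂ := 3) (halts_ite (fun h12 => ?_) fun h12 => ?_) (by omega)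
    · refine halts_copy (k * R) (T := 1) (by rw [f₁ 11 (by norm_num) (by norm_num), hx]) <|
        halts_nil (key _ ?_ ?_ ?_ ?_ fun j hj hj' => ?_)
      · simp [State.setReg_arr, a₁]
      · simp [State.setReg_reg]
      · simp [State.setReg_reg]
      · simp only [State.setReg_reg, lastFit]
        rw [if_pos trivial, if_pos]
        by_contra hc
        rw [if_neg hc] at o₁
        exact h12 o₁
      · simp only [State.setReg_reg, if_neg hj']
    · refine halts_nil (key _ a₁ rfl rfl ?_ fun _ _ _ => rfl)
      rw [f₁ 14 (by norm_num) (by norm_num), h14, lastFit, if_neg]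
      intro hc
      rw [if_pos hc, h12] at o₁
      exact zero_ne_one o₁

end routines

/-! ### Tables of addresses -/

section tables

/-- The address in a box of side `n` of the point whose coordinates are the `i` lowest digits of `k`
in base `m`. -/
def address (m n i k : ℕ) : ℕ := ∑ j ∈ Finset.range i, k / m ^ j % m * n ^ j

theorem address_succ_of_lt {m n i k : ℕ} (hk : k < m ^ i) :
    address m n (i + 1) k = address m n i k := by
  rw [address, Finset.sum_range_succ, Nat.div_eq_of_lt hk, Nat.zero_mod, zero_mul, add_zero]
  rfl

theorem address_add {m n i k : ℕ} (hm : 0 < m) (hk : k + m ^ i < m ^ (i + 1)) :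
    address m n (i + 1) (k + m ^ i) = address m n (i + 1) k + n ^ i := by
  have hp : 0 < m ^ i := by positivity
  rw [address, address, Finset.sum_range_succ, Finset.sum_range_succ]
  have h1 : ∀ j ∈ Finset.range i, (k + m ^ i) / m ^ j % m * n ^ j = k / m ^ j % m * n ^ j := by
    intro j hj
    have hj := Finset.mem_range.1 hj
    obtain ⟨t, rfl⟩ : ∃ t, i = j + 1 + t := ⟨i - (j + 1), by omega⟩
    rw [show m ^ (j + 1 + t) = m * m ^ t * m ^ j by ring, Nat.add_mul_div_right _ _ (by positivity),
      Nat.add_mul_mod_self_left]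
  rw [Finset.sum_congr rfl h1, Nat.add_div_right _ hp]
  have h2 : (k + m ^ i) / m ^ i < m := by
    rw [Nat.div_lt_iff_lt_mul hp, mul_comm]
    rwa [pow_succ] at hk
  rw [Nat.add_div_right _ hp] at h2
  rw [Nat.mod_eq_of_lt h2, Nat.mod_eq_of_lt (by omega)]
  ring

/-- Writes the addresses `address m n d k`, `k < m ^ d`, into the array `a`, the powers of `n` into
array `5` and `m ^ d` into register `9`. The numbers `n`, `d`, `m` are in the registers `0`, `3`,
`8`. -/
def tableProg (a : ℕ) : Program :=
  block [.const 9 1, .const 18 1, .const 19 0, .copy 20 3, times 20 (block [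
    .store 5 19 18, .sub 21 8 2, mulProg 22 21 9 23, .copy 24 9, .copy 23 22,
    times 23 (block [.sub 25 24 9, .load 26 a 25, .add 26 26 18, .store a 24 26, .add 24 24 2]),
    .copy 9 24, mulProg 22 0 18 23, .copy 18 22, .add 19 19 2])]

variable {s : State} {a m n d : ℕ}

theorem halts_tableLoop {i : ℕ} (h2 : s.reg 2 = 1) (h9 : s.reg 9 = m ^ i)
    (h18 : s.reg 18 = n ^ i) (h23 : s.reg 23 = (m - 1) * m ^ i) (h24 : s.reg 24 = m ^ i)
    (hm : 0 < m) (ha : ∀ k < m ^ i, s.arr a k = address m n i k) :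
    Halts (times 23 (block [.sub 25 24 9, .load 26 a 25, .add 26 26 18, .store a 24 26,
        .add 24 24 2])) s ((m - 1) * m ^ i * 8 + 1) fun s' =>
      s'.reg 24 = m ^ (i + 1) ∧ (∀ j < 23, s'.reg j = s.reg j) ∧ (∀ b ≠ a, s'.arr b = s.arr b) ∧
      ∀ k < m ^ (i + 1), s'.arr a k = address m n (i + 1) k := by
  have e : m ^ i + (m - 1) * m ^ i = m ^ (i + 1) := by
    obtain ⟨t, rfl⟩ : ∃ t, m = t + 1 := ⟨m - 1, by omega⟩
    simp only [Nat.add_sub_cancel]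
    ring
  have hp : 0 < m ^ i := by positivity
  refine (halts_times (T := 6) (N := (m - 1) * m ^ i) (fun w s' =>
    s'.reg 24 = m ^ i + w ∧ (∀ j < 23, s'.reg j = s.reg j) ∧ (∀ b ≠ a, s'.arr b = s.arr b) ∧
      ∀ k < m ^ i + w, s'.arr a k = address m n (i + 1) k) h23 ?_ ?_).mono le_rfl ?_
  · refine ⟨h24, fun _ _ => rfl, fun _ _ => rfl, fun k hk => ?_⟩
    rw [ha k (by omega), address_succ_of_lt (by omega)]
  · rintro w hw s' ⟨h24', hf, hb, hk⟩ hi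
    have r2 := (hf 2 (by norm_num)).trans h2
    have r9 := (hf 9 (by norm_num)).trans h9
    have r18 := (hf 18 (by norm_num)).trans h18
    have ew : address m n (i + 1) w + n ^ i = address m n (i + 1) (m ^ i + w) := by
      rw [add_comm (m ^ i) w, address_add hm (by omega)]
    refine halts_sub w ?_ <| halts_load (address m n (i + 1) w) ?_ <|
      halts_add (address m n (i + 1) (m ^ i + w)) ?_ <|
      halts_store (m ^ i + w) (address m n (i + 1) (m ^ i + w)) ?_ ?_ <|
      halts_add (m ^ i + (w + 1)) ?_ <| halts_nil
        ⟨?_, ?_, ?_, fun j hj => ?frame, fun b hba => ?_, fun k hk' => ?cells⟩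
    case frame =>
      have := hf j hj
      simp (disch := omega) only [State.setReg_reg, State.setArr_reg, if_neg, this]
    case cells =>
      simp only [State.setReg_arr, State.setArr_arr, Function.update_self]
      rw [Function.update_apply]
      split_ifs with hc
      · rw [hc]
      · exact hk k (by omega)
    all_goals
      simp [State.setReg_reg, State.setReg_arr, State.setArr_reg, State.setArr_arr, add_assoc, *]
  · rintro s' ⟨h24', hf, hb, hk⟩
    rw [e] at hk h24'
    exact ⟨h24', hf, hb, hk⟩

theorem halts_tableProg (h0 : s.reg 0 = n) (h2 : s.reg 2 = 1) (h3 : s.reg 3 = d)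
    (h8 : s.reg 8 = m) (hm : 0 < m) (ha : a ≠ 5) (ha0 : s.arr a 0 = 0) :
    Halts (tableProg a) s (d * (8 * m ^ d + 4 * m + 4 * n + 19) + 6) fun s' =>
      s'.reg 9 = m ^ d ∧ (∀ j < 18, j ≠ 9 → s'.reg j = s.reg j) ∧
      (∀ b ≠ a, b ≠ 5 → s'.arr b = s.arr b) ∧ (∀ k < m ^ d, s'.arr a k = address m n d k) ∧
      ∀ i < d, s'.arr 5 i = n ^ i := by
  obtain ⟨T, hT⟩ : ∃ T, T = 8 * m ^ d + 4 * m + 4 * n + 17 := ⟨_, rfl⟩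
  rw [show 8 * m ^ d + 4 * m + 4 * n + 19 = T + 2 by omega]
  refine halts_const (T := d * (T + 2) + 5) <| halts_const (T := d * (T + 2) + 4) <|
    halts_const (T := d * (T + 2) + 3) <|
    halts_copy d (T := d * (T + 2) + 2) (by simp [State.setReg_reg, h3]) <|
    halts_call (T₁ := d * (T + 2) + 1) (T₂ := 1) ?_ le_rfl
  refine (halts_times (T := T) (N := d) (fun i s' =>
    s'.reg 9 = m ^ i ∧ s'.reg 18 = n ^ i ∧ s'.reg 19 = i ∧ (∀ j < 18, j ≠ 9 → s'.reg j = s.reg j) ∧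
      (∀ b ≠ a, b ≠ 5 → s'.arr b = s.arr b) ∧ (∀ k < m ^ i, s'.arr a k = address m n i k) ∧
      ∀ j < i, s'.arr 5 j = n ^ j) ?_ ?_ ?_).mono le_rfl
      fun s' ⟨h9, _, _, h⟩ => halts_nil ⟨h9, h⟩
  · simp [State.setReg_reg]
  · refine ⟨by simp [State.setReg_reg], by simp [State.setReg_reg], by simp [State.setReg_reg],
      fun j hj hj' => ?_, fun _ _ _ => rfl, fun k hk => ?_, by simp⟩
    · simp (disch := omega) only [State.setReg_reg, if_neg]
    · obtain rfl : k = 0 := by simpa using hk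
      simp [State.setReg_arr, ha0, address]
  · rintro i hi s₁ ⟨h9, h18, h19, hf, hb, hk, hpw⟩ h20
    have r0 := (hf 0 (by norm_num) (by norm_num)).trans h0
    have r2 := (hf 2 (by norm_num) (by norm_num)).trans h2
    have r8 := (hf 8 (by norm_num) (by norm_num)).trans h8
    have hle : (m - 1) * m ^ i ≤ m ^ d := by
      calc (m - 1) * m ^ i ≤ m * m ^ i := Nat.mul_le_mul_right _ (by omega)
        _ = m ^ (i + 1) := by ring
        _ ≤ m ^ d := Nat.pow_le_pow_right hm hi
    rw [show T = (8 * m ^ d + 4 * m + 4 * n + 15) + 1 + 1 by omega]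
    refine halts_store i (n ^ i) h19 h18 <| halts_sub (m - 1)
      (by simp [State.setArr_reg, r8, r2]) ?_
    obtain ⟨s₂, hs₂⟩ : ∃ s₂, s₂ = (s₁.setArr 5 i (n ^ i)).setReg 21 (m - 1) := ⟨_, rfl⟩
    rw [← hs₂]
    have f₂ : ∀ j < 21, s₂.reg j = s₁.reg j := by
      intro j hj
      rw [hs₂]
      simp (disch := omega) only [State.setReg_reg, State.setArr_reg, if_neg]
    have r21 : s₂.reg 21 = m - 1 := by simp [hs₂, State.setReg_reg]
    have b₂ : s₂.arr = Function.update s₁.arr 5 (Function.update (s₁.arr 5) i (n ^ i)) := by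
      rw [hs₂]; rfl
    refine halts_call (T₁ := 4 * (m - 1) + 4) (T₂ := 8 * m ^ d + 4 * n + 15)
      ((halts_mulProg (by rw [f₂ 2 (by norm_num), r2]) (by norm_num) (by norm_num) (by norm_num)
        (by norm_num) (by norm_num) (by norm_num)).mono (by rw [r21]) ?_) (by omega)
    rintro s₃ ⟨b₃, r22, f₃⟩
    have f₃' : ∀ j < 21, s₃.reg j = s₁.reg j := fun j hj =>
      (f₃ j (by omega) (by omega)).trans (f₂ j hj)
    rw [r21, f₂ 9 (by norm_num), h9] at r22
    rw [show 8 * m ^ d + 4 * n + 15 = (8 * m ^ d + 4 * n + 13) + 1 + 1 by omega]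
    refine halts_copy (m ^ i) (by rw [f₃' 9 (by norm_num), h9]) <|
      halts_copy ((m - 1) * m ^ i) (by simp [State.setReg_reg, r22]) ?_
    obtain ⟨s₄, hs₄⟩ : ∃ s₄, s₄ = (s₃.setReg 24 (m ^ i)).setReg 23 ((m - 1) * m ^ i) := ⟨_, rfl⟩
    rw [← hs₄]
    have f₄ : ∀ j < 21, s₄.reg j = s₁.reg j := by
      intro j hj
      rw [hs₄, ← f₃' j hj]
      simp (disch := omega) only [State.setReg_reg, if_neg]
    have b₄ : s₄.arr = Function.update s₁.arr 5 (Function.update (s₁.arr 5) i (n ^ i)) := by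
      rw [← b₂, ← b₃, hs₄]; rfl
    refine halts_call (T₁ := (m - 1) * m ^ i * 8 + 1) (T₂ := 4 * n + 12)
      ((halts_tableLoop (n := n) (by rw [f₄ 2 (by norm_num), r2]) (by rw [f₄ 9 (by norm_num), h9])
        (by rw [f₄ 18 (by norm_num), h18]) (by simp [hs₄, State.setReg_reg])
        (by simp [hs₄, State.setReg_reg]) hm
        fun k hk' => by rw [b₄, Function.update_of_ne ha, hk k hk']).mono le_rfl ?_) (by omega)
    rintro s₅ ⟨r24, f₅, b₅, k₅⟩
    have f₅' : ∀ j < 21, s₅.reg j = s₁.reg j := fun j hj => (f₅ j (by omega)).trans (f₄ j hj)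
    refine halts_copy (m ^ (i + 1)) (T := 4 * n + 11) r24 ?_
    obtain ⟨s₆, hs₆⟩ : ∃ s₆, s₆ = s₅.setReg 9 (m ^ (i + 1)) := ⟨_, rfl⟩
    rw [← hs₆]
    have f₆ : ∀ j < 21, j ≠ 9 → s₆.reg j = s₁.reg j := by
      intro j hj hj'
      rw [hs₆, ← f₅' j hj]
      simp (disch := omega) only [State.setReg_reg, if_neg]
    have r9 : s₆.reg 9 = m ^ (i + 1) := by simp [hs₆, State.setReg_reg]
    have b₆ : s₆.arr = s₅.arr := by rw [hs₆]; rfl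
    refine halts_call (T₁ := 4 * n + 4) (T₂ := 7)
      ((halts_mulProg (by rw [f₆ 2 (by norm_num) (by norm_num), r2]) (by norm_num) (by norm_num)
        (by norm_num) (by norm_num) (by norm_num) (by norm_num)).mono
        (by rw [f₆ 0 (by norm_num) (by norm_num), r0]) ?_) (by omega)
    rintro s₇ ⟨b₇, r22', f₇⟩
    rw [f₆ 0 (by norm_num) (by norm_num), r0, f₆ 18 (by norm_num) (by norm_num), h18] at r22'
    have f₇' : ∀ j < 21, j ≠ 9 → s₇.reg j = s₁.reg j := fun j hj hj' =>
      (f₇ j (by omega) (by omega)).trans (f₆ j hj hj')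
    refine halts_copy (n ^ (i + 1)) (T := 6) (by rw [r22']; ring) <|
      halts_add (i + 1) (T := 5) ?_ <| halts_nil (T := 4) ⟨?_, ?_, ?_, ?_, ?_,
        fun j hj hj' => ?frame,
        fun b hba hb5 => ?_, fun k hk' => ?_, fun j hj => ?pow⟩
    case frame =>
      have := (f₇' j (by omega) hj').trans (hf j hj hj')
      simp (disch := omega) only [State.setReg_reg, if_neg, this]
    case pow =>
      simp only [State.setReg_arr, b₇, b₆]
      rw [b₅ 5 ha.symm, b₄, Function.update_self, Function.update_apply]
      split_ifs with hc
      · rw [hc]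
      · exact hpw j (by omega)
    all_goals
      simp [State.setReg_reg, State.setReg_arr, State.setArr_reg, State.setArr_arr, *]

end tables

/-! ### Finding the corner pattern -/

section startSearch
variable {s : State} {γ β A K pw : ℕ → ℕ} {R M V d n base pat : ℕ}

theorem clear_place (γ A : ℕ → ℕ) (base pat R : ℕ) :
    clear γ base (place γ A base pat (fun _ => 0) R) R = fun _ => 0 := by
  have h1 : ∀ m w, place γ A base pat (fun _ => 0) m w ≠ 0 → ∃ x < m, w = γ x + base := by
    intro m
    induction m with
    | zero => intro w hw; exact absurd rfl hw
    | succ m ih =>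
      intro w hw
      rw [place, Function.update_apply] at hw
      split_ifs at hw with hc
      · exact ⟨m, by omega, hc⟩
      · obtain ⟨x, hx, hw⟩ := ih w hw
        exact ⟨x, by omega, hw⟩
  have h2 : ∀ K m w, ((∃ x < m, w = γ x + base) ∨ K w = 0) → clear γ base K m w = 0 := by
    intro K m
    induction m with
    | zero => rintro w (⟨x, hx, -⟩ | hw); exacts [absurd hx (by omega), hw]
    | succ m ih =>
      intro w hw
      rw [clear, Function.update_apply]
      split_ifs with hc
      · rfl
      · refine ih w (hw.imp_left ?_)
        rintro ⟨x, hx, rfl⟩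
        refine ⟨x, lt_of_le_of_ne (by omega) ?_, rfl⟩
        rintro rfl
        exact hc rfl
  funext w
  by_cases hw : place γ A base pat (fun _ => 0) R w = 0
  · exact h2 _ _ _ (Or.inr hw)
  · exact h2 _ _ _ (Or.inl (h1 _ _ hw))

/-- How many patterns are consistent, at the corner, with the pattern at `pat` placed at one of the
first `i` unit vectors. None is consistent when `pat` is the pattern of the corner box of a labeling
without repetitions of that box. -/
noncomputable def numShiftedFits (γ A pw : ℕ → ℕ) (R M pat i : ℕ) : ℕ :=
  ∑ j ∈ Finset.range i, numFits γ A (place γ A (pw j) pat (fun _ => 0) R) R 0 M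

/-- Computes `numShiftedFits` for the pattern at `reg 15` in register `16`. -/
def shiftedFitsProg : Program :=
  block [.const 16 0, .const 18 0, .copy 22 3, times 22 (block [
    .load 10 5 18, .copy 11 15, placeProg, .const 10 0, countProg, .add 16 16 13, .load 10 5 18,
    clearProg, .add 18 18 2])]

theorem halts_shiftedFitsProg (h : Ready γ β A pw R M V d n s) (hp : s.reg 15 = pat)
    (hK : s.arr 1 = fun _ => 0) :
    Halts shiftedFitsProg s (d * (M * (18 * R + 13) + 20 * R + 24) + 5) fun s' => s'.arr = s.arr ∧
      (∀ j < 30, j < 10 ∨ j = 15 ∨ j = 17 ∨ 22 < j ∨ j = 21 → s'.reg j = s.reg j) ∧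
      s'.reg 16 = numShiftedFits γ A pw R M pat d := by
  obtain ⟨T, hT⟩ : ∃ T, T = M * (18 * R + 13) + 20 * R + 22 := ⟨_, rfl⟩
  rw [show M * (18 * R + 13) + 20 * R + 24 = T + 2 by omega]
  refine halts_const (T := d * (T + 2) + 4) <| halts_const (T := d * (T + 2) + 3) <|
    halts_copy d (T := d * (T + 2) + 2) (by simp [State.setReg_reg, h.reg_three]) <|
    halts_call (T₁ := d * (T + 2) + 1) (T₂ := 1) ?_ le_rfl
  refine (halts_times (T := T) (N := d) (fun i s' => s'.arr = s.arr ∧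
      (∀ j < 30, j < 10 ∨ j = 15 ∨ j = 17 ∨ 22 < j ∨ j = 21 → s'.reg j = s.reg j) ∧
      s'.reg 16 = numShiftedFits γ A pw R M pat i ∧ s'.reg 18 = i) ?_ ?_ ?_).mono le_rfl
      fun s' ⟨h1, h2, h3, _⟩ => halts_nil ⟨h1, h2, h3⟩
  · simp [State.setReg_reg]
  · refine ⟨rfl, fun j hj hj' => ?_, by simp [State.setReg_reg, numShiftedFits],
      by simp [State.setReg_reg]⟩
    simp (disch := omega) only [State.setReg_reg, if_neg]
  · rintro i hi s₁ ⟨a₁, f₁, h16, h18⟩ h22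
    have R₁ : Ready γ β A pw R M V d n s₁ :=
      h.congr (fun j hj => f₁ j (by omega) (by omega)) fun a _ => by rw [a₁]
    rw [show T = (M * (18 * R + 13) + 20 * R + 20) + 1 + 1 by omega]
    refine halts_load (pw i) (by rw [h18, R₁.arr_five]) <| halts_copy pat
      (by simp [State.setReg_reg, f₁, hp]) ?_
    obtain ⟨s₂, hs₂⟩ : ∃ s₂, s₂ = (s₁.setReg 10 (pw i)).setReg 11 pat := ⟨_, rfl⟩
    rw [← hs₂]
    have f₂ : ∀ j < 30, j ≠ 10 → j ≠ 11 → s₂.reg j = s₁.reg j := fun j hj hj' hj'' => by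
      simp [hs₂, State.setReg_reg, hj', hj'']
    have a₂ : s₂.arr = s.arr := by rw [← a₁, hs₂]; rfl
    have R₂ : Ready γ β A pw R M V d n s₂ :=
      R₁.congr (fun j hj => f₂ j (by omega) (by omega) (by omega)) fun a _ => by rw [a₁, a₂]
    refine halts_call (T₁ := 10 * R + 4) (T₂ := M * (18 * R + 13) + 10 * R + 16)
      ((halts_placeProg R₂ (base := pw i) (pat := pat) (by simp [hs₂, State.setReg_reg])
        (by simp [hs₂, State.setReg_reg])).mono le_rfl ?_) (by omega)
    rintro s₃ ⟨a₃, f₃⟩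
    rw [a₂, hK] at a₃
    refine halts_const (T := M * (18 * R + 13) + 10 * R + 15) ?_
    obtain ⟨s₄, hs₄⟩ : ∃ s₄, s₄ = s₃.setReg 10 0 := ⟨_, rfl⟩
    rw [← hs₄]
    have f₄ : ∀ j < 30, j ≠ 10 → j ≠ 11 → s₄.reg j = s₁.reg j := fun j hj hj' hj'' => by
      rw [← f₂ j hj hj' hj'', ← f₃ j hj]; simp [hs₄, State.setReg_reg, hj']
    have a₄ : s₄.arr = s₃.arr := by rw [hs₄]; rfl
    have R₄ : Ready γ β A pw R M V d n s₄ :=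
      R₁.congr (fun j hj => f₄ j (by omega) (by omega) (by omega)) fun a ha => by
        rw [a₄, a₃, Function.update_of_ne ha, a₁]
    refine halts_call (T₁ := M * (18 * R + 13) + 6) (T₂ := 10 * R + 9)
      ((halts_countProg R₄ (base := 0) (by simp [hs₄, State.setReg_reg]) rfl).mono le_rfl ?_)
      (by omega)
    rintro s₅ ⟨a₅, f₅, h13, -⟩
    have K₄ : s₄.arr 1 = place γ A (pw i) pat (fun _ => 0) R := by
      rw [a₄, a₃, Function.update_self]
    rw [K₄] at h13
    have f₅' : ∀ j < 30, j < 10 ∨ 14 < j → j ≠ 20 → s₅.reg j = s₁.reg j := fun j hj hj' hj'' =>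
      (f₅ j hj (by omega) hj'').trans (f₄ j hj (by omega) (by omega))
    have a₅' : s₅.arr = Function.update s.arr 1 (place γ A (pw i) pat (fun _ => 0) R) := by
      rw [a₅, a₄, a₃]
    refine halts_add (numShiftedFits γ A pw R M pat (i + 1)) (T := 10 * R + 8) ?_ <|
      halts_load (pw i) (T := 10 * R + 7) ?_ ?_
    · rw [f₅' 16 (by norm_num) (by norm_num) (by norm_num), h16, h13, numShiftedFits,
        numShiftedFits,
        Finset.sum_range_succ]
    · have := f₅' 18 (by norm_num) (by norm_num) (by norm_num)
      simp [State.setReg_reg, State.setReg_arr, this, h18, a₅', h.arr_five]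
    obtain ⟨s₆, hs₆⟩ : ∃ s₆, s₆ = (s₅.setReg 16 (numShiftedFits γ A pw R M pat (i + 1))).setReg 10
      (pw i) := ⟨_, rfl⟩
    rw [← hs₆]
    have f₆ : ∀ j < 30, j < 10 ∨ 14 < j → j ≠ 20 → j ≠ 16 → s₆.reg j = s₁.reg j :=
      fun j hj hj' hj'' h6 => by
        rw [← f₅' j hj hj' hj'', hs₆]
        simp (disch := omega) only [State.setReg_reg, if_neg]
    have a₆ : s₆.arr = Function.update s.arr 1 (place γ A (pw i) pat (fun _ => 0) R) := by
      rw [← a₅', hs₆]; rfl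
    have R₆ : Ready γ β A pw R M V d n s₆ :=
      R₁.congr (fun j hj => f₆ j (by omega) (by omega) (by omega) (by omega)) fun a ha => by
        rw [a₆, Function.update_of_ne ha, a₁]
    refine halts_call (T₁ := 10 * R + 5) (T₂ := 2)
      ((halts_clearProg R₆ (base := pw i) (by simp [hs₆, State.setReg_reg])).mono le_rfl ?_)
      (by omega)
    rintro s₇ ⟨a₇, f₇⟩
    rw [a₆, Function.update_self, clear_place, Function.update_idem, ← hK, Function.update_eq_self]
      at a₇
    refine halts_add (i + 1) (T := 1) ?_ <| halts_nil (T := 0)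
      ⟨?_, ?_, a₇, fun j hj hj' => ?frame, ?_, ?_⟩
    case frame =>
      have := ((f₇ j hj).trans (f₆ j hj (by omega) (by omega) (by omega))).trans (f₁ j hj hj')
      simp (disch := omega) only [State.setReg_reg, if_neg, this]
    all_goals
      have e2 := (f₇ 2 (by norm_num)).trans
        (f₆ 2 (by norm_num) (by norm_num) (by norm_num) (by norm_num))
      have e18 := (f₇ 18 (by norm_num)).trans
        (f₆ 18 (by norm_num) (by norm_num) (by norm_num) (by norm_num))
      have e22 := (f₇ 22 (by norm_num)).trans
        (f₆ 22 (by norm_num) (by norm_num) (by norm_num) (by norm_num))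
      have e16 : s₇.reg 16 = numShiftedFits γ A pw R M pat (i + 1) := by
        rw [f₇ 16 (by norm_num), hs₆]; simp [State.setReg_reg]
      simp [State.setReg_reg, e2, e16, e18, e22, h18, h22, R₁.reg_two]

/-- The position of the last of the first `m` patterns for which `numShiftedFits` vanishes. -/
noncomputable def startPos (γ A pw : ℕ → ℕ) (R M d : ℕ) : ℕ → ℕ
  | 0 => 0
  | m + 1 => if numShiftedFits γ A pw R M (m * R) d = 0 then m * R else startPos γ A pw R M d m

/-- Finds the pattern of the corner box and places it there. -/
def startProg : Program :=
  block [.const 17 0, .const 15 0, .copy 21 5, times 21 (block [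
    shiftedFitsProg, .ite 16 (block []) (block [.copy 17 15]), .add 15 15 4]),
    .const 10 0, .copy 11 17, placeProg]

theorem halts_startProg (h : Ready γ β A pw R M V d n s) (hK : s.arr 1 = fun _ => 0) :
    Halts startProg s (M * (d * (M * (18 * R + 13) + 20 * R + 24) + 12) + 10 * R + 11) fun s' =>
      s'.arr = Function.update s.arr 1 (place γ A 0 (startPos γ A pw R M d M) (fun _ => 0) R) ∧
      (∀ j < 10, s'.reg j = s.reg j) := by
  obtain ⟨T, hT⟩ : ∃ T, T = d * (M * (18 * R + 13) + 20 * R + 24) + 5 := ⟨_, rfl⟩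
  rw [show d * (M * (18 * R + 13) + 20 * R + 24) + 12 = T + 5 + 2 by omega]
  refine halts_const (T := M * (T + 5 + 2) + 10 * R + 10) <|
    halts_const (T := M * (T + 5 + 2) + 10 * R + 9) <|
    halts_copy M (T := M * (T + 5 + 2) + 10 * R + 8) (by simp [State.setReg_reg, h.reg_five]) <|
    halts_call (T₁ := M * (T + 5 + 2) + 1) (T₂ := 10 * R + 7) ?_ (by omega)
  refine (halts_times (T := T + 5) (N := M) (fun k s' => s'.arr = s.arr ∧
      (∀ j < 10, s'.reg j = s.reg j) ∧ s'.reg 17 = startPos γ A pw R M d k ∧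
      s'.reg 15 = k * R) ?_ ?_ ?_).mono le_rfl ?_
  · simp [State.setReg_reg]
  · refine ⟨rfl, fun j hj => ?_, by simp [State.setReg_reg, startPos], by simp [State.setReg_reg]⟩
    simp (disch := omega) only [State.setReg_reg, if_neg]
  · rintro k hk s₁ ⟨a₁, f₁, h17, h15⟩ h21
    have R₁ : Ready γ β A pw R M V d n s₁ := h.congr f₁ fun a _ => by rw [a₁]
    refine halts_call (T₁ := T) (T₂ := 5) ((halts_shiftedFitsProg R₁ h15 (by rw [a₁, hK])).mono
      (by rw [hT]) ?_) le_rfl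
    rintro s₂ ⟨a₂, f₂, h16⟩
    have f₂' : ∀ j < 10, s₂.reg j = s.reg j := fun j hj =>
      (f₂ j (by omega) (by omega)).trans (f₁ j hj)
    have key : ∀ s₃ : State, s₃.arr = s.arr → (∀ j < 30, j ≠ 17 → s₃.reg j = s₂.reg j) →
        s₃.reg 17 = startPos γ A pw R M d (k + 1) →
        Halts (block [.add 15 15 4]) s₃ 2 fun s' =>
          s'.reg 21 = M - k ∧ s'.reg 2 = 1 ∧ (s'.setReg 21 (M - (k + 1))).arr = s.arr ∧
          (∀ j < 10, (s'.setReg 21 (M - (k + 1))).reg j = s.reg j) ∧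
          (s'.setReg 21 (M - (k + 1))).reg 17 = startPos γ A pw R M d (k + 1) ∧
          (s'.setReg 21 (M - (k + 1))).reg 15 = (k + 1) * R := by
      intro s₃ a₃ f₃ r₁₇
      have e15 := (f₃ 15 (by norm_num) (by norm_num)).trans (f₂ 15 (by norm_num) (by norm_num))
      have e21 := (f₃ 21 (by norm_num) (by norm_num)).trans (f₂ 21 (by norm_num) (by norm_num))
      have e2 := (f₃ 2 (by norm_num) (by norm_num)).trans (f₂' 2 (by norm_num))
      have e4 := (f₃ 4 (by norm_num) (by norm_num)).trans (f₂' 4 (by norm_num))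
      refine halts_add ((k + 1) * R) ?_ <| halts_nil ⟨?_, ?_, a₃, fun j hj => ?frame, ?_, ?_⟩
      case frame =>
        have := (f₃ j (by omega) (by omega)).trans (f₂' j hj)
        simp (disch := omega) only [State.setReg_reg, if_neg, this]
      all_goals
        simp [State.setReg_reg, e15, e21, e2, e4, h15, h21, h.reg_two, h.reg_four, r₁₇, add_mul]
    refine halts_call (T₁ := 2 + 1) (T₂ := 2) (halts_ite (fun hc => ?_) fun hc => ?_) (by omega)
    · refine halts_nil (key _ (a₂.trans a₁) (fun _ _ _ => rfl) ?_)
      rw [f₂ 17 (by norm_num) (by norm_num), h17, startPos, if_neg (by rwa [← h16])]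
    · refine halts_copy (k * R) (T := 1) (by rw [f₂ 15 (by norm_num) (by norm_num), h15]) <|
        halts_nil (key _ (a₂.trans a₁) (fun j hj hj' => ?_) ?_)
      · simp only [State.setReg_reg, if_neg hj']
      · rw [startPos, if_pos (by rwa [← h16])]
        simp [State.setReg_reg]
  · rintro s₁ ⟨a₁, f₁, h17, -⟩
    refine halts_const (T := 10 * R + 6) <| halts_copy (startPos γ A pw R M d M) (T := 10 * R + 5)
      (by simp [State.setReg_reg, h17]) ?_
    have f₂ : ∀ j < 10, ((s₁.setReg 10 0).setReg 11 (startPos γ A pw R M d M)).reg j = s.reg j := by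
      intro j hj
      have := f₁ j hj
      simp (disch := omega) only [State.setReg_reg, if_neg, this]
    refine halts_call (T₁ := 10 * R + 4) (T₂ := 1) ((halts_placeProg (base := 0)
      (pat := startPos γ A pw R M d M) (h.congr f₂ fun a _ => ?_) (by simp [State.setReg_reg])
      (by simp [State.setReg_reg])).mono le_rfl ?_) (by omega)
    · simp only [State.setReg_arr, a₁]
    · rintro s₃ ⟨a₃, f₃⟩
      simp only [State.setReg_arr, a₁, hK] at a₃
      exact halts_nil ⟨a₃, fun j hj => (f₃ j (by omega)).trans (f₂ j hj)⟩

end startSearch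

/-! ### Extending the known region -/

section rounds
variable {s : State} {γ β A K pw : ℕ → ℕ} {R M V d n : ℕ}

/-- Extends the known labels at the `k`-th box, if at most one pattern is consistent with them. -/
noncomputable def fillStep (γ β A : ℕ → ℕ) (R M k : ℕ) (K : ℕ → ℕ) : ℕ → ℕ :=
  if numFits γ A K R (β k) M ≤ 1 then place γ A (β k) (lastFit γ A K R (β k) M) K R else K

/-- Extends the known labels at the first `m` boxes in turn. -/
noncomputable def sweep (γ β A : ℕ → ℕ) (R M : ℕ) (K : ℕ → ℕ) : ℕ → ℕ → ℕ
  | 0 => K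
  | m + 1 => fillStep γ β A R M m (sweep γ β A R M K m)

/-- Performs one `sweep` over all boxes. -/
def sweepProg : Program :=
  block [.const 18 0, .copy 24 5, times 24 (block [
    .load 10 3 18, countProg, .sub 13 13 2, .ite 13 (block []) (block [.copy 11 14, placeProg]),
    .add 18 18 2])]

theorem halts_sweepProg (h : Ready γ β A pw R M V d n s) (hK : s.arr 1 = K) :
    Halts sweepProg s (M * (M * (18 * R + 13) + 10 * R + 19) + 4) fun s' =>
      s'.arr = Function.update s.arr 1 (sweep γ β A R M K M) ∧
      (∀ j < 10, s'.reg j = s.reg j) ∧ s'.reg 23 = s.reg 23 := by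
  obtain ⟨T, hT⟩ : ∃ T, T = M * (18 * R + 13) + 10 * R + 17 := ⟨_, rfl⟩
  rw [show M * (18 * R + 13) + 10 * R + 19 = T + 2 by omega]
  refine halts_const (T := M * (T + 2) + 3) <|
    halts_copy M (T := M * (T + 2) + 2) (by simp [State.setReg_reg, h.reg_five]) <|
    halts_call (T₁ := M * (T + 2) + 1) (T₂ := 1) ?_ le_rfl
  refine (halts_times (T := T) (N := M) (fun k s' =>
      s'.arr = Function.update s.arr 1 (sweep γ β A R M K k) ∧
      (∀ j < 10, s'.reg j = s.reg j) ∧ s'.reg 23 = s.reg 23 ∧ s'.reg 18 = k) ?_ ?_ ?_).mono le_rfl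
      fun s' ⟨h1, h2, h3, _⟩ => halts_nil ⟨h1, h2, h3⟩
  · simp [State.setReg_reg]
  · refine ⟨by simp [sweep, State.setReg_arr, ← hK], fun j hj => ?_, by simp [State.setReg_reg],
      by simp [State.setReg_reg]⟩
    simp (disch := omega) only [State.setReg_reg, if_neg]
  · rintro k hk s₁ ⟨a₁, f₁, h23, h18⟩ h24
    obtain ⟨K₁, hK₁⟩ : ∃ K₁, K₁ = sweep γ β A R M K k := ⟨_, rfl⟩
    rw [← hK₁] at a₁
    have R₁ : Ready γ β A pw R M V d n s₁ :=
      h.congr f₁ fun a ha => by rw [a₁, Function.update_of_ne ha]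
    rw [show T = (M * (18 * R + 13) + 10 * R + 16) + 1 by omega]
    refine halts_load (β k) (by rw [h18, R₁.arr_three]) ?_
    have R₂ : Ready γ β A pw R M V d n (s₁.setReg 10 (β k)) :=
      R₁.congr (fun j hj => by simp (disch := omega) only [State.setReg_reg, if_neg]) fun a _ => rfl
    refine halts_call (T₁ := M * (18 * R + 13) + 6) (T₂ := 10 * R + 10)
      ((halts_countProg R₂ (base := β k) (K := K₁) (by simp [State.setReg_reg])
        (by simp [State.setReg_arr, a₁])).mono le_rfl ?_) (by omega)
    rintro s₃ ⟨a₃, f₃, h13, h14⟩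
    rw [State.setReg_arr, a₁] at a₃
    have f₃' : ∀ j < 30, j < 10 ∨ 14 < j → j ≠ 20 → s₃.reg j = s₁.reg j := fun j hj hj' hj'' => by
      rw [f₃ j hj (by omega) hj'']
      simp (disch := omega) only [State.setReg_reg, if_neg]
    refine halts_sub (numFits γ A K₁ R (β k) M - 1) (T := 10 * R + 9)
      (by rw [h13, f₃' 2 (by norm_num) (by norm_num) (by norm_num), R₁.reg_two]) ?_
    obtain ⟨s₄, hs₄⟩ : ∃ s₄, s₄ = s₃.setReg 13 (numFits γ A K₁ R (β k) M - 1) := ⟨_, rfl⟩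
    rw [← hs₄]
    have f₄ : ∀ j < 30, j < 10 ∨ 14 < j → j ≠ 20 → s₄.reg j = s₁.reg j := fun j hj hj' hj'' => by
      rw [← f₃' j hj hj' hj'', hs₄]
      simp (disch := omega) only [State.setReg_reg, if_neg]
    have key : ∀ s₅ : State, s₅.arr = Function.update s.arr 1 (sweep γ β A R M K (k + 1)) →
        (∀ j < 30, j < 10 ∨ 14 < j → j ≠ 20 → s₅.reg j = s₁.reg j) →
        Halts (block [.add 18 18 2]) s₅ 2 fun s' =>
          s'.reg 24 = M - k ∧ s'.reg 2 = 1 ∧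
          (s'.setReg 24 (M - (k + 1))).arr = Function.update s.arr 1 (sweep γ β A R M K (k + 1)) ∧
          (∀ j < 10, (s'.setReg 24 (M - (k + 1))).reg j = s.reg j) ∧
          (s'.setReg 24 (M - (k + 1))).reg 23 = s.reg 23 ∧
          (s'.setReg 24 (M - (k + 1))).reg 18 = k + 1 := by
      intro s₅ a₅ f₅
      have e2 := f₅ 2 (by norm_num) (by norm_num) (by norm_num)
      have e18 := f₅ 18 (by norm_num) (by norm_num) (by norm_num)
      have e23 := f₅ 23 (by norm_num) (by norm_num) (by norm_num)
      have e24 := f₅ 24 (by norm_num) (by norm_num) (by norm_num)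
      refine halts_add (k + 1) ?_ <| halts_nil ⟨?_, ?_, a₅, fun j hj => ?frame, ?_, ?_⟩
      case frame =>
        have := (f₅ j (by omega) (by omega) (by omega)).trans (f₁ j hj)
        simp (disch := omega) only [State.setReg_reg, if_neg, this]
      all_goals simp [State.setReg_reg, e2, e18, e23, e24, h18, h23, h24, R₁.reg_two]
    refine halts_call (T₁ := (10 * R + 6) + 1) (T₂ := 2) (halts_ite (fun hc => ?_) fun hc => ?_)
      (by omega)
    · refine halts_nil (T := 10 * R + 5) (key _ ?_ f₄)
      simp only [hs₄, State.setReg_reg, if_true] at hc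
      rw [sweep, ← hK₁, fillStep, if_neg (by omega), hs₄, State.setReg_arr, a₃]
    · simp only [hs₄, State.setReg_reg, if_true] at hc
      refine halts_copy (lastFit γ A K₁ R (β k) M) (T := 10 * R + 5)
        (by rw [hs₄]; simp [State.setReg_reg, h14]) ?_
      have R₅ : Ready γ β A pw R M V d n (s₄.setReg 11 (lastFit γ A K₁ R (β k) M)) := by
        refine R₁.congr (fun j hj => ?_) fun a ha => ?_
        · rw [← f₄ j (by omega) (by omega) (by omega)]
          simp (disch := omega) only [State.setReg_reg, if_neg]
        · rw [State.setReg_arr, hs₄, State.setReg_arr, a₃, a₁]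
      refine halts_call (T₁ := 10 * R + 4) (T₂ := 1) ((halts_placeProg R₅ (base := β k)
        (pat := lastFit γ A K₁ R (β k) M) ?_ (by simp [State.setReg_reg])).mono le_rfl ?_)
        (by omega)
      · simp only [hs₄, State.setReg_reg]
        norm_num
        rw [f₃ 10 (by norm_num) (by norm_num) (by norm_num)]
        simp [State.setReg_reg]
      · rintro s₆ ⟨a₆, f₆⟩
        refine halts_nil (key _ ?_ fun j hj hj' hj'' => ?_)
        · rw [a₆, sweep, ← hK₁, fillStep, if_pos (by omega)]
          simp [hs₄, State.setReg_arr, a₃]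
        · rw [f₆ j hj, ← f₄ j hj hj' hj'']
          simp (disch := omega) only [State.setReg_reg, if_neg]

/-- Repeats the sweep as often as there are vertices. -/
def roundsProg : Program := block [.copy 23 6, times 23 sweepProg]

theorem halts_roundsProg (h : Ready γ β A pw R M V d n s) (hK : s.arr 1 = K) :
    Halts roundsProg s (V * (M * (M * (18 * R + 13) + 10 * R + 19) + 6) + 3) fun s' =>
      s'.arr = Function.update s.arr 1 ((fun K => sweep γ β A R M K M)^[V] K) ∧
      (∀ j < 10, s'.reg j = s.reg j) := by
  obtain ⟨T, hT⟩ : ∃ T, T = M * (M * (18 * R + 13) + 10 * R + 19) + 4 := ⟨_, rfl⟩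
  rw [show M * (M * (18 * R + 13) + 10 * R + 19) + 6 = T + 2 by omega]
  refine halts_copy V (T := V * (T + 2) + 2) h.reg_six <|
    halts_call (T₁ := V * (T + 2) + 1) (T₂ := 1) ?_ le_rfl
  refine (halts_times (T := T) (N := V) (fun k s' =>
      s'.arr = Function.update s.arr 1 ((fun K => sweep γ β A R M K M)^[k] K) ∧
      (∀ j < 10, s'.reg j = s.reg j)) ?_ ?_ ?_).mono le_rfl fun s' h => halts_nil h
  · simp [State.setReg_reg]
  · refine ⟨by simp [State.setReg_arr, ← hK], fun j hj => ?_⟩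
    simp (disch := omega) only [State.setReg_reg, if_neg]
  · rintro k hk s₁ ⟨a₁, f₁⟩ h23
    have R₁ : Ready γ β A pw R M V d n s₁ :=
      h.congr f₁ fun a ha => by rw [a₁, Function.update_of_ne ha]
    refine (halts_sweepProg R₁ (K := (fun K => sweep γ β A R M K M)^[k] K) (by simp [a₁])).mono
      (by rw [hT]) ?_
    rintro s₂ ⟨a₂, f₂, r23⟩
    refine ⟨r23.trans h23, (f₂ 2 (by norm_num)).trans R₁.reg_two, ?_, fun j hj => ?_⟩
    · rw [State.setReg_arr, a₂, a₁, Function.update_idem, Function.iterate_succ_apply']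
    · rw [← f₁ j hj, ← f₂ j hj]
      simp (disch := omega) only [State.setReg_reg, if_neg]

/-- Turns the entries `c + 1` of array `1` into the labels `c`. -/
def outputProg : Program :=
  block [.const 18 0, .copy 24 6, times 24 (block [
    .load 19 1 18, .sub 19 19 2, .store 1 18 19, .add 18 18 2])]

theorem halts_outputProg (h : Ready γ β A pw R M V d n s) (hK : s.arr 1 = K) :
    Halts outputProg s (V * 7 + 4) fun s' => ∀ k < V, s'.arr 1 k = K k - 1 := by
  refine halts_const (T := V * 7 + 3) <|
    halts_copy V (T := V * 7 + 2) (by simp [State.setReg_reg, h.reg_six]) <|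
    halts_call (T₁ := V * (5 + 2) + 1) (T₂ := 1) ?_ le_rfl
  refine (halts_times (T := 5) (N := V) (fun k s' => s'.reg 18 = k ∧ s'.reg 2 = 1 ∧
      (∀ w < k, s'.arr 1 w = K w - 1) ∧ ∀ w, k ≤ w → s'.arr 1 w = K w) ?_ ?_ ?_).mono le_rfl
      fun s' h => halts_nil h.2.2.1
  · simp [State.setReg_reg]
  · refine ⟨by simp [State.setReg_reg], by simp [State.setReg_reg, h.reg_two], by simp, ?_⟩
    simp [State.setReg_arr, hK]
  · rintro k hk s₁ ⟨h18, h2, hlt, hge⟩ h24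
    refine halts_load (K k) (by rw [h18, hge k le_rfl]) <| halts_sub (K k - 1) ?_ <|
      halts_store k (K k - 1) ?_ ?_ <| halts_add (k + 1) ?_ <|
      halts_nil ⟨?_, ?_, ?_, ?_, fun w hw => ?lt, fun w hw => ?ge⟩
    case lt =>
      simp only [State.setReg_arr, State.setArr_arr, Function.update_self]
      rw [Function.update_apply]
      split_ifs with hc
      · rw [hc]
      · exact hlt w (by omega)
    case ge =>
      simp only [State.setReg_arr, State.setArr_arr, Function.update_self]
      rw [Function.update_of_ne (by omega)]
      exact hge w (by omega)
    all_goals simp [State.setReg_reg, State.setArr_reg, h18, h2, h24]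

end rounds

/-! ### The reconstruction program -/

section reconstruct

/-- The labels, increased by `1`, that are known in the end. -/
noncomputable def finalLabels (γ β A pw : ℕ → ℕ) (R M V d : ℕ) : ℕ → ℕ :=
  (fun K => sweep γ β A R M K M)^[V] (place γ A 0 (startPos γ A pw R M d M) (fun _ => 0) R)

/-- Computes the shared data, places the corner pattern and extends it. -/
def reconstruct (d : ℕ) : Program :=
  block [.const 2 1, .const 3 d, .sub 7 0 1, .add 7 7 2, .copy 8 1, tableProg 2, .copy 4 9,
    .copy 8 7, tableProg 3, .copy 5 9, .copy 8 0, tableProg 4, .copy 6 9,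
    startProg, roundsProg, outputProg]

open Polynomial in
/-- A bound for the running time; all of `r ^ d`, `(n - r + 1) ^ d`, `n ^ d` are at most
`(n + 1) ^ d`. -/
noncomputable def timeBound (d : ℕ) : Polynomial ℕ :=
  let W := (X + 1 : ℕ[X]) ^ d
  3 * ((d : ℕ[X]) * (8 * W + 4 * X + 4 * X + 19) + 6) +
    (W * ((d : ℕ[X]) * (W * (18 * W + 13) + 20 * W + 24) + 12) + 10 * W + 11) +
    (W * (W * (W * (18 * W + 13) + 10 * W + 19) + 6) + 3) + (W * 7 + 4) + 11

variable {s : State} {A : ℕ → ℕ} {n r d : ℕ}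

theorem halts_reconstruct (hr : 1 ≤ r) (hrn : r ≤ n) (h0 : s.reg 0 = n) (h1 : s.reg 1 = r)
    (hA : s.arr 0 = A) (ha : ∀ a ≠ 0, s.arr a = fun _ => 0) :
    Halts (reconstruct d) s ((timeBound d).eval n) fun s' => ∃ γ β pw : ℕ → ℕ,
      (∀ k < r ^ d, γ k = address r n d k) ∧
      (∀ k < (n - r + 1) ^ d, β k = address (n - r + 1) n d k) ∧ (∀ i < d, pw i = n ^ i) ∧
      ∀ k < n ^ d, s'.arr 1 k =
        finalLabels γ β A pw (r ^ d) ((n - r + 1) ^ d) (n ^ d) d k - 1 := by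
  obtain ⟨W, hW⟩ : ∃ W, W = (n + 1) ^ d := ⟨_, rfl⟩
  obtain ⟨m, hm⟩ : ∃ m, m = n - r + 1 := ⟨_, rfl⟩
  rw [← hm]
  have hR : r ^ d ≤ W := hW ▸ Nat.pow_le_pow_left (by omega) d
  have hM : m ^ d ≤ W := hW ▸ Nat.pow_le_pow_left (by omega) d
  have hV : n ^ d ≤ W := hW ▸ Nat.pow_le_pow_left (by omega) d
  obtain ⟨T₁, hT₁⟩ : ∃ T₁, T₁ = d * (8 * W + 4 * n + 4 * n + 19) + 6 := ⟨_, rfl⟩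
  obtain ⟨T₂, hT₂⟩ : ∃ T₂, T₂ = W * (d * (W * (18 * W + 13) + 20 * W + 24) + 12) + 10 * W + 11 :=
    ⟨_, rfl⟩
  obtain ⟨T₃, hT₃⟩ : ∃ T₃, T₃ = W * (W * (W * (18 * W + 13) + 10 * W + 19) + 6) + 3 := ⟨_, rfl⟩
  have hT : (timeBound d).eval n = 3 * T₁ + T₂ + T₃ + (W * 7 + 4) + 11 := by
    simp [timeBound, hT₁, hT₂, hT₃, hW]
  rw [hT]
  have t₁ : d * (8 * r ^ d + 4 * r + 4 * n + 19) + 6 ≤ T₁ := by rw [hT₁]; gcongr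
  have t₂ : d * (8 * m ^ d + 4 * m + 4 * n + 19) + 6 ≤ T₁ := by rw [hT₁]; gcongr; omega
  have t₃ : d * (8 * n ^ d + 4 * n + 4 * n + 19) + 6 ≤ T₁ := by rw [hT₁]; gcongr
  refine halts_const (T := 3 * T₁ + T₂ + T₃ + (W * 7 + 4) + 10) <|
    halts_const (T := 3 * T₁ + T₂ + T₃ + (W * 7 + 4) + 9) <|
    halts_sub (n - r) (T := 3 * T₁ + T₂ + T₃ + (W * 7 + 4) + 8) ?_ <|
    halts_add m (T := 3 * T₁ + T₂ + T₃ + (W * 7 + 4) + 7) ?_ <|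
    halts_copy r (T := 3 * T₁ + T₂ + T₃ + (W * 7 + 4) + 6) ?_ ?_
  · simp [State.setReg_reg, h0, h1]
  · simp [State.setReg_reg, hm]
  · simp [State.setReg_reg, h1]
  obtain ⟨s₁, hs₁⟩ : ∃ s₁, s₁ = ((((s.setReg 2 1).setReg 3 d).setReg 7 (n - r)).setReg 7 m).setReg
    8 r := ⟨_, rfl⟩
  rw [← hs₁]
  have e0 : s₁.reg 0 = n := by simp [hs₁, State.setReg_reg, h0]
  have e2 : s₁.reg 2 = 1 := by simp [hs₁, State.setReg_reg]
  have e3 : s₁.reg 3 = d := by simp [hs₁, State.setReg_reg]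
  have e7 : s₁.reg 7 = m := by simp [hs₁, State.setReg_reg]
  have a₁ : s₁.arr = s.arr := by rw [hs₁]; rfl
  refine halts_call (T₁ := T₁) (T₂ := 2 * T₁ + T₂ + T₃ + (W * 7 + 4) + 6) ((halts_tableProg (a := 2)
    e0 e2 e3 (m := r) (by simp [hs₁, State.setReg_reg]) hr (by norm_num)
    (by rw [a₁, ha 2 (by norm_num)])).mono t₁ ?_) (by omega)
  rintro s₂ ⟨g9, g, b₂, hγ, -⟩
  refine halts_copy (r ^ d) (T := 2 * T₁ + T₂ + T₃ + (W * 7 + 4) + 5) g9 <|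
    halts_copy m (T := 2 * T₁ + T₂ + T₃ + (W * 7 + 4) + 4) ?_ ?_
  · simp [State.setReg_reg, g, e7]
  obtain ⟨s₃, hs₃⟩ : ∃ s₃, s₃ = (s₂.setReg 4 (r ^ d)).setReg 8 m := ⟨_, rfl⟩
  rw [← hs₃]
  have a₃ : s₃.arr = s₂.arr := by rw [hs₃]; rfl
  refine halts_call (T₁ := T₁) (T₂ := T₁ + T₂ + T₃ + (W * 7 + 4) + 4) ((halts_tableProg (a := 3)
    (s := s₃) (n := n) (d := d) (m := m) (by simp [hs₃, State.setReg_reg, g, e0])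
    (by simp [hs₃, State.setReg_reg, g, e2]) (by simp [hs₃, State.setReg_reg, g, e3])
    (by simp [hs₃, State.setReg_reg]) (by omega) (by norm_num)
    (by rw [a₃, b₂ 3 (by norm_num) (by norm_num), a₁, ha 3 (by norm_num)])).mono t₂ ?_) (by omega)
  rintro s₄ ⟨i9, i, b₄, hβ, -⟩
  refine halts_copy (m ^ d) (T := T₁ + T₂ + T₃ + (W * 7 + 4) + 3) i9 <|
    halts_copy n (T := T₁ + T₂ + T₃ + (W * 7 + 4) + 2) ?_ ?_
  · simp [State.setReg_reg, i, hs₃, g, e0]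
  obtain ⟨s₅, hs₅⟩ : ∃ s₅, s₅ = (s₄.setReg 5 (m ^ d)).setReg 8 n := ⟨_, rfl⟩
  rw [← hs₅]
  have a₅ : s₅.arr = s₄.arr := by rw [hs₅]; rfl
  refine halts_call (T₁ := T₁) (T₂ := T₂ + T₃ + (W * 7 + 4) + 2) ((halts_tableProg (a := 4)
    (s := s₅) (n := n) (d := d) (m := n) (by simp [hs₅, hs₃, State.setReg_reg, i, g, e0])
    (by simp [hs₅, hs₃, State.setReg_reg, i, g, e2])
    (by simp [hs₅, hs₃, State.setReg_reg, i, g, e3])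
    (by simp [hs₅, State.setReg_reg]) (by omega) (by norm_num)
    (by rw [a₅, b₄ 4 (by norm_num) (by norm_num), a₃, b₂ 4 (by norm_num) (by norm_num), a₁,
      ha 4 (by norm_num)])).mono t₃ ?_) (by omega)
  rintro s₆ ⟨k9, k, b₆, -, hpw⟩
  refine halts_copy (n ^ d) (T := T₂ + T₃ + (W * 7 + 4) + 1) k9 ?_
  have hready : Ready (s₆.arr 2) (s₆.arr 3) A (s₆.arr 5) (r ^ d) (m ^ d) (n ^ d) d n
      (s₆.setReg 6 (n ^ d)) := by
    refine ⟨?_, ?_, ?_, ?_, ?_, ?_, ?_, rfl, rfl, rfl⟩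
    · simp [State.setReg_reg, k, hs₅, i, hs₃, g, e0]
    · simp [State.setReg_reg, k, hs₅, i, hs₃, g, e2]
    · simp [State.setReg_reg, k, hs₅, i, hs₃, g, e3]
    · simp [State.setReg_reg, k, hs₅, i, hs₃]
    · simp [State.setReg_reg, k, hs₅]
    · simp [State.setReg_reg]
    · rw [State.setReg_arr, b₆ 0 (by norm_num) (by norm_num), a₅, b₄ 0 (by norm_num) (by norm_num),
        a₃, b₂ 0 (by norm_num) (by norm_num), a₁, hA]
  have hγ' : ∀ k < r ^ d, s₆.arr 2 k = address r n d k := by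
    rwa [b₆ 2 (by norm_num) (by norm_num), a₅, b₄ 2 (by norm_num) (by norm_num), a₃]
  have hβ' : ∀ k < m ^ d, s₆.arr 3 k = address m n d k := by
    rwa [b₆ 3 (by norm_num) (by norm_num), a₅]
  refine halts_call (T₁ := T₂) (T₂ := T₃ + (W * 7 + 4) + 1) ((halts_startProg hready ?_).mono
    (by rw [hT₂]; gcongr) ?_) (by omega)
  · rw [State.setReg_arr, b₆ 1 (by norm_num) (by norm_num), a₅, b₄ 1 (by norm_num) (by norm_num),
      a₃, b₂ 1 (by norm_num) (by norm_num), a₁, ha 1 (by norm_num)]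
  rintro s₇ ⟨a₇, f₇⟩
  have R₇ := hready.congr f₇ fun a ha => by rw [a₇, Function.update_of_ne ha]
  refine halts_call (T₁ := T₃) (T₂ := (W * 7 + 4) + 1) ((halts_roundsProg R₇ rfl).mono
    (by rw [hT₃]; gcongr) ?_) (by omega)
  rintro s₈ ⟨a₈, f₈⟩
  have R₈ := R₇.congr f₈ fun a ha => by rw [a₈, Function.update_of_ne ha]
  refine halts_call (T₁ := W * 7 + 4) (T₂ := 1) ((halts_outputProg R₈ rfl).mono (by gcongr) ?_)
    le_rfl
  intro s₉ h₉
  refine halts_nil ⟨s₆.arr 2, s₆.arr 3, s₆.arr 5, hγ', hβ', hpw, fun w hw => ?_⟩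
  rw [h₉ w hw, a₈, Function.update_self, a₇, Function.update_self]
  rfl

end reconstruct

/-! ### Correctness of the reconstruction -/

section correctness
variable {γ β A K pw : ℕ → ℕ} {R M n r d : ℕ}

theorem place_apply_of_forall_ne {base pat w m : ℕ} (h : ∀ x < m, γ x + base ≠ w) :
    place γ A base pat K m w = K w := by
  induction m with
  | zero => rfl
  | succ m ih =>
    rw [place, Function.update_of_ne (h m (by omega)).symm]
    exact ih fun x hx => h x (by omega)

theorem place_apply_of_exists {base pat w m v : ℕ} (h : ∃ x < m, γ x + base = w)
    (hv : ∀ x < m, γ x + base = w → A (pat + x) + 1 = v) : place γ A base pat K m w = v := by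
  induction m with
  | zero => obtain ⟨x, hx, -⟩ := h; omega
  | succ m ih =>
    rw [place, Function.update_apply]
    split_ifs with hc
    · exact hv m (by omega) hc.symm
    · refine ih ?_ fun x hx => hv x (by omega)
      obtain ⟨x, hx, hw⟩ := h
      refine ⟨x, lt_of_le_of_ne (by omega) ?_, hw⟩
      rintro rfl
      exact hc hw.symm

open Classical in
theorem numFits_eq_card {base m : ℕ} : numFits γ A K R base m =
    ((Finset.range m).filter fun p => Consistent γ A K R base (p * R)).card := by
  induction m with
  | zero => rfl
  | succ m ih =>
    rw [numFits, ih, Finset.range_add_one, Finset.filter_insert]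
    split_ifs with h
    · rw [Finset.card_insert_of_notMem (by simp)]
    · rfl

theorem numFits_eq_zero_iff {base m : ℕ} :
    numFits γ A K R base m = 0 ↔ ∀ p < m, ¬ Consistent γ A K R base (p * R) := by
  classical
  rw [numFits_eq_card, Finset.card_eq_zero, Finset.filter_eq_empty_iff]
  simp

theorem numFits_le_one_iff {base m : ℕ} : numFits γ A K R base m ≤ 1 ↔
    ∀ p < m, ∀ p' < m, Consistent γ A K R base (p * R) → Consistent γ A K R base (p' * R) →
      p = p' := by
  classical
  rw [numFits_eq_card, Finset.card_le_one]
  simp only [Finset.mem_filter, Finset.mem_range]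
  exact ⟨fun h p hp p' hp' hc hc' => h p ⟨hp, hc⟩ p' ⟨hp', hc'⟩,
    fun h p hp p' hp' => h p hp.1 p' hp'.1 hp.2 hp'.2⟩

theorem lastFit_eq {base m p : ℕ} (hp : p < m) (hc : Consistent γ A K R base (p * R))
    (h : ∀ p' < m, Consistent γ A K R base (p' * R) → p' = p) :
    lastFit γ A K R base m = p * R := by
  induction m with
  | zero => omega
  | succ m ih =>
    rw [lastFit]
    split_ifs with hm
    · rw [h m (by omega) hm]
    · refine ih (lt_of_le_of_ne (by omega) ?_) fun p' hp' => h p' (by omega)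
      rintro rfl
      exact hm hc

theorem startPos_eq {m p : ℕ} (hp : p < m) (hc : numShiftedFits γ A pw R M (p * R) d = 0)
    (h : ∀ p' < m, numShiftedFits γ A pw R M (p' * R) d = 0 → p' = p) :
    startPos γ A pw R M d m = p * R := by
  induction m with
  | zero => omega
  | succ m ih =>
    rw [startPos]
    split_ifs with hm
    · rw [h m (by omega) hm]
    · refine ih (lt_of_le_of_ne (by omega) ?_) fun p' hp' => h p' (by omega)
      rintro rfl
      exact hm hc

/-- The tables and the list of patterns describe the labels `g` on `Λ_n`: `addr v` is the address of
the vertex `v`, `X x` is the `x`-th vertex of the box `Λ_r`, `C p` is the smallest corner of the box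
that carries the `p`-th pattern, and `Y k` is the `k`-th smallest corner in the order in which
the boxes are swept. -/
structure Describes (n r : ℕ) (g : (Fin d → ℤ) → ℕ) (γ β A pw : ℕ → ℕ) (R M : ℕ)
    (addr : (Fin d → ℤ) → ℕ) (C X Y : ℕ → Fin d → ℤ) : Prop where
  addr_inj : Set.InjOn addr (vertices d n)
  offset_mem : ∀ x < R, X x ∈ cube r (0 : Fin d → ℤ)
  exists_offset : ∀ u ∈ cube r (0 : Fin d → ℤ), ∃ x < R, X x = u
  corner_isSite : ∀ p < M, IsSite n r (C p)
  exists_corner : ∀ c, IsSite n r c → ∃ p < M, C p = c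
  corner_inj : ∀ p < M, ∀ p' < M, C p = C p' → p = p'
  position_isSite : ∀ k < M, IsSite n r (Y k)
  exists_position : ∀ c, IsSite n r c → ∃ k < M, Y k = c
  addr_zero : ∀ x < R, γ x + 0 = addr (0 + X x)
  addr_position : ∀ k < M, ∀ x < R, γ x + β k = addr (Y k + X x)
  addr_unit : ∀ i : Fin d, ∀ x < R, γ x + pw i = addr (Pi.single i 1 + X x)
  pattern : ∀ p < M, ∀ x < R, A (p * R + x) = g (C p + X x)

variable {g : (Fin d → ℤ) → ℕ} {addr : (Fin d → ℤ) → ℕ} {C X Y : ℕ → Fin d → ℤ}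

theorem add_mem_cube {c u : Fin d → ℤ} : c + u ∈ cube r c ↔ u ∈ cube r (0 : Fin d → ℤ) := by
  simp only [mem_cube, Pi.add_apply, Pi.zero_apply]
  refine forall_congr' fun i => ?_
  omega

namespace Describes

theorem place_of_mem (H : Describes n r g γ β A pw R M addr C X Y) {base p : ℕ} {c u : Fin d → ℤ}
    (hp : p < M) (hb : ∀ x < R, γ x + base = addr (c + X x)) (hc : IsSite n r c)
    (hu : u ∈ cube r (0 : Fin d → ℤ)) :
    place γ A base (p * R) K R (addr (c + u)) = g (C p + u) + 1 := by
  have hv : ∀ w ∈ cube r (0 : Fin d → ℤ), c + w ∈ vertices d n := fun w hw =>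
    cube_subset_vertices hc (add_mem_cube.2 hw)
  refine place_apply_of_exists ?_ fun x hx he => ?_
  · obtain ⟨x, hx, rfl⟩ := H.exists_offset u hu
    exact ⟨x, hx, hb x hx⟩
  · rw [hb x hx] at he
    have := H.addr_inj (hv _ (H.offset_mem x hx)) (hv u hu) he
    rw [H.pattern p hp x hx, add_left_cancel this]

theorem place_of_notMem (H : Describes n r g γ β A pw R M addr C X Y) {base pat : ℕ}
    {c v : Fin d → ℤ} (hb : ∀ x < R, γ x + base = addr (c + X x)) (hc : IsSite n r c)
    (hv : v ∈ vertices d n) (hvc : v ∉ cube r c) :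
    place γ A base pat K R (addr v) = K (addr v) := by
  refine place_apply_of_forall_ne fun x hx he => hvc ?_
  rw [hb x hx] at he
  have h1 : c + X x ∈ cube r c := add_mem_cube.2 (H.offset_mem x hx)
  rwa [← H.addr_inj (cube_subset_vertices hc h1) hv he]

theorem consistent_iff (H : Describes n r g γ β A pw R M addr C X Y) {base p : ℕ}
    {c : Fin d → ℤ} (hp : p < M) (hb : ∀ x < R, γ x + base = addr (c + X x)) :
    Consistent γ A K R base (p * R) ↔ ∀ u ∈ cube r (0 : Fin d → ℤ),
      K (addr (c + u)) = 0 ∨ K (addr (c + u)) = g (C p + u) + 1 := by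
  constructor
  · intro h u hu
    obtain ⟨x, hx, rfl⟩ := H.exists_offset u hu
    have := h x hx
    rwa [hb x hx, H.pattern p hp x hx] at this
  · intro h x hx
    have := h _ (H.offset_mem x hx)
    rwa [hb x hx, H.pattern p hp x hx]

end Describes

/-- All known labels are correct. -/
def Sound (n : ℕ) (g : (Fin d → ℤ) → ℕ) (addr : (Fin d → ℤ) → ℕ) (K : ℕ → ℕ) : Prop :=
  ∀ v ∈ vertices d n, K (addr v) = 0 ∨ K (addr v) = g v + 1

/-- The vertices whose labels are known. -/
noncomputable def known (n : ℕ) (addr : (Fin d → ℤ) → ℕ) (K : ℕ → ℕ) : Finset (Fin d → ℤ) :=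
  (vertices d n).filter fun v => K (addr v) ≠ 0

namespace Describes

theorem sound_place (H : Describes n r g γ β A pw R M addr C X Y) {base p : ℕ}
    (hK : Sound n g addr K) (hp : p < M) (hb : ∀ x < R, γ x + base = addr (C p + X x)) :
    Sound n g addr (place γ A base (p * R) K R) ∧
      known n addr K ⊆ known n addr (place γ A base (p * R) K R) ∧
      cube r (C p) ⊆ known n addr (place γ A base (p * R) K R) := by
  have hc := H.corner_isSite p hp
  have h1 : ∀ v ∈ cube r (C p), place γ A base (p * R) K R (addr v) = g v + 1 := by
    intro v hv
    have := H.place_of_mem (K := K) (u := v - C p) hp hb hc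
      (add_mem_cube (c := C p).1 (by rwa [add_sub_cancel]))
    rwa [add_sub_cancel] at this
  refine ⟨fun v hv => ?_, fun v hv => ?_, fun v hv => ?_⟩
  · by_cases hvc : v ∈ cube r (C p)
    · exact Or.inr (h1 v hvc)
    · rw [H.place_of_notMem hb hc hv hvc]
      exact hK v hv
  · rw [known, Finset.mem_filter] at hv ⊢
    refine ⟨hv.1, ?_⟩
    by_cases hvc : v ∈ cube r (C p)
    · rw [h1 v hvc]; omega
    · rw [H.place_of_notMem hb hc hv.1 hvc]
      exact hv.2
  · rw [known, Finset.mem_filter, h1 v hv]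
    exact ⟨cube_subset_vertices hc hv, by omega⟩

/-- A pattern that agrees with the correct labels on the core of a good box is the right one. -/
theorem eq_of_consistent {q : ℕ} {σ : Labeling d n q}
    (H : Describes n r (ext σ) γ β A pw R M addr C X Y) {base p : ℕ} {c : Fin d → ℤ}
    (hK : Sound n (ext σ) addr K) (hp : p < M) (hb : ∀ x < R, γ x + base = addr (c + X x))
    (hgood : c ∉ badSites r σ) (hcore : ∀ v ∈ core r c, v ∈ known n addr K)
    (h : Consistent γ A K R base (p * R)) : C p = c := by
  rw [H.consistent_iff hp hb] at h
  by_contra hne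
  refine hgood ⟨C p - c, sub_ne_zero.2 hne, fun x hx => ?_⟩
  have hxc := core_subset_cube r c hx
  have hu : x - c ∈ cube r (0 : Fin d → ℤ) := add_mem_cube (c := c).1 (by rwa [add_sub_cancel])
  have e : x + (C p - c) = C p + (x - c) := by abel
  refine ⟨?_, ?_⟩
  · rw [e]
    exact cube_subset_vertices (H.corner_isSite p hp) (add_mem_cube.2 hu)
  · have h1 := h _ hu
    rw [add_sub_cancel] at h1
    have h2 := hcore x hx
    rw [known, Finset.mem_filter] at h2
    have h3 := hK x h2.1
    rw [e]
    omega

theorem fillStep_spec {q : ℕ} {σ : Labeling d n q}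
    (H : Describes n r (ext σ) γ β A pw R M addr C X Y) {k : ℕ} (hk : k < M)
    (hK : Sound n (ext σ) addr K) :
    Sound n (ext σ) addr (fillStep γ β A R M k K) ∧
      known n addr K ⊆ known n addr (fillStep γ β A R M k K) ∧
      (Y k ∉ badSites r σ → (∀ v ∈ core r (Y k), v ∈ known n addr K) →
        cube r (Y k) ⊆ known n addr (fillStep γ β A R M k K)) := by
  have hb := H.addr_position k hk
  have hs := H.position_isSite k hk
  obtain ⟨p, hp, hpk⟩ := H.exists_corner _ hs
  have hcp : Consistent γ A K R (β k) (p * R) := by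
    rw [H.consistent_iff hp hb, hpk]
    exact fun u hu => hK _ (cube_subset_vertices hs (add_mem_cube.2 hu))
  by_cases h1 : numFits γ A K R (β k) M ≤ 1
  · rw [fillStep, if_pos h1, lastFit_eq hp hcp fun p' hp' hc' =>
      numFits_le_one_iff.1 h1 p' hp' p hp hc' hcp]
    rw [← hpk] at hb ⊢
    obtain ⟨h2, h3, h4⟩ := H.sound_place hK hp hb
    exact ⟨h2, h3, fun _ _ => h4⟩
  · rw [fillStep, if_neg h1]
    refine ⟨hK, subset_rfl, fun hgood hcore => absurd ?_ h1⟩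
    rw [numFits_le_one_iff]
    intro p₁ hp₁ p₂ hp₂ hc₁ hc₂
    exact H.corner_inj p₁ hp₁ p₂ hp₂ ((H.eq_of_consistent hK hp₁ hb hgood hcore hc₁).trans
      (H.eq_of_consistent hK hp₂ hb hgood hcore hc₂).symm)

theorem sweep_spec {q : ℕ} {σ : Labeling d n q}
    (H : Describes n r (ext σ) γ β A pw R M addr C X Y) (hK : Sound n (ext σ) addr K) {m : ℕ}
    (hm : m ≤ M) :
    Sound n (ext σ) addr (sweep γ β A R M K m) ∧
      known n addr K ⊆ known n addr (sweep γ β A R M K m) ∧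
      ∀ k < m, Y k ∉ badSites r σ → (∀ v ∈ core r (Y k), v ∈ known n addr K) →
        cube r (Y k) ⊆ known n addr (sweep γ β A R M K m) := by
  induction m with
  | zero => exact ⟨hK, subset_rfl, fun k hk => absurd hk (by omega)⟩
  | succ m ih =>
    obtain ⟨h1, h2, h3⟩ := ih (by omega)
    obtain ⟨h4, h5, h6⟩ := H.fillStep_spec (k := m) (by omega) h1
    refine ⟨h4, h2.trans h5, fun k hk hgood hcore => ?_⟩
    rcases Nat.lt_succ_iff_lt_or_eq.1 hk with hk | rfl
    · exact (h3 k hk hgood hcore).trans h5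
    · exact h6 hgood fun v hv => h2 (hcore v hv)

theorem card_vertices (d n : ℕ) : (vertices d n).card = n ^ d := by
  simp [vertices, Fintype.card_piFinset]

/-- As long as some label is unknown, each sweep finds a new one. -/
theorem known_iterate_sweep {q : ℕ} {σ : Labeling d n q}
    (H : Describes n r (ext σ) γ β A pw R M addr C X Y) (hσ : Fillable r σ)
    (hK : Sound n (ext σ) addr K) (h0 : cube r (0 : Fin d → ℤ) ⊆ known n addr K) (t : ℕ) :
    Sound n (ext σ) addr ((fun K => sweep γ β A R M K M)^[t] K) ∧
      cube r (0 : Fin d → ℤ) ⊆ known n addr ((fun K => sweep γ β A R M K M)^[t] K) ∧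
      (t ≤ (known n addr ((fun K => sweep γ β A R M K M)^[t] K)).card ∨
        vertices d n ⊆ known n addr ((fun K => sweep γ β A R M K M)^[t] K)) := by
  induction t with
  | zero => exact ⟨hK, h0, Or.inl (Nat.zero_le _)⟩
  | succ t ih =>
    rw [Function.iterate_succ_apply']
    obtain ⟨h1, h2, h3⟩ := ih
    obtain ⟨h4, h5, h6⟩ := H.sweep_spec h1 le_rfl
    refine ⟨h4, h2.trans h5, ?_⟩
    by_cases he : known n addr ((fun K => sweep γ β A R M K M)^[t] K) =
        known n addr (sweep γ β A R M ((fun K => sweep γ β A R M K M)^[t] K) M)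
    · right
      rw [← he]
      refine hσ.2 (known n addr ((fun K => sweep γ β A R M K M)^[t] K) : Set _) ?_ h2
      intro c hc hgood hcore v hv
      obtain ⟨k, hk, rfl⟩ := H.exists_position c hc
      have := h6 k hk hgood hcore hv
      rw [← he] at this
      exact this
    · rcases h3 with h3 | h3
      · left
        have := Finset.card_lt_card (Finset.ssubset_iff_subset_ne.2 ⟨h5, he⟩)
        omega
      · exact Or.inr (h3.trans h5)

theorem isSite_single (hrn : r < n) (i : Fin d) : IsSite n r (Pi.single i 1 : Fin d → ℤ) := by
  intro j
  rw [Pi.single_apply]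
  split_ifs <;> omega

/-- Only the corner box has no neighbour one step down in any direction. For the other boxes that
neighbour is consistent; for the corner box a consistent pattern would be a repetition of its core.
-/
theorem numShiftedFits_eq_zero_iff {q : ℕ} {σ : Labeling d n q}
    (H : Describes n r (ext σ) γ β A pw R M addr C X Y) (h0 : 0 ∉ badSites r σ) (hrn : r < n)
    {p : ℕ} (hp : p < M) : numShiftedFits γ A pw R M (p * R) d = 0 ↔ C p = 0 := by
  have hsite := H.corner_isSite p hp
  have hK1 : ∀ (i : Fin d), ∀ u ∈ cube r (0 : Fin d → ℤ),
      u ∈ cube r (Pi.single i 1 : Fin d → ℤ) →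
      place γ A (pw i) (p * R) (fun _ => 0) R (addr (0 + u)) =
        ext σ (C p + (u - Pi.single i 1)) + 1 := by
    intro i u hu hui
    have hu' : u - Pi.single i 1 ∈ cube r (0 : Fin d → ℤ) :=
      add_mem_cube (c := Pi.single i 1).1 (by rwa [add_sub_cancel])
    rw [← H.place_of_mem (K := fun _ => 0) hp (H.addr_unit i) (isSite_single hrn i) hu',
      add_sub_cancel, zero_add]
  have hK2 : ∀ (i : Fin d), ∀ u ∈ cube r (0 : Fin d → ℤ),
      u ∉ cube r (Pi.single i 1 : Fin d → ℤ) →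
      place γ A (pw i) (p * R) (fun _ => 0) R (addr (0 + u)) = 0 := by
    intro i u hu hui
    rw [zero_add]
    exact H.place_of_notMem (H.addr_unit i) (isSite_single hrn i)
      (cube_subset_vertices (isSite_zero hrn.le) hu) hui
  rw [numShiftedFits, Finset.sum_eq_zero_iff]
  simp only [Finset.mem_range, numFits_eq_zero_iff]
  constructor
  · intro h
    by_contra hne
    obtain ⟨i, hi⟩ := Function.ne_iff.1 hne
    have hi := lt_of_le_of_ne (hsite i).1 (Ne.symm hi)
    have hs' : IsSite n r (C p - Pi.single i 1) := by
      intro j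
      have := hsite j
      rw [Pi.sub_apply, Pi.single_apply]
      split_ifs with hj
      · subst hj; omega
      · omega
    obtain ⟨p', hp', hpp⟩ := H.exists_corner _ hs'
    refine h i i.2 p' hp' ((H.consistent_iff hp' H.addr_zero).2 fun u hu => ?_)
    by_cases hui : u ∈ cube r (Pi.single i 1 : Fin d → ℤ)
    · right
      rw [hK1 i u hu hui, hpp]
      congr 2
      abel
    · exact Or.inl (hK2 i u hu hui)
  · intro hCp i hi p' hp' hcon
    rw [H.consistent_iff hp' H.addr_zero] at hcon
    refine h0 ⟨C p' + Pi.single ⟨i, hi⟩ 1, ?_, fun x hx => ?_⟩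
    · intro he
      have := congrFun he ⟨i, hi⟩
      have h1 := (H.corner_isSite p' hp' ⟨i, hi⟩).1
      simp only [Pi.add_apply, Pi.single_eq_same, Pi.zero_apply] at this
      omega
    · have hx' := mem_core.1 hx
      have hu : x + Pi.single ⟨i, hi⟩ 1 ∈ cube r (0 : Fin d → ℤ) := by
        rw [mem_cube]
        intro j
        have := hx' j
        simp only [Pi.add_apply, Pi.single_apply, Pi.zero_apply] at this ⊢
        split_ifs <;> omega
      have hui : x + Pi.single ⟨i, hi⟩ 1 ∈ cube r (Pi.single ⟨i, hi⟩ 1 : Fin d → ℤ) := by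
        rw [add_comm]
        exact add_mem_cube.2 (core_subset_cube r _ hx)
      have h1 := hcon _ hu
      have h2 := hK1 ⟨i, hi⟩ _ hu hui
      simp only at h2
      rw [h2, hCp, zero_add, add_sub_cancel_right] at h1
      have e : x + (C p' + Pi.single ⟨i, hi⟩ 1) = C p' + (x + Pi.single ⟨i, hi⟩ 1) := by abel
      rw [e]
      exact ⟨cube_subset_vertices (H.corner_isSite p' hp') (add_mem_cube.2 hu), by omega⟩

theorem finalLabels_eq {q : ℕ} {σ : Labeling d n q}
    (H : Describes n r (ext σ) γ β A pw R M addr C X Y) (hσ : Fillable r σ) (hrn : r ≤ n)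
    (hM : M = (n - r + 1) ^ d) {v : Fin d → ℤ} (hv : v ∈ vertices d n) :
    finalLabels γ β A pw R M (n ^ d) d (addr v) = ext σ v + 1 := by
  obtain ⟨p, hp, hp0⟩ := H.exists_corner 0 (isSite_zero hrn)
  have hstart : startPos γ A pw R M d M = p * R := by
    rcases hrn.lt_or_eq with hlt | rfl
    · refine startPos_eq hp ((H.numShiftedFits_eq_zero_iff hσ.1 hlt hp).2 hp0) fun p' hp' h => ?_
      rw [H.numShiftedFits_eq_zero_iff hσ.1 hlt hp'] at h
      exact H.corner_inj p' hp' p hp (h.trans hp0.symm)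
    -- the only pattern is at position `0`, also if `startPos` finds none
    · have hM1 : M = 1 := by simpa using hM
      obtain rfl : p = 0 := by omega
      rw [hM1]
      simp [startPos]
  have hK0 : Sound n (ext σ) addr (fun _ => 0) := fun v _ => Or.inl rfl
  obtain ⟨h1, -, h2⟩ := H.sound_place hK0 hp (base := 0) (by rw [hp0]; exact H.addr_zero)
  rw [hp0] at h2
  obtain ⟨h3, -, h4⟩ := H.known_iterate_sweep hσ h1 h2 (n ^ d)
  have hall : v ∈ known n addr ((fun K => sweep γ β A R M K M)^[n ^ d]
      (place γ A 0 (p * R) (fun _ => 0) R)) := by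
    rcases h4 with h4 | h4
    · have h5 := (card_vertices d n).le.trans h4
      rwa [known, Finset.eq_of_subset_of_card_le (Finset.filter_subset _ _) h5]
    · exact h4 hv
  rw [known, Finset.mem_filter] at hall
  rw [finalLabels, hstart]
  exact (h3 v hv).resolve_left hall.2

end Describes

end correctness

/-! ### The input and the tables describe the labeling -/

section describes
variable {d n q r m : ℕ}

/-- The point whose coordinates are the digits of `k` in base `m`. -/
def digitPoint (d m k : ℕ) : Fin d → ℤ := fun i => ((k / m ^ (i : ℕ) % m : ℕ) : ℤ)

/-- The position of a vertex of `Λ_n` in the output. -/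
def vertexAddress (n : ℕ) (v : Fin d → ℤ) : ℕ := ∑ i : Fin d, (v i).toNat * n ^ (i : ℕ)

theorem digitPoint_nonneg (k : ℕ) (i : Fin d) : 0 ≤ digitPoint d m k i := Int.natCast_nonneg _

theorem digitPoint_lt (hm : 0 < m) (k : ℕ) (i : Fin d) : digitPoint d m k i < m := by
  unfold digitPoint
  exact_mod_cast Nat.mod_lt _ hm

theorem digitPoint_val (k : Fin (m ^ d)) :
    digitPoint d m k = fun i => ((finFunctionFinEquiv.symm k i : ℕ) : ℤ) := rfl

theorem exists_digitPoint {v : Fin d → ℤ} (hv : ∀ i, 0 ≤ v i ∧ v i < m) :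
    ∃ k < m ^ d, digitPoint d m k = v := by
  let f : Fin d → Fin m := fun i => ⟨(v i).toNat, by have := hv i; omega⟩
  refine ⟨finFunctionFinEquiv f, (finFunctionFinEquiv f).2, ?_⟩
  rw [digitPoint_val, Equiv.symm_apply_apply]
  funext i
  have := hv i
  simp only [f]
  omega

theorem address_eq (k : ℕ) : address m n d k = vertexAddress n (digitPoint d m k) := by
  rw [address, Finset.sum_range]
  rfl

theorem vertexAddress_add {u v : Fin d → ℤ} (hu : ∀ i, 0 ≤ u i) (hv : ∀ i, 0 ≤ v i) :
    vertexAddress n (u + v) = vertexAddress n u + vertexAddress n v := by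
  rw [vertexAddress, vertexAddress, vertexAddress, ← Finset.sum_add_distrib]
  refine Finset.sum_congr rfl fun i _ => ?_
  rw [Pi.add_apply, Int.toNat_add (hu i) (hv i), add_mul]

theorem vertexAddress_single (i : Fin d) :
    vertexAddress n (Pi.single i 1 : Fin d → ℤ) = n ^ (i : ℕ) := by
  rw [vertexAddress, Finset.sum_eq_single i]
  · simp
  · intro j _ hj
    simp [Pi.single_eq_of_ne hj]
  · simp

theorem vertexAddress_eq (hn : 0 < n) {v : Fin d → ℤ} (hv : v ∈ vertices d n) :
    vertexAddress n v = (finFunctionFinEquiv (toVertex hn v) : ℕ) := by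
  rw [mem_vertices] at hv
  rw [finFunctionFinEquiv_apply, vertexAddress]
  refine Finset.sum_congr rfl fun i _ => ?_
  have := hv i
  simp only [toVertex]
  rw [Nat.mod_eq_of_lt (by omega)]

theorem vertexAddress_injOn (hn : 0 < n) :
    Set.InjOn (vertexAddress n) (vertices d n : Set (Fin d → ℤ)) := by
  intro u hu v hv h
  rw [vertexAddress_eq hn hu, vertexAddress_eq hn hv, Fin.val_inj, Equiv.apply_eq_iff_eq] at h
  rw [← toVertex_cast hn hu, ← toVertex_cast hn hv, h]

theorem getD_flatMap {α : Type*} {f : α → List ℕ} {R : ℕ} (hf : ∀ a, (f a).length = R) {l : List α}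
    {p x : ℕ} (hp : p < l.length) (hx : x < R) :
    (l.flatMap f).getD (p * R + x) 0 = (f l[p]).getD x 0 := by
  induction l generalizing p with
  | nil => simp at hp
  | cons a l ih =>
    rw [List.flatMap_cons]
    cases p with
    | zero =>
      rw [zero_mul, zero_add, List.getD_append _ _ _ _ (by rw [hf]; exact hx)]
      rfl
    | succ p =>
      rw [List.getD_append_right _ _ _ _ (by rw [hf, add_mul]; omega), hf,
        show (p + 1) * R + x - R = p * R + x by rw [add_mul]; omega]
      simp only [List.getElem_cons_succ]
      exact ih (by simpa using hp)

/-- The order of the patterns comes from an order of the boxes. -/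
theorem exists_boxes {σ : Labeling d n q} {L : List (Labeling d r q)}
    (hL : (L : Multiset (Labeling d r q)) = profile r σ) :
    ∃ w : List (Box d n r), L = w.map (restrict σ) ∧ w.Nodup ∧ ∀ b, b ∈ w := by
  have h1 : L.Perm ((Finset.univ : Finset (Box d n r)).toList.map (restrict σ)) := by
    rw [← Multiset.coe_eq_coe, hL, ← Multiset.map_coe, Finset.coe_toList]
    rfl
  have h2 : List.Forall₂ (fun y b => y = restrict σ b)
      ((Finset.univ : Finset (Box d n r)).toList.map (restrict σ)) Finset.univ.toList := by
    rw [List.forall₂_map_left_iff, List.forall₂_same]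
    exact fun _ _ => rfl
  obtain ⟨w, hw, hp⟩ := List.perm_comp_forall₂ h1 h2
  refine ⟨w, ?_, hp.nodup_iff.2 (Finset.nodup_toList _), fun b => hp.mem_iff.2 (by simp)⟩
  clear hp h1 h2 hL
  induction hw with
  | nil => rfl
  | cons h _ ih => rw [h, ih, List.map_cons]

theorem card_box (hr : 1 ≤ r) (hrn : r ≤ n) : Fintype.card (Box d n r) = (n - r + 1) ^ d := by
  let e : Box d n r ≃ (Fin d → Fin (n - r + 1)) :=
    { toFun := fun b i => ⟨b.1 i, by have := b.2 i; omega⟩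
      invFun := fun f => ⟨fun i => ⟨f i, by have := (f i).2; omega⟩,
        fun i => by have := (f i).2; simp only; omega⟩
      left_inv := fun b => rfl
      right_inv := fun f => rfl }
  rw [Fintype.card_congr e, Fintype.card_fun, Fintype.card_fin, Fintype.card_fin]

/-- The smallest corner of the `p`-th box of a list. -/
def corner (w : List (Box d n r)) (p : ℕ) : Fin d → ℤ :=
  fun i => if h : p < w.length then ((w[p].1 i : ℕ) : ℤ) else 0

theorem describes_map_restrict (hr : 1 ≤ r) (hrn : r ≤ n) (σ : Labeling d n q)
    {w : List (Box d n r)} (hw : w.Nodup) (hmem : ∀ b, b ∈ w) {γ β pw : ℕ → ℕ}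
    (hγ : ∀ k < r ^ d, γ k = address r n d k)
    (hβ : ∀ k < (n - r + 1) ^ d, β k = address (n - r + 1) n d k) (hpw : ∀ i < d, pw i = n ^ i) :
    Describes n r (ext σ) γ β (fun k => ((w.map (restrict σ)).flatMap labelList).getD k 0) pw
      (r ^ d) ((n - r + 1) ^ d) (vertexAddress n) (corner w) (digitPoint d r)
      (digitPoint d (n - r + 1)) := by
  have hn : 0 < n := by omega
  have hlen : w.length = (n - r + 1) ^ d := by
    classical
    rw [← card_box hr hrn, ← List.toFinset_card_of_nodup hw, ← Finset.card_univ]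
    congr 1
    ext b
    simp [hmem b]
  have hcorner : ∀ p (hp : p < w.length), corner w p = fun i => ((w[p].1 i : ℕ) : ℤ) :=
    fun p hp => by funext i; rw [corner, dif_pos hp]
  have hsite : ∀ p < (n - r + 1) ^ d, IsSite n r (corner w p) := by
    intro p hp i
    rw [hcorner p (by omega)]
    have := w[p].2 i
    simp only
    omega
  have hoff : ∀ x, digitPoint d r x ∈ cube r (0 : Fin d → ℤ) := by
    intro x
    rw [mem_cube]
    intro i
    have h1 := digitPoint_nonneg (d := d) (m := r) x i
    have h2 := digitPoint_lt (d := d) (m := r) (by omega) x i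
    simp only [Pi.zero_apply]
    omega
  refine ⟨vertexAddress_injOn hn, fun x _ => hoff x, fun u hu => ?_, hsite, fun c hc => ?_,
    fun p hp p' hp' h => ?_, fun k _ i => ?_, fun c hc => ?_, fun x hx => ?_, fun k hk x hx => ?_,
    fun i x hx => ?_, fun p hp x hx => ?_⟩
  · refine exists_digitPoint fun i => ?_
    have := mem_cube.1 hu i
    simp only [Pi.zero_apply] at this
    omega
  · let b : Box d n r := ⟨fun i => ⟨(c i).toNat, by have := hc i; omega⟩, fun i => by
      have := hc i
      simp only
      omega⟩
    obtain ⟨p, hp, hpb⟩ := List.getElem_of_mem (hmem b)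
    refine ⟨p, by omega, ?_⟩
    rw [hcorner p hp, hpb]
    funext i
    have := hc i
    simp only [b]
    omega
  · rw [hcorner p (by omega), hcorner p' (by omega)] at h
    refine (hw.getElem_inj_iff (hi := by omega) (hj := by omega)).1 (Subtype.ext ?_)
    funext i
    have := congrFun h i
    simp only [Nat.cast_inj] at this
    exact Fin.ext this
  · have h1 := digitPoint_nonneg (d := d) (m := n - r + 1) k i
    have h2 := digitPoint_lt (d := d) (m := n - r + 1) (by omega) k i
    omega
  · refine exists_digitPoint fun i => ?_
    have := hc i
    omega
  · rw [hγ x hx, address_eq, zero_add, add_zero]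
  · rw [hγ x hx, hβ k hk, address_eq, address_eq,
      vertexAddress_add (digitPoint_nonneg k) (digitPoint_nonneg x), add_comm]
  · rw [hγ x hx, hpw i i.2, address_eq, vertexAddress_add (fun j => ?_) (digitPoint_nonneg x),
      vertexAddress_single, add_comm]
    rw [Pi.single_apply]
    split_ifs <;> norm_num
  · rw [getD_flatMap (R := r ^ d) (fun a => by simp [labelList]) (by simpa [hlen] using hp) hx,
      List.getElem_map]
    have hv : corner w p + digitPoint d r x ∈ vertices d n :=
      cube_subset_vertices (hsite p hp) (add_mem_cube.2 (hoff x))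
    rw [ext_eq hn σ hv]
    have hx' : x < (labelList (restrict σ w[p])).length := by simpa [labelList] using hx
    rw [List.getD_eq_getElem _ _ hx']
    simp only [labelList, List.getElem_ofFn]
    have e : (fun i => (⟨(w[p].1 i : ℕ) + (finFunctionFinEquiv.symm (⟨x, hx⟩ : Fin (r ^ d)) i : ℕ),
        by have := w[p].2 i; omega⟩ : Fin n)) = toVertex hn (corner w p + digitPoint d r x) := by
      funext i
      have h1 := w[p].2 i
      have h2 := (finFunctionFinEquiv.symm (⟨x, hx⟩ : Fin (r ^ d)) i).2
      rw [hcorner p (by omega), digitPoint_val (⟨x, hx⟩ : Fin (r ^ d))]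
      refine Fin.ext ?_
      simp only [toVertex, Pi.add_apply]
      rw [← Nat.cast_add, Int.toNat_natCast, Nat.mod_eq_of_lt (by omega)]
    exact congrArg (fun v => (σ v : ℕ)) e

/-! ### Recovery and identifiability -/

theorem halts_inputState (hr : 1 ≤ r) (hrn : r ≤ n) (L : List (Labeling d r q)) :
    ∃ t ≤ (timeBound d).eval n, ∃ s, Run (reconstruct d) (inputState n L) t s ∧
      ∃ γ β pw : ℕ → ℕ, (∀ k < r ^ d, γ k = address r n d k) ∧
      (∀ k < (n - r + 1) ^ d, β k = address (n - r + 1) n d k) ∧ (∀ i < d, pw i = n ^ i) ∧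
      ∀ k < n ^ d, s.arr 1 k = finalLabels γ β (fun k => (L.flatMap labelList).getD k 0) pw
        (r ^ d) ((n - r + 1) ^ d) (n ^ d) d k - 1 :=
  halts_reconstruct hr hrn rfl rfl (by simp [inputState]) fun a ha => by simp [inputState, ha]

/-- The program recovers every fillable labeling from its profile. -/
theorem Fillable.outputs {σ : Labeling d n q} (hσ : Fillable r σ) (hr : 1 ≤ r) (hrn : r ≤ n)
    {L : List (Labeling d r q)} (hL : (L : Multiset (Labeling d r q)) = profile r σ) :
    ∃ t ≤ (timeBound d).eval n, ∃ s, Run (reconstruct d) (inputState n L) t s ∧ s.Outputs σ := by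
  obtain ⟨t, ht, s, hrun, γ, β, pw, hγ, hβ, hpw, hs⟩ := halts_inputState hr hrn L
  refine ⟨t, ht, s, hrun, fun v => ?_⟩
  obtain ⟨w, rfl, hw, hmem⟩ := exists_boxes hL
  have hn : 0 < n := by omega
  have H := describes_map_restrict hr hrn σ hw hmem hγ hβ hpw
  have hv : (fun i => ((v i : ℕ) : ℤ)) ∈ vertices d n := by
    rw [mem_vertices]
    intro i
    have := (v i).2
    omega
  have e : toVertex hn (fun i => ((v i : ℕ) : ℤ)) = v := by
    funext i
    ext
    simp [toVertex, Nat.mod_eq_of_lt (v i).2]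
  have h1 := H.finalLabels_eq hσ hrn rfl hv
  rw [vertexAddress_eq hn hv, ext_eq hn σ hv, e] at h1
  rw [hs _ (finFunctionFinEquiv v).2, h1, Nat.add_sub_cancel]

/-- The output is a function of the profile, so fillable labelings with equal profiles are equal. -/
theorem Fillable.eq_of_profile_eq {σ σ' : Labeling d n q} (hσ : Fillable r σ) (hσ' : Fillable r σ')
    (hr : 1 ≤ r) (hrn : r ≤ n) (h : profile r σ = profile r σ') : σ = σ' := by
  obtain ⟨L, hL⟩ := Quot.exists_rep (profile r σ)
  obtain ⟨t, -, s, hs, ho⟩ := hσ.outputs hr hrn hL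
  obtain ⟨t', -, s', hs', ho'⟩ := hσ'.outputs hr hrn (hL.trans h)
  obtain rfl := hs.unique hs'
  funext v
  exact Fin.ext ((ho v).symm.trans (ho' v))

theorem AboveThreshold.eventually {c ε : ℝ} {r : ℕ → ℕ} (h : AboveThreshold d q c ε r) :
    ∀ᶠ n in atTop, 1 ≤ r n ∧ r n ≤ n := h.mono fun _ hn => ⟨hn.1, hn.2.1⟩

theorem identifiable_whp {r : ℕ → ℕ} (hq : 0 < q) (hr : ∀ᶠ n in atTop, 1 ≤ r n ∧ r n ≤ n)
    (h : WithHighProbability d q fun n σ => Fillable (r n) σ) :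
    WithHighProbability d q fun n σ => Identifiable (r n) σ := by
  refine identifiable_of_injOn hq r _ h ?_
  filter_upwards [hr] with n hn σ σ' hσ hσ' hp
  exact hσ.eq_of_profile_eq hσ' hn.1 hn.2 hp

theorem recoverableInPolyTime {S : (ℕ → ℕ) → Prop} (hq : 0 < q)
    (hr : ∀ r, S r → ∀ᶠ n in atTop, 1 ≤ r n ∧ r n ≤ n)
    (h : ∀ r, S r → WithHighProbability d q fun n σ => Fillable (r n) σ) :
    RecoverableInPolyTime d q S := by
  refine ⟨reconstruct d, timeBound d, fun n r h1 hrn σ L _ => ?_, fun r hS => ?_⟩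
  · obtain ⟨t, ht, s, hs, -⟩ := halts_inputState h1 hrn L
    exact ⟨t, ht, s, hs⟩
  · refine (h r hS).mono hq ?_
    filter_upwards [hr r hS] with n hn σ hσ L hL
    exact hσ.outputs hn.1 hn.2 hL

end describes

end Shotgun

theorem theorem1 (ε : ℝ) (hε : 0 < ε) (q : ℕ) (hq : 2 ≤ q) :
    ((∀ r : ℕ → ℕ, Shotgun.AboveThreshold 1 q 2 ε r →
        Shotgun.WithHighProbability 1 q fun n σ => Shotgun.Identifiable (r n) σ) ∧
      (∀ r : ℕ → ℕ, Shotgun.BelowThreshold 1 q 2 ε r →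
        Shotgun.WithHighProbability 1 q fun n σ => ¬ Shotgun.Identifiable (r n) σ) ∧
      Shotgun.RecoverableInPolyTime 1 q (Shotgun.AboveThreshold 1 q 2 ε)) ∧
    (∀ d : ℕ, 2 ≤ d →
      (∀ r : ℕ → ℕ, Shotgun.AboveThreshold d q d ε r →
        Shotgun.WithHighProbability d q fun n σ => Shotgun.Identifiable (r n) σ) ∧
      (∀ r : ℕ → ℕ, Shotgun.BelowThreshold d q d ε r →
        Shotgun.WithHighProbability d q fun n σ => ¬ Shotgun.Identifiable (r n) σ) ∧
      Shotgun.RecoverableInPolyTime d q (Shotgun.AboveThreshold d q d ε)) := by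
  have hq0 : 0 < q := by omega
  refine ⟨⟨fun r h => ?_, fun r h => ?_, ?_⟩, fun d hd => ⟨fun r h => ?_, fun r h => ?_, ?_⟩⟩
  · exact Shotgun.identifiable_whp hq0 h.eventually (Shotgun.fillable_whp_one hε hq h)
  · exact Shotgun.not_identifiable_whp_one hε hq h
  · exact Shotgun.recoverableInPolyTime hq0 (fun r h => h.eventually)
      fun r h => Shotgun.fillable_whp_one hε hq h
  · exact Shotgun.identifiable_whp hq0 h.eventually (Shotgun.fillable_whp_of_two_le hε hd hq h)
  · exact Shotgun.not_identifiable_whp hε (by omega) hq h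
  · exact Shotgun.recoverableInPolyTime hq0 (fun r h => h.eventually)
      fun r h => Shotgun.fillable_whp_of_two_le hε hd hq h
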